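/- Let $(M,d)$ be a complete metric space with a $\sigma$-finite Radon measure $\mathbf m$ (a locally finite Borel measure, inner regular with respect to compact sets), and let $1<p<\infty$. Convergence in $L^0(\mathbf m)$ means convergence in measure on sets of finite measure. **Modules of functionals.** Let $V$ be a real vector space with a linear map $V\to L^0(\mathbf m)$ (so that elements of $V$ may be regarded as functions) and let $f\mapsto g_f$, $V\to L^p_+(\mathbf m)$, be subadditive and absolutely homogeneous. The module generated by this functional is the completion of the space of countable families $(f_i,A_i)$, where $(A_i)$ is a Borel partition of $M$, $f_i\in V$ and $\sum_i\int_{A_i}g_{f_i}^p\,d\mathbf m<\infty$, two families $(f_i,A_i)$, $(h_j,B_j)$ being identified if $g_{f_i-h_j}=0$ a.e. on $A_i\cap B_j$ for all $i,j$, with respect to the norm $\|\,|v|\,\|_{L^p(\mathbf m)}$, where $|(f_i,A_i)|=g_{f_i}$ on $A_i$. The pointwise norm $|\cdot|$ extends to the completion with values in $L^p(\mathbf m)$, and so does the multiplication by $L^\infty(\mathbf m)$ that is given for countably valued $a=\sum_j a_j\chi_{B_j}$ by $a\cdot(f_i,A_i)=(a_jf_i,A_i\cap B_j)$. The differential of $f\in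 V$ is $df=(f,M)$. The module is *weakly reflexive* if every bounded sequence $df_n$ with $f_n\in V$ convergent in $L^0(\mathbf m)$ has a weakly convergent subsequence. **The Lipschitz module and the cotangent module.** Let $D_{\rm lip}$ be the space of Lipschitz functions $f:M\to\mathbb R$ with $\operatorname{lip}f\in L^p(\mathbf m)$, where $\operatorname{lip}f(x)=\limsup_{y\to x}|f(y)-f(x)|/d(y,x)$ (and $0$ at isolated points). The functional $f\mapsto\operatorname{lip}f$ on $D_{\rm lip}$ generates the $L^p$-Lipschitz module $L^p_{\rm lip}(T^*M)$ with differential $d_{\rm lip}$. Let $D_p\subset L^0(\mathbf m)$ be the set of all $f$ with $\inf\{\liminf_n\int(\operatorname{lip}f_n)^p\,d\mathbf m : D_{\rm lip}\ni f_n\to f\text{ in }L^0(\mathbf m)\}<\infty$. For $f\in D_p$ the relaxed slope $|Df|_{*,p}$ is the greatest $G\in L^p(\mathbf m)$ such that $G\le\tilde G$ a.e. whenever $D_{\rm lip}\ni f_n\to f$ in $L^0(\mathbf m)$ and $\operatorname{lip}f_n\rightharpoonup\tilde G$ weakly in $L^p(\mathbf m)$. The functional $f\mapsto|Df|_{*,p}$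 on $D_p$ generates the $L^p$-cotangent module $L^p(T^*M)$ with differential $d_p$. **The $\text{Lipschitz}_0$ module.** Let $L^p_{\rm lip_0}(T^*M)$ be the closed $L^\infty(\mathbf m)$-submodule of $L^p_{\rm lip}(T^*M)$ generated by all $\omega$ for which there are $f_n\in D_{\rm lip}$ with $f_n\to0$ in $L^0(\mathbf m)$ and $d_{\rm lip}f_n\to\omega$ strongly in $L^p_{\rm lip}(T^*M)$. **Theorem.** Assume that $L^p_{\rm lip}(T^*M)$ is weakly reflexive. Then: 1. $L^p_{\rm lip_0}(T^*M)$ is an $L^p(\mathbf m)$-normed submodule of $L^p_{\rm lip}(T^*M)$: it is a closed subspace, stable under multiplication by $L^\infty(\mathbf m)$, with the following two properties. Locality: if $\chi_{A_n}\cdot v=0$ for all $n$, then $\chi_{\bigcup_nA_n}\cdot v=0$. Glueing: if $\chi_{A_i\cap A_j}\cdot v_i=\chi_{A_i\cap A_j}\cdot v_j$ for all $i,j$ and the norms $\|\sum_{i<n}\chi_{A_i}\cdot v_i\|$ are bounded, then there is $w$ in the submodule with $\chi_{A_i}\cdot w=\chi_{A_i}\cdot v_i$ for all $i$ and $\|w\|\le\liminf_n\|\sum_{i<n}\chi_{A_i}\cdot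 v_i\|$. 2. There is a surjective linear isometry $$\Phi:\ L^p_{\rm lip}(T^*M)\big/L^p_{\rm lip_0}(T^*M)\ \longrightarrow\ L^p(T^*M)$$ (the quotient carrying the quotient norm) that is $L^\infty(\mathbf m)$-linear, satisfies $\Phi([d_{\rm lip}f])=d_pf$ for all $f\in D_{\rm lip}$, and preserves pointwise norms: $|\Phi([v])|$ is the greatest lower bound in $L^p(\mathbf m)$ of $\{|v+w| : w\in L^p_{\rm lip_0}(T^*M)\}$. 3. $d_{\rm lip}$ is closable as an operator from $L^0(\mathbf m)$ to $L^p_{\rm lip}(T^*M)$ (if $f_n\to g$ and $h_n\to g$ in $L^0(\mathbf m)$ with $f_n,h_n\in D_{\rm lip}$, $d_{\rm lip}f_n\to\omega$ and $d_{\rm lip}h_n\to\eta$, then $\omega=\eta$) if and only if $L^p_{\rm lip_0}(T^*M)=\{0\}$. 4. In that case there is a surjective linear isometry $L^p_{\rm lip}(T^*M)\to L^p(T^*M)$ that is $L^\infty(\mathbf m)$-linear, preserves pointwise norms and sends $d_{\rm lip}f$ to $d_pf$ for all $f\in D_{\rm lip}$; and $|Df|_{*,p}=\operatorname{lip}f$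 $\mathbf m$-a.e. for every Lipschitz function $f$ whose class belongs to $D_p$. -/

import Mathlib

set_option linter.unusedSectionVars false

open MeasureTheory Filter Topology Set
open scoped NNReal ENNReal

/-- The standing integrability exponent `p` is a real number in `(1, ∞)`. -/
instance one_le_exponent (p : ℝ≥0) [hp : Fact (1 < p)] : Fact (1 ≤ (p : ℝ≥0∞)) :=
  ⟨by exact_mod_cast hp.out.le⟩

noncomputable section

namespace NormedModules

section General

variable {M : Type*} [MeasurableSpace M]

/-- Convergence in `L⁰(μ)`: convergence in measure on every set of finite measure. -/
def TendstoL0 {μ : Measure M} (f : ℕ → M →ₘ[μ] ℝ) (g : M →ₘ[μ] ℝ) : Prop :=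
  ∀ E : Set M, MeasurableSet E → μ E < ∞ →
    TendstoInMeasure (μ.restrict E) (fun n => (f n : M → ℝ)) atTop (g : M → ℝ)

/-- Weak convergence of a sequence in a normed space. -/
def TendstoWeakly {E : Type*} [NormedAddCommGroup E] [NormedSpace ℝ E] (u : ℕ → E) (a : E) :
    Prop :=
  ∀ φ : StrongDual ℝ E, Tendsto (fun n => φ (u n)) atTop (𝓝 (φ a))

/-- `s` takes countably many values, each on a measurable set; equivalently, `s` is given by a
countable measurable partition and one value on each piece. -/
def IsPiecewiseConst {X : Type*} (s : M → X) : Prop :=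
  (range s).Countable ∧ ∀ v, MeasurableSet (s ⁻¹' {v})

theorem IsPiecewiseConst.const {X : Type*} (v : X) : IsPiecewiseConst (fun _ : M => v) := by
  refine ⟨(countable_singleton v).mono ?_, fun w => ?_⟩
  · rintro _ ⟨x, rfl⟩; rfl
  · by_cases h : v = w <;> simp [h]

theorem IsPiecewiseConst.map₂ {X Y Z : Type*} (op : X → Y → Z) {s : M → X} {t : M → Y}
    (hs : IsPiecewiseConst s) (ht : IsPiecewiseConst t) :
    IsPiecewiseConst (fun x => op (s x) (t x)) := by
  refine ⟨(hs.1.image2 ht.1 op).mono ?_, fun z => ?_⟩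
  · rintro _ ⟨x, rfl⟩
    exact ⟨s x, mem_range_self x, t x, mem_range_self x, rfl⟩
  · have : (fun x => op (s x) (t x)) ⁻¹' {z} =
        ⋃ v ∈ range s, ⋃ w ∈ range t, ⋃ (_ : op v w = z), (s ⁻¹' {v} ∩ t ⁻¹' {w}) := by
      ext x
      simp only [mem_preimage, mem_singleton_iff, mem_iUnion, mem_inter_iff, exists_prop]
      constructor
      · intro h
        exact ⟨s x, mem_range_self x, t x, mem_range_self x, h, rfl, rfl⟩
      · rintro ⟨v, -, w, -, h, rfl, rfl⟩
        exact h
    rw [this]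
    refine MeasurableSet.biUnion hs.1 fun v _ => MeasurableSet.biUnion ht.1 fun w _ =>
      MeasurableSet.iUnion fun _ => (hs.2 v).inter (ht.2 w)

theorem IsPiecewiseConst.of_countable {X : Type*} [MeasurableSpace X] [MeasurableSingletonClass X]
    {s : M → X} (h : (range s).Countable) (hs : Measurable s) : IsPiecewiseConst s :=
  ⟨h, fun v => hs (measurableSet_singleton v)⟩

theorem IsPiecewiseConst.measurable_eval {X : Type*} {s : M → X} (hs : IsPiecewiseConst s)
    {g : X → M → ℝ} (hg : ∀ v, Measurable (g v)) : Measurable (fun x => g (s x) x) := by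
  intro B hB
  have : (fun x => g (s x) x) ⁻¹' B = ⋃ v ∈ range s, (s ⁻¹' {v} ∩ g v ⁻¹' B) := by
    ext x
    simp only [mem_preimage, mem_iUnion, mem_inter_iff, mem_singleton_iff, exists_prop]
    constructor
    · intro h
      exact ⟨s x, mem_range_self x, rfl, h⟩
    · rintro ⟨v, -, rfl, h⟩
      exact h
  rw [this]
  exact MeasurableSet.biUnion hs.1 fun v _ => (hs.2 v).inter (hg v hB)

/-- An `L^p`-valued functional on a real vector space `V` of functions (`toL0` sends an element
of `V` to its class in `L⁰(μ)`): `val f = g_f` is non-negative, subadditive and absolutely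
homogeneous. -/
structure LpFunctional (μ : Measure M) (p : ℝ≥0) [Fact (1 < p)] (V : Type*) [AddCommGroup V]
    [Module ℝ V] where
  toL0 : V →ₗ[ℝ] (M →ₘ[μ] ℝ)
  val : V → Lp ℝ p μ
  nonneg' : ∀ f, 0 ≤ val f
  add_le' : ∀ f h, val (f + h) ≤ val f + val h
  smul' : ∀ (c : ℝ) (f : V), val (c • f) = |c| • val f

namespace LpFunctional

variable {μ : Measure M} {p : ℝ≥0} [Fact (1 < p)] {V : Type*} [AddCommGroup V] [Module ℝ V]
  (F : LpFunctional μ p V)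

theorem val_zero : F.val 0 = 0 := by
  have := F.smul' 0 0
  simpa using this

/-- The function `x ↦ g_{s(x)}(x)` attached to `s : M → V`. -/
def eval (s : M → V) (x : M) : ℝ := F.val (s x) x

theorem measurable_eval {s : M → V} (hs : IsPiecewiseConst s) : Measurable (F.eval s) :=
  hs.measurable_eval fun v => (Lp.stronglyMeasurable (F.val v)).measurable

theorem ae_eval {s : M → V} (hs : IsPiecewiseConst s) {P : V → M → Prop}
    (h : ∀ v, ∀ᵐ x ∂μ, P v x) : ∀ᵐ x ∂μ, P (s x) x := by
  have := (ae_ball_iff hs.1).2 fun v _ => h v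
  filter_upwards [this] with x hx using hx (s x) (mem_range_self x)

theorem ae_nonneg (v : V) : ∀ᵐ x ∂μ, 0 ≤ F.val v x := by
  have := (Lp.coeFn_nonneg (F.val v)).2 (F.nonneg' v)
  exact this

theorem ae_eval_nonneg {s : M → V} (hs : IsPiecewiseConst s) : ∀ᵐ x ∂μ, 0 ≤ F.eval s x :=
  ae_eval hs F.ae_nonneg

theorem ae_add_le (v w : V) : ∀ᵐ x ∂μ, F.val (v + w) x ≤ F.val v x + F.val w x := by
  have h := (Lp.coeFn_le _ _).2 (F.add_le' v w)
  filter_upwards [h, Lp.coeFn_add (F.val v) (F.val w)] with x hx h2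
  rw [h2] at hx
  exact hx

theorem ae_smul (c : ℝ) (v : V) : ∀ᵐ x ∂μ, F.val (c • v) x = |c| * F.val v x := by
  rw [F.smul' c v]
  filter_upwards [Lp.coeFn_smul (|c|) (F.val v)] with x hx
  simpa using hx

theorem ae_eval_add_le {s t : M → V} (hs : IsPiecewiseConst s) (ht : IsPiecewiseConst t) :
    ∀ᵐ x ∂μ, F.eval (s + t) x ≤ F.eval s x + F.eval t x :=
  ae_eval (s := fun x => (s x, t x)) (hs.map₂ Prod.mk ht)
    (P := fun q x => F.val (q.1 + q.2) x ≤ F.val q.1 x + F.val q.2 x)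
    fun q => F.ae_add_le q.1 q.2

theorem ae_eval_smul {c : M → ℝ} {s : M → V} (hc : IsPiecewiseConst c) (hs : IsPiecewiseConst s) :
    ∀ᵐ x ∂μ, F.eval (fun x => c x • s x) x = |c x| * F.eval s x :=
  ae_eval (s := fun x => (c x, s x)) (hc.map₂ Prod.mk hs)
    (P := fun q x => F.val (q.1 • q.2) x = |q.1| * F.val q.2 x)
    fun q => F.ae_smul q.1 q.2

/-- Pre-forms: families `(f_i, A_i)` with `(A_i)` a countable measurable partition of `M`,
`f_i ∈ V` and `∑ i, ∫_{A_i} g_{f_i}^p dμ < ∞`, written as maps `s : M → V` with `s = f_i` on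
`A_i`. -/
def pfmSubmodule : Submodule ℝ (M → V) where
  carrier := {s | IsPiecewiseConst s ∧ MemLp (F.eval s) p μ}
  zero_mem' := by
    refine ⟨IsPiecewiseConst.const 0, ?_⟩
    exact Lp.memLp (F.val 0)
  add_mem' := by
    rintro s t ⟨hs, hs'⟩ ⟨ht, ht'⟩
    have hst : IsPiecewiseConst (s + t) := hs.map₂ (· + ·) ht
    refine ⟨hst, (hs'.add ht').mono (F.measurable_eval hst).aestronglyMeasurable ?_⟩
    filter_upwards [F.ae_eval_add_le hs ht, F.ae_eval_nonneg hst] with x hx h0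
    rw [Real.norm_of_nonneg h0]
    exact hx.trans (le_abs_self _)
  smul_mem' := by
    rintro c s ⟨hs, hs'⟩
    have hc : IsPiecewiseConst (fun x => c • s x) := (IsPiecewiseConst.const c).map₂ (· • ·) hs
    refine ⟨hc, (hs'.const_mul |c|).ae_eq ?_⟩
    filter_upwards [F.ae_eval_smul (IsPiecewiseConst.const c) hs] with x hx
    exact hx.symm

/-- The vector space of pre-forms generated by the functional. -/
def Pfm : Type _ := F.pfmSubmodule

instance : AddCommGroup F.Pfm := inferInstanceAs (AddCommGroup F.pfmSubmodule)

instance : Module ℝ F.Pfm := inferInstanceAs (Module ℝ F.pfmSubmodule)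

variable {F}

/-- The map `M → V` underlying a pre-form. -/
def Pfm.fn (s : F.Pfm) : M → V := Subtype.val (p := fun s => s ∈ F.pfmSubmodule) s

theorem Pfm.isPiecewiseConst (s : F.Pfm) : IsPiecewiseConst s.fn :=
  (Subtype.property (p := fun s => s ∈ F.pfmSubmodule) s).1

theorem Pfm.memLp (s : F.Pfm) : MemLp (F.eval s.fn) p μ :=
  (Subtype.property (p := fun s => s ∈ F.pfmSubmodule) s).2

variable (F)

/-- Constructor for pre-forms. -/
def mkPfm (s : M → V) (hs : IsPiecewiseConst s) (h : MemLp (F.eval s) p μ) : F.Pfm :=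
  (⟨s, hs, h⟩ : F.pfmSubmodule)

variable {F}

/-- The pointwise norm `|s| = g_{f_i}` on `A_i` of a pre-form, as an element of `L^p(μ)`. -/
def Pfm.pnorm (s : F.Pfm) : Lp ℝ p μ := s.memLp.toLp (F.eval s.fn)

theorem Pfm.coeFn_pnorm (s : F.Pfm) : s.pnorm =ᵐ[μ] F.eval s.fn := s.memLp.coeFn_toLp

theorem Pfm.pnorm_nonneg (s : F.Pfm) : 0 ≤ s.pnorm := by
  rw [← Lp.coeFn_nonneg]
  filter_upwards [s.coeFn_pnorm, F.ae_eval_nonneg s.isPiecewiseConst] with x h1 h2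
  rw [h1]; exact h2

theorem Pfm.pnorm_add_le (s t : F.Pfm) : (s + t).pnorm ≤ s.pnorm + t.pnorm := by
  rw [← Lp.coeFn_le]
  filter_upwards [(s + t).coeFn_pnorm, s.coeFn_pnorm, t.coeFn_pnorm,
    Lp.coeFn_add s.pnorm t.pnorm,
    F.ae_eval_add_le s.isPiecewiseConst t.isPiecewiseConst] with x h1 h2 h3 h4 h5
  rw [h1, h4, Pi.add_apply, h2, h3]
  exact h5

theorem Pfm.pnorm_smul (c : ℝ) (s : F.Pfm) : (c • s).pnorm = |c| • s.pnorm := by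
  refine Lp.ext ?_
  filter_upwards [(c • s).coeFn_pnorm, s.coeFn_pnorm, Lp.coeFn_smul (|c|) s.pnorm,
    F.ae_eval_smul (IsPiecewiseConst.const c) s.isPiecewiseConst] with x h1 h2 h3 h4
  rw [h1, h3, Pi.smul_apply, h2, smul_eq_mul]
  exact h4

theorem norm_mono {u v : Lp ℝ p μ} (hu : 0 ≤ u) (h : u ≤ v) : ‖u‖ ≤ ‖v‖ :=
  norm_le_norm_of_abs_le_abs (by rwa [abs_of_nonneg hu, abs_of_nonneg (hu.trans h)])

variable (F)

/-- The seminorm `‖s‖ = ‖ |s| ‖_{L^p}` on pre-forms. -/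
def pfmSeminorm : Seminorm ℝ F.Pfm :=
  Seminorm.of (fun s => ‖s.pnorm‖)
    (fun s t => (norm_mono (s + t).pnorm_nonneg (s.pnorm_add_le t)).trans (norm_add_le _ _))
    (fun c s => by rw [Pfm.pnorm_smul, norm_smul, Real.norm_eq_abs, abs_abs, Real.norm_eq_abs])

instance : SeminormedAddCommGroup F.Pfm :=
  F.pfmSeminorm.toAddGroupSeminorm.toSeminormedAddCommGroup

theorem norm_pfm (s : F.Pfm) : ‖s‖ = ‖s.pnorm‖ := rfl

instance : NormedSpace ℝ F.Pfm where
  norm_smul_le c s := (F.pfmSeminorm.smul' c s).le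

/-- The module generated by the functional: the completion of the pre-forms modulo
`s ∼ t ↔ |s - t| = 0` a.e. (the separated completion performs the quotient). -/
abbrev Mod : Type _ := UniformSpace.Completion F.Pfm

/-- The differential `d f = [f, M]`. -/
def d : V →ₗ[ℝ] F.Mod where
  toFun f := ((F.mkPfm (fun _ => f) (IsPiecewiseConst.const f) (Lp.memLp (F.val f)) : F.Pfm) :
    F.Mod)
  map_add' f h := by
    rw [← UniformSpace.Completion.coe_add]; rfl
  map_smul' c f := by
    rw [RingHom.id_apply, ← UniformSpace.Completion.coe_smul]; rfl

/-- The pointwise norm `|·| : Mod → L^p(μ)`: the continuous extension of the pointwise norm of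
pre-forms. -/
def pnorm : F.Mod → Lp ℝ p μ :=
  UniformSpace.Completion.extension Pfm.pnorm

theorem uniformContinuous_pnorm : UniformContinuous (Pfm.pnorm : F.Pfm → Lp ℝ p μ) := by
  refine LipschitzWith.uniformContinuous (K := 1) (LipschitzWith.of_dist_le_mul fun s t => ?_)
  rw [NNReal.coe_one, one_mul, dist_eq_norm, dist_eq_norm]
  have key : ∀ s t : F.Pfm, s.pnorm - t.pnorm ≤ (s - t).pnorm := fun s t => by
    have := (s - t).pnorm_add_le t
    rw [sub_add_cancel] at this
    exact sub_le_iff_le_add.2 this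
  have hsymm : (t - s).pnorm = (s - t).pnorm := by
    have := Pfm.pnorm_smul (-1) (s - t)
    simpa using this
  refine norm_le_norm_of_abs_le_abs ?_
  rw [abs_of_nonneg (s - t).pnorm_nonneg]
  refine abs_le'.2 ⟨key s t, ?_⟩
  rw [neg_sub, ← hsymm]
  exact key t s

theorem pnorm_coe (s : F.Pfm) : F.pnorm (s : F.Mod) = s.pnorm :=
  UniformSpace.Completion.extension_coe F.uniformContinuous_pnorm s

theorem pnorm_d (f : V) : F.pnorm (F.d f) = F.val f := by
  refine (F.pnorm_coe _).trans ?_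
  exact Lp.toLp_coeFn (F.val f) _


/-- Multiplication of a pre-form by a bounded function `c` with countably many values:
`c · (f_i, A_i) = (c_j f_i, A_i ∩ B_j)` if `c = c_j` on `B_j`. -/
def mulPfmFun (c : M → ℝ) (hc : IsPiecewiseConst c) (K : ℝ) (hK : ∀ᵐ x ∂μ, |c x| ≤ K)
    (s : F.Pfm) : F.Pfm :=
  F.mkPfm (fun x => c x • s.fn x) (hc.map₂ (· • ·) s.isPiecewiseConst) (by
    refine (s.memLp.const_mul K).mono
      (F.measurable_eval (hc.map₂ (· • ·) s.isPiecewiseConst)).aestronglyMeasurable ?_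
    filter_upwards [hK, F.ae_eval_smul hc s.isPiecewiseConst] with x h1 h2
    rw [h2, norm_mul, norm_mul, Real.norm_eq_abs, abs_abs]
    exact mul_le_mul_of_nonneg_right (h1.trans (le_abs_self K)) (norm_nonneg _))

theorem pnorm_mulPfmFun (c : M → ℝ) (hc : IsPiecewiseConst c) (K : ℝ) (hK : ∀ᵐ x ∂μ, |c x| ≤ K)
    (s : F.Pfm) : ∀ᵐ x ∂μ, (F.mulPfmFun c hc K hK s).pnorm x = |c x| * s.pnorm x := by
  filter_upwards [F.ae_eval_smul hc s.isPiecewiseConst, (F.mulPfmFun c hc K hK s).coeFn_pnorm,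
    s.coeFn_pnorm] with x h2 h3 h4
  rw [h3, h4]
  exact h2

theorem norm_mulPfmFun_le (c : M → ℝ) (hc : IsPiecewiseConst c) (K : ℝ)
    (hK : ∀ᵐ x ∂μ, |c x| ≤ K) (s : F.Pfm) : ‖F.mulPfmFun c hc K hK s‖ ≤ K * ‖s‖ := by
  rw [norm_pfm, norm_pfm]
  refine Lp.norm_le_mul_norm_of_ae_le_mul ?_
  filter_upwards [hK, F.pnorm_mulPfmFun c hc K hK s] with x h1 h2
  rw [h2, norm_mul, Real.norm_eq_abs, abs_abs]
  exact mul_le_mul_of_nonneg_right h1 (norm_nonneg _)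

/-- `mulPfmFun` as a continuous linear map. -/
def mulPfm (c : M → ℝ) (hc : IsPiecewiseConst c) (K : ℝ) (hK : ∀ᵐ x ∂μ, |c x| ≤ K) :
    F.Pfm →L[ℝ] F.Pfm :=
  LinearMap.mkContinuous
    { toFun := F.mulPfmFun c hc K hK
      map_add' := fun s t => Subtype.ext (funext fun x => smul_add (c x) (s.fn x) (t.fn x))
      map_smul' := fun r s => Subtype.ext (funext fun x => smul_comm (c x) r (s.fn x)) }
    K (F.norm_mulPfmFun_le c hc K hK)

theorem mulPfm_apply (c : M → ℝ) (hc : IsPiecewiseConst c) (K : ℝ) (hK : ∀ᵐ x ∂μ, |c x| ≤ K)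
    (s : F.Pfm) : F.mulPfm c hc K hK s = F.mulPfmFun c hc K hK s := rfl

/-- The approximation `⌊(n+1) a⌋ / (n+1)` of `a` by functions with countably many values. -/
def quant (n : ℕ) (a : M → ℝ) (x : M) : ℝ := (⌊((n : ℝ) + 1) * a x⌋ : ℝ) / ((n : ℝ) + 1)

theorem abs_quant_sub_le (n : ℕ) (a : M → ℝ) (x : M) :
    |quant n a x - a x| ≤ 1 / ((n : ℝ) + 1) := by
  have hn : (0 : ℝ) < (n : ℝ) + 1 := by positivity
  have h1 := Int.floor_le (((n : ℝ) + 1) * a x)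
  have h2 := (Int.lt_floor_add_one (((n : ℝ) + 1) * a x)).le
  have : quant n a x - a x = ((⌊((n : ℝ) + 1) * a x⌋ : ℝ) - ((n : ℝ) + 1) * a x) / ((n : ℝ) + 1) := by
    unfold quant; field_simp
  rw [this, abs_div, abs_of_pos hn]
  refine div_le_div_of_nonneg_right ?_ hn.le
  rw [abs_le]; constructor <;> linarith

theorem isPiecewiseConst_quant (n : ℕ) {a : M → ℝ} (ha : Measurable a) :
    IsPiecewiseConst (quant n a) := by
  refine IsPiecewiseConst.of_countable
    ((countable_range fun k : ℤ => (k : ℝ) / ((n : ℝ) + 1)).mono ?_) ?_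
  · rintro _ ⟨x, rfl⟩
    exact ⟨⌊((n : ℝ) + 1) * a x⌋, rfl⟩
  · unfold quant
    fun_prop

theorem ae_quant_le (n : ℕ) (a : Lp ℝ ∞ μ) : ∀ᵐ x ∂μ, |quant n a x| ≤ ‖a‖ + 1 := by
  have h0 : ∀ᵐ x ∂μ, ‖a x‖ₑ ≤ eLpNorm a ∞ μ := by
    rw [eLpNorm_exponent_top]
    exact enorm_ae_le_eLpNormEssSup a μ
  filter_upwards [h0] with x hx
  have hx : ‖a x‖ ≤ ‖a‖ := by
    rw [Lp.norm_def, ← toReal_enorm]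
    exact ENNReal.toReal_mono (Lp.eLpNorm_ne_top a) hx
  have h1 := abs_quant_sub_le n a x
  have h2 : 1 / ((n : ℝ) + 1) ≤ 1 := by
    rw [div_le_one (by positivity)]; linarith [Nat.cast_nonneg (α := ℝ) n]
  have h3 : |quant n a x| ≤ |quant n a x - a x| + |a x| := by
    simpa using abs_add_le (quant n a x - a x) (a x)
  rw [Real.norm_eq_abs] at hx
  linarith

/-- Multiplication by the approximation `quant n a` of `a ∈ L^∞(μ)`, extended to the module. -/
def mulApprox (a : Lp ℝ ∞ μ) (n : ℕ) : F.Mod →L[ℝ] F.Mod :=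
  (F.mulPfm (quant n a) (isPiecewiseConst_quant n (Lp.stronglyMeasurable a).measurable) (‖a‖ + 1)
    (ae_quant_le n a)).completion

theorem norm_mulApprox_sub_le (a : Lp ℝ ∞ μ) (n m : ℕ) :
    ‖F.mulApprox a n - F.mulApprox a m‖ ≤ 1 / ((n : ℝ) + 1) + 1 / ((m : ℝ) + 1) := by
  refine ContinuousLinearMap.opNorm_le_bound _ (by positivity) fun v => ?_
  induction v using UniformSpace.Completion.induction_on with
  | hp => exact isClosed_le (by fun_prop) (by fun_prop)
  | ih s =>
    rw [sub_apply, mulApprox, mulApprox,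
      ContinuousLinearMap.completion_apply_coe, ContinuousLinearMap.completion_apply_coe,
      ← UniformSpace.Completion.coe_sub, UniformSpace.Completion.norm_coe,
      UniformSpace.Completion.norm_coe]
    have hs := s.isPiecewiseConst
    have h1 := isPiecewiseConst_quant n (Lp.stronglyMeasurable a).measurable
    have h2 := isPiecewiseConst_quant m (Lp.stronglyMeasurable a).measurable
    have h3 : IsPiecewiseConst (fun x => quant n a x - quant m a x) := h1.map₂ (· - ·) h2
    have hb : ∀ x, |quant n a x - quant m a x| ≤ 1 / ((n : ℝ) + 1) + 1 / ((m : ℝ) + 1) := by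
      intro x
      have e1 := abs_quant_sub_le n a x
      have e2 := abs_quant_sub_le m a x
      have : quant n a x - quant m a x = (quant n a x - a x) - (quant m a x - a x) := by ring
      rw [this]
      exact (abs_sub _ _).trans (add_le_add e1 e2)
    have key : F.mulPfm (quant n a) h1 (‖a‖ + 1) (ae_quant_le n a) s -
        F.mulPfm (quant m a) h2 (‖a‖ + 1) (ae_quant_le m a) s =
        F.mulPfmFun _ h3 (1 / ((n : ℝ) + 1) + 1 / ((m : ℝ) + 1)) (ae_of_all _ hb) s := by
      rw [mulPfm_apply, mulPfm_apply]
      exact Subtype.ext (funext fun x => (sub_smul (quant n a x) (quant m a x) (s.fn x)).symm)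
    rw [key]
    exact F.norm_mulPfmFun_le _ _ _ _ s

theorem cauchySeq_mulApprox (a : Lp ℝ ∞ μ) : CauchySeq (F.mulApprox a) := by
  refine cauchySeq_of_le_tendsto_0 (fun N : ℕ => 2 * (1 / ((N : ℝ) + 1))) (fun n m N hn hm => ?_) ?_
  · rw [dist_eq_norm]
    refine (F.norm_mulApprox_sub_le a n m).trans ?_
    have e1 := one_div_le_one_div_of_le (by positivity : (0 : ℝ) < (N : ℝ) + 1)
      (by exact_mod_cast Nat.succ_le_succ hn : (N : ℝ) + 1 ≤ (n : ℝ) + 1)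
    have e2 := one_div_le_one_div_of_le (by positivity : (0 : ℝ) < (N : ℝ) + 1)
      (by exact_mod_cast Nat.succ_le_succ hm : (N : ℝ) + 1 ≤ (m : ℝ) + 1)
    linarith
  · simpa using tendsto_one_div_add_atTop_nhds_zero_nat.const_mul (2 : ℝ)

/-- The multiplication `v ↦ a · v` by `a ∈ L^∞(μ)` on the module: the limit in operator norm of
the multiplications by functions `a_n → a` with countably many values. -/
def mul (a : Lp ℝ ∞ μ) : F.Mod →L[ℝ] F.Mod := limUnder atTop (F.mulApprox a)

theorem tendsto_mulApprox (a : Lp ℝ ∞ μ) : Tendsto (F.mulApprox a) atTop (𝓝 (F.mul a)) :=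
  (F.cauchySeq_mulApprox a).tendsto_limUnder

/-- The indicator function `χ_A` as an element of `L^∞(μ)`. -/
def chi (μ : Measure M) (A : Set M) (hA : MeasurableSet A) : Lp ℝ ∞ μ :=
  ((memLp_top_const (1 : ℝ)).indicator hA : MemLp (A.indicator fun _ => (1 : ℝ)) ∞ μ).toLp _

/-- `N` is an `L^p(μ)`-normed submodule: a closed subspace, stable under multiplication by
`L^∞(μ)`, with the locality and the glueing property. -/
structure IsLpNormedSubmodule (N : Submodule ℝ F.Mod) : Prop where
  isClosed : IsClosed (N : Set F.Mod)
  mul_mem : ∀ (a : Lp ℝ ∞ μ), ∀ v ∈ N, F.mul a v ∈ N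
  locality : ∀ v ∈ N, ∀ (A : ℕ → Set M) (hA : ∀ n, MeasurableSet (A n)),
    (∀ n, F.mul (chi μ (A n) (hA n)) v = 0) →
    F.mul (chi μ (⋃ n, A n) (MeasurableSet.iUnion hA)) v = 0
  glueing : ∀ v : ℕ → F.Mod, (∀ n, v n ∈ N) →
    ∀ (A : ℕ → Set M) (hA : ∀ n, MeasurableSet (A n)),
    (∀ i j, F.mul (chi μ (A i ∩ A j) ((hA i).inter (hA j))) (v i) =
      F.mul (chi μ (A i ∩ A j) ((hA i).inter (hA j))) (v j)) →
    BddAbove (range fun n => ‖∑ i ∈ Finset.range n, F.mul (chi μ (A i) (hA i)) (v i)‖) →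
    ∃ w ∈ N, (∀ i, F.mul (chi μ (A i) (hA i)) w = F.mul (chi μ (A i) (hA i)) (v i)) ∧
      ‖w‖ ≤ liminf (fun n => ‖∑ i ∈ Finset.range n, F.mul (chi μ (A i) (hA i)) (v i)‖) atTop

/-- The limits `ω` of differentials `d f_n` along sequences `f_n → 0` in `L⁰(μ)`. -/
def zeroSet : Set F.Mod :=
  {ω | ∃ f : ℕ → V, TendstoL0 (fun n => F.toL0 (f n)) 0 ∧
    Tendsto (fun n => F.d (f n)) atTop (𝓝 ω)}

/-- The submodule generated by `zeroSet`: the closed linear span of all `a · ω` with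
`a ∈ L^∞(μ)` and `ω ∈ zeroSet`. -/
def zeroModule : Submodule ℝ F.Mod :=
  (Submodule.span ℝ {v | ∃ a : Lp ℝ ∞ μ, ∃ ω ∈ F.zeroSet, v = F.mul a ω}).topologicalClosure

/-- The operator `d`, from `L⁰(μ)` to the module with domain the functions in `V`, is closable:
the closure of its graph is the graph of a (single-valued) operator. -/
def Closable : Prop :=
  ∀ (f h : ℕ → V) (g : M →ₘ[μ] ℝ) (ω η : F.Mod),
    TendstoL0 (fun n => F.toL0 (f n)) g → Tendsto (fun n => F.d (f n)) atTop (𝓝 ω) →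
    TendstoL0 (fun n => F.toL0 (h n)) g → Tendsto (fun n => F.d (h n)) atTop (𝓝 η) → ω = η

/-- The module is weakly reflexive: every bounded sequence of differentials `d f_n` with `(f_n)`
convergent in `L⁰(μ)` has a weakly convergent subsequence. -/
def WeaklyReflexive : Prop :=
  ∀ (f : ℕ → V) (g : M →ₘ[μ] ℝ), TendstoL0 (fun n => F.toL0 (f n)) g →
    BddAbove (range fun n => ‖F.d (f n)‖) →
    ∃ (φ : ℕ → ℕ) (ω : F.Mod), StrictMono φ ∧ TendstoWeakly (fun n => F.d (f (φ n))) ω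

end LpFunctional

section Lebesgue

variable {μ : Measure M} {p : ℝ≥0} [hp : Fact (1 < p)]

theorem TendstoL0.exists_subseq_ae [SigmaFinite μ] {f : ℕ → M →ₘ[μ] ℝ} {g : M →ₘ[μ] ℝ}
    (h : TendstoL0 f g) :
    ∃ φ : ℕ → ℕ, StrictMono φ ∧ ∀ᵐ x ∂μ, Tendsto (fun n => f (φ n) x) atTop (𝓝 (g x)) := by
  set S := spanningSets μ
  let A : ℕ → ℕ → Set M := fun n k => {x | ((1 / 2 : ℝ) ^ n) ≤ ‖f k x - g x‖}
  have hA : ∀ n, ∀ᶠ k in atTop, μ.restrict (S n) (A n k) < ENNReal.ofReal ((1 / 2 : ℝ) ^ n) := by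
    intro n
    have h1 := tendstoInMeasure_iff_norm.1
      (h (S n) (measurableSet_spanningSets μ n) (measure_spanningSets_lt_top μ n))
      ((1 / 2 : ℝ) ^ n) (by positivity)
    exact h1.eventually (gt_mem_nhds (by simp))
  obtain ⟨φ, hφ, hφ'⟩ := extraction_forall_of_eventually hA
  refine ⟨φ, hφ, ?_⟩
  have hmeas : ∀ n, MeasurableSet (A n (φ n)) := fun n =>
    measurableSet_le measurable_const
      (((f (φ n)).stronglyMeasurable.measurable.sub g.stronglyMeasurable.measurable).norm)
  have hsum : ∑' n, μ (A n (φ n) ∩ S n) ≠ ∞ := by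
    have hle : ∑' n, μ (A n (φ n) ∩ S n) ≤ ∑' n, ENNReal.ofReal ((1 / 2 : ℝ) ^ n) := by
      refine ENNReal.tsum_le_tsum fun n => ?_
      rw [← Measure.restrict_apply (hmeas n)]
      exact (hφ' n).le
    refine ne_top_of_le_ne_top ?_ hle
    rw [← ENNReal.ofReal_tsum_of_nonneg (fun n => by positivity) summable_geometric_two]
    exact ENNReal.ofReal_ne_top
  filter_upwards [ae_eventually_notMem hsum] with x hx
  have hS : ∀ᶠ n in atTop, x ∈ S n := by
    have hm := mem_spanningSetsIndex μ x
    filter_upwards [eventually_ge_atTop (spanningSetsIndex μ x)] with n hn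
    exact monotone_spanningSets μ hn hm
  rw [tendsto_iff_norm_sub_tendsto_zero]
  refine squeeze_zero' (Eventually.of_forall fun n => norm_nonneg _) ?_
    (tendsto_pow_atTop_nhds_zero_of_lt_one (r := (1 / 2 : ℝ)) (by norm_num) (by norm_num))
  filter_upwards [hx, hS] with n h1 h2
  by_contra h3
  exact h1 ⟨(not_le.1 h3).le, h2⟩

theorem TendstoL0.of_ae {f : ℕ → M →ₘ[μ] ℝ} {g : M →ₘ[μ] ℝ}
    (h : ∀ᵐ x ∂μ, Tendsto (fun n => f n x) atTop (𝓝 (g x))) : TendstoL0 f g := by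
  intro E _ hE'
  have : IsFiniteMeasure (μ.restrict E) := ⟨by simpa using hE'⟩
  exact tendstoInMeasure_of_tendsto_ae
    (fun n => (f n).stronglyMeasurable.aestronglyMeasurable) (ae_restrict_of_ae h)

theorem one_lt_coe : 1 < (p : ℝ) := by exact_mod_cast hp.out

theorem integrable_rpow (u : Lp ℝ p μ) : Integrable (fun x => |u x| ^ (p : ℝ)) μ := by
  have h := (Lp.memLp u).integrable_norm_rpow
    (by exact_mod_cast (zero_lt_one.trans hp.out).ne') ENNReal.coe_ne_top
  simpa using h

theorem norm_rpow_eq (u : Lp ℝ p μ) : ‖u‖ ^ (p : ℝ) = ∫ x, |u x| ^ (p : ℝ) ∂μ := by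
  have hp0 : (p : ℝ) ≠ 0 := (zero_lt_one.trans (one_lt_coe (p := p))).ne'
  have h0 : 0 ≤ ∫ x, |u x| ^ (p : ℝ) ∂μ := integral_nonneg fun x => by positivity
  have h := (Lp.memLp u).eLpNorm_eq_integral_rpow_norm
    (by exact_mod_cast (zero_lt_one.trans hp.out).ne') ENNReal.coe_ne_top
  simp only [ENNReal.coe_toReal, Real.norm_eq_abs] at h
  rw [Lp.norm_def, h, ENNReal.toReal_ofReal (by positivity), ← Real.rpow_mul h0,
    inv_mul_cancel₀ hp0, Real.rpow_one]

theorem rpow_uniform_convex {q : ℝ} (hq : 1 < q) {ε : ℝ} (hε : 0 < ε) :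
    ∃ C : ℝ, 0 ≤ C ∧ ∀ a b : ℝ, 0 ≤ a → 0 ≤ b →
      |a - b| ^ q ≤ ε * (a ^ q + b ^ q) + C * ((a ^ q + b ^ q) / 2 - ((a + b) / 2) ^ q) := by
  have hq0 : 0 < q := zero_lt_one.trans hq
  let δ : ℝ → ℝ := fun t => (t ^ q + (1 - t) ^ q) / 2 - (1 / 2 : ℝ) ^ q
  have cont1 : Continuous fun t : ℝ => t ^ q + (1 - t) ^ q :=
    (Real.continuous_rpow_const hq0.le).add
      ((Real.continuous_rpow_const hq0.le).comp (continuous_const.sub continuous_id))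
  have hδc : Continuous δ := (cont1.div_const 2).sub continuous_const
  have cont2 : Continuous fun t : ℝ => |t - (1 - t)| ^ q :=
    (Real.continuous_rpow_const hq0.le).comp (by fun_prop)
  have hconv := strictConvexOn_rpow hq
  have hδ0 : ∀ t ∈ Icc (0 : ℝ) 1, 0 ≤ δ t := by
    intro t ht
    have m1 : t ∈ Ici (0 : ℝ) := ht.1
    have m2 : 1 - t ∈ Ici (0 : ℝ) := sub_nonneg.2 ht.2
    have h := hconv.convexOn.2 m1 m2 (by norm_num : (0 : ℝ) ≤ 1 / 2)
      (by norm_num : (0 : ℝ) ≤ 1 / 2) (by norm_num)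
    simp only [smul_eq_mul] at h
    have e : (1 / 2 : ℝ) * t + 1 / 2 * (1 - t) = 1 / 2 := by ring
    rw [e] at h
    simp only [δ]; linarith
  have hδpos : ∀ t ∈ Icc (0 : ℝ) 1, t ≠ 1 / 2 → 0 < δ t := by
    intro t ht hne
    have m1 : t ∈ Ici (0 : ℝ) := ht.1
    have m2 : 1 - t ∈ Ici (0 : ℝ) := sub_nonneg.2 ht.2
    have h := hconv.2 m1 m2 (fun h => hne (by linarith)) (by norm_num : (0 : ℝ) < 1 / 2)
      (by norm_num : (0 : ℝ) < 1 / 2) (by norm_num)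
    simp only [smul_eq_mul] at h
    have e : (1 / 2 : ℝ) * t + 1 / 2 * (1 - t) = 1 / 2 := by ring
    rw [e] at h
    simp only [δ]; linarith
  have hunit : ∃ C : ℝ, 0 ≤ C ∧ ∀ t ∈ Icc (0 : ℝ) 1,
      |t - (1 - t)| ^ q ≤ ε * (t ^ q + (1 - t) ^ q) + C * δ t := by
    let K : Set ℝ := Icc 0 1 ∩ {t | ε * (t ^ q + (1 - t) ^ q) ≤ |t - (1 - t)| ^ q}
    have hK : IsCompact K :=
      isCompact_Icc.inter_right (isClosed_le (continuous_const.mul cont1) cont2)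
    have hpos : ∀ t ∈ Icc (0 : ℝ) 1, 0 ≤ t ^ q + (1 - t) ^ q := fun t ht =>
      add_nonneg (Real.rpow_nonneg ht.1 _) (Real.rpow_nonneg (sub_nonneg.2 ht.2) _)
    rcases K.eq_empty_or_nonempty with hKe | hKn
    · refine ⟨0, le_rfl, fun t ht => ?_⟩
      by_contra h
      have : t ∈ K := ⟨ht, show ε * (t ^ q + (1 - t) ^ q) ≤ |t - (1 - t)| ^ q by
        linarith [not_le.1 h]⟩
      rw [hKe] at this
      exact this
    · obtain ⟨t₀, ht₀, hmin⟩ := hK.exists_isMinOn hKn hδc.continuousOn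
      have hne : t₀ ≠ 1 / 2 := by
        rintro rfl
        have h : ε * ((1 / 2 : ℝ) ^ q + (1 - 1 / 2) ^ q) ≤ |(1 / 2 : ℝ) - (1 - 1 / 2)| ^ q := ht₀.2
        have e : (1 / 2 : ℝ) - (1 - 1 / 2) = 0 := by norm_num
        rw [e, abs_zero, Real.zero_rpow hq0.ne'] at h
        have : 0 < ε * ((1 / 2 : ℝ) ^ q + (1 - 1 / 2) ^ q) := by
          have : (1 - 1 / 2 : ℝ) = 1 / 2 := by norm_num
          rw [this]; positivity
        linarith
      have hm : 0 < δ t₀ := hδpos t₀ ht₀.1 hne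
      refine ⟨(δ t₀)⁻¹, (inv_pos.2 hm).le, fun t ht => ?_⟩
      have h1 : 0 ≤ ε * (t ^ q + (1 - t) ^ q) := mul_nonneg hε.le (hpos t ht)
      have h2 : 0 ≤ (δ t₀)⁻¹ * δ t := mul_nonneg (inv_pos.2 hm).le (hδ0 t ht)
      by_cases htK : t ∈ K
      · have h3 : δ t₀ ≤ δ t := hmin htK
        have h4 : 1 ≤ (δ t₀)⁻¹ * δ t := by
          rw [inv_mul_eq_div, one_le_div hm]; exact h3
        have h5 : |t - (1 - t)| ^ q ≤ 1 := by
          refine Real.rpow_le_one (abs_nonneg _) ?_ hq0.le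
          rw [abs_le]; constructor <;> linarith [ht.1, ht.2]
        linarith
      · have : ¬ ε * (t ^ q + (1 - t) ^ q) ≤ |t - (1 - t)| ^ q := fun h => htK ⟨ht, h⟩
        linarith [not_le.1 this]
  obtain ⟨C, hC, h⟩ := hunit
  refine ⟨C, hC, fun a b ha hb => ?_⟩
  rcases (add_nonneg ha hb).eq_or_lt with h0 | hs
  · have ha0 : a = 0 := by linarith
    have hb0 : b = 0 := by linarith
    subst ha0; subst hb0
    simp [Real.zero_rpow hq0.ne']
  · set s := a + b with hsdef
    have ht : a / s ∈ Icc (0 : ℝ) 1 :=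
      ⟨div_nonneg ha hs.le, (div_le_one hs).2 (by linarith)⟩
    have hb' : 1 - a / s = b / s := by field_simp; linarith
    have key := h (a / s) ht
    simp only [δ, hb'] at key
    have hsq : 0 < s ^ q := Real.rpow_pos_of_pos hs q
    have e1 : |a / s - b / s| ^ q = |a - b| ^ q / s ^ q := by
      rw [← sub_div, abs_div, abs_of_pos hs, Real.div_rpow (abs_nonneg _) hs.le]
    have e2 : (s / 2) ^ q = s ^ q * (1 / 2 : ℝ) ^ q := by
      rw [div_eq_mul_one_div, Real.mul_rpow hs.le (by norm_num)]
    rw [e1, Real.div_rpow ha hs.le, Real.div_rpow hb hs.le] at key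
    have key2 := mul_le_mul_of_nonneg_right key hsq.le
    rw [e2]
    have e3 : |a - b| ^ q / s ^ q * s ^ q = |a - b| ^ q := by field_simp
    have e4 : (ε * (a ^ q / s ^ q + b ^ q / s ^ q) +
        C * ((a ^ q / s ^ q + b ^ q / s ^ q) / 2 - (1 / 2 : ℝ) ^ q)) * s ^ q =
        ε * (a ^ q + b ^ q) + C * ((a ^ q + b ^ q) / 2 - s ^ q * (1 / 2 : ℝ) ^ q) := by
      field_simp
    rw [e3, e4] at key2
    exact key2

theorem norm_sub_rpow_le {ε : ℝ} (hε : 0 < ε) : ∃ C : ℝ, 0 ≤ C ∧ ∀ u v : Lp ℝ p μ, 0 ≤ u → 0 ≤ v →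
    ‖u - v‖ ^ (p : ℝ) ≤ ε * (‖u‖ ^ (p : ℝ) + ‖v‖ ^ (p : ℝ)) +
      C * ((‖u‖ ^ (p : ℝ) + ‖v‖ ^ (p : ℝ)) / 2 - ‖(1 / 2 : ℝ) • (u + v)‖ ^ (p : ℝ)) := by
  obtain ⟨C, hC, h⟩ := rpow_uniform_convex (one_lt_coe (p := p)) hε
  refine ⟨C, hC, fun u v hu hv => ?_⟩
  have iu := integrable_rpow u
  have iv := integrable_rpow v
  have iw := integrable_rpow ((1 / 2 : ℝ) • (u + v))
  have j1 : Integrable (fun x => |u x| ^ (p : ℝ) + |v x| ^ (p : ℝ)) μ := iu.add iv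
  have j2 : Integrable (fun x => (|u x| ^ (p : ℝ) + |v x| ^ (p : ℝ)) / 2 -
      |((1 / 2 : ℝ) • (u + v) : Lp ℝ p μ) x| ^ (p : ℝ)) μ := (j1.div_const 2).sub iw
  have j3 : Integrable (fun x => ε * (|u x| ^ (p : ℝ) + |v x| ^ (p : ℝ))) μ := j1.const_mul ε
  have e : ε * (‖u‖ ^ (p : ℝ) + ‖v‖ ^ (p : ℝ)) +
      C * ((‖u‖ ^ (p : ℝ) + ‖v‖ ^ (p : ℝ)) / 2 - ‖(1 / 2 : ℝ) • (u + v)‖ ^ (p : ℝ)) =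
      ∫ x, ε * (|u x| ^ (p : ℝ) + |v x| ^ (p : ℝ)) + C * ((|u x| ^ (p : ℝ) + |v x| ^ (p : ℝ)) / 2 -
        |((1 / 2 : ℝ) • (u + v) : Lp ℝ p μ) x| ^ (p : ℝ)) ∂μ := by
    rw [integral_add j3 (j2.const_mul C), integral_const_mul, integral_const_mul,
      integral_sub (j1.div_const 2) iw, integral_div, integral_add iu iv, norm_rpow_eq,
      norm_rpow_eq, norm_rpow_eq]
  rw [e, norm_rpow_eq]
  refine integral_mono_ae (integrable_rpow _)
    (j3.add (j2.const_mul C)) ?_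
  filter_upwards [Lp.coeFn_sub u v, Lp.coeFn_smul (1 / 2 : ℝ) (u + v), Lp.coeFn_add u v,
    (Lp.coeFn_nonneg u).2 hu, (Lp.coeFn_nonneg v).2 hv] with x h1 h2 h3 h4 h5
  simp only [Pi.zero_apply] at h4 h5
  have h6 := h (u x) (v x) h4 h5
  have e2 : |((1 / 2 : ℝ) • (u + v) : Lp ℝ p μ) x| = (u x + v x) / 2 := by
    rw [h2, Pi.smul_apply, h3, Pi.add_apply, smul_eq_mul, abs_of_nonneg (by positivity)]
    ring
  rw [e2, h1, Pi.sub_apply, abs_of_nonneg h4, abs_of_nonneg h5]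
  exact h6

theorem norm_superadd {u v : Lp ℝ p μ} (hu : 0 ≤ u) (h : u ≤ v) :
    ‖u‖ ^ (p : ℝ) + ‖v - u‖ ^ (p : ℝ) ≤ ‖v‖ ^ (p : ℝ) := by
  rw [norm_rpow_eq, norm_rpow_eq, norm_rpow_eq,
    ← integral_add (integrable_rpow u) (integrable_rpow (v - u))]
  refine integral_mono_ae ((integrable_rpow u).add (integrable_rpow (v - u)))
    (integrable_rpow v) ?_
  filter_upwards [Lp.coeFn_sub v u, (Lp.coeFn_nonneg u).2 hu, (Lp.coeFn_le u v).2 h]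
    with x h1 h2 h3
  simp only [Pi.zero_apply] at h2
  rw [h1, Pi.sub_apply, abs_of_nonneg h2, abs_of_nonneg (sub_nonneg.2 h3),
    abs_of_nonneg (h2.trans h3)]
  have := Real.add_rpow_le_rpow_add h2 (sub_nonneg.2 h3) (one_lt_coe (p := p)).le
  simpa using this

theorem rpow_cauchy {u : ℕ → Lp ℝ p μ}
    (h : ∀ η > 0, ∃ N, ∀ n k, N ≤ n → n ≤ k → ‖u n - u k‖ ^ (p : ℝ) < η) : CauchySeq u := by
  have hp0 : 0 < (p : ℝ) := zero_lt_one.trans (one_lt_coe (p := p))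
  rw [Metric.cauchySeq_iff']
  intro η hη
  obtain ⟨N, hN⟩ := h (η ^ (p : ℝ)) (by positivity)
  refine ⟨N, fun n hn => ?_⟩
  rw [dist_comm, dist_eq_norm]
  exact (Real.rpow_lt_rpow_iff (norm_nonneg _) hη.le hp0).1 (hN N n le_rfl hn)

theorem exists_tendsto_of_midpoint {W : Type*} [AddCommGroup W] [Module ℝ W] (N : W → Lp ℝ p μ)
    (hN0 : ∀ w, 0 ≤ N w)
    (hN : ∀ v w, N ((1 / 2 : ℝ) • (v + w)) ≤ (1 / 2 : ℝ) • (N v + N w))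
    (A : ℕ → Set W) (hA : Antitone A) (hconv : ∀ n, Convex ℝ (A n)) (C : ℝ)
    (hC : ∀ n, ∃ w ∈ A n, ‖N w‖ ≤ C) :
    ∃ z : ℕ → W, (∀ n, z n ∈ A n) ∧ ∃ G, Tendsto (fun n => N (z n)) atTop (𝓝 G) := by
  have hp0 : 0 < (p : ℝ) := zero_lt_one.trans (one_lt_coe (p := p))
  let m : ℕ → ℝ := fun n => sInf ((fun w => ‖N w‖) '' A n)
  have hbdd : ∀ n, BddBelow ((fun w => ‖N w‖) '' A n) := fun n =>
    ⟨0, by rintro _ ⟨w, -, rfl⟩; exact norm_nonneg _⟩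
  have hne : ∀ n, ((fun w => ‖N w‖) '' A n).Nonempty := fun n => by
    obtain ⟨w, hw, -⟩ := hC n
    exact ⟨_, w, hw, rfl⟩
  have hm_le : ∀ n, ∀ w ∈ A n, m n ≤ ‖N w‖ := fun n w hw => csInf_le (hbdd n) ⟨w, hw, rfl⟩
  have hm0 : ∀ n, 0 ≤ m n := fun n => le_csInf (hne n) (by
    rintro _ ⟨w, -, rfl⟩; exact norm_nonneg _)
  have hmono : Monotone m := fun a b hab =>
    csInf_le_csInf (hbdd a) (hne b) (image_mono (hA hab))
  have hmC : BddAbove (range m) := ⟨C, by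
    rintro _ ⟨n, rfl⟩
    obtain ⟨w, hw, h⟩ := hC n
    exact (hm_le n w hw).trans h⟩
  have hmL := tendsto_atTop_ciSup hmono hmC
  set L := ⨆ n, m n
  have hex : ∀ n, ∃ w ∈ A n, ‖N w‖ < m n + 1 / ((n : ℝ) + 1) := fun n => by
    obtain ⟨_, ⟨w, hw, rfl⟩, h⟩ := exists_lt_of_csInf_lt (hne n)
      (lt_add_of_pos_right (m n) (by positivity : (0 : ℝ) < 1 / ((n : ℝ) + 1)))
    exact ⟨w, hw, h⟩
  choose z hzA hz using hex
  refine ⟨z, hzA, ?_⟩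
  have hzL : Tendsto (fun n => ‖N (z n)‖) atTop (𝓝 L) := by
    refine tendsto_of_tendsto_of_tendsto_of_le_of_le hmL ?_
      (fun n => hm_le n _ (hzA n)) (fun n => (hz n).le)
    simpa using hmL.add (tendsto_one_div_add_atTop_nhds_zero_nat (𝕜 := ℝ))
  have hcont : ContinuousAt (fun t : ℝ => t ^ (p : ℝ)) L :=
    (Real.continuous_rpow_const hp0.le).continuousAt
  have h1 : Tendsto (fun n => ‖N (z n)‖ ^ (p : ℝ)) atTop (𝓝 (L ^ (p : ℝ))) :=
    hcont.tendsto.comp hzL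
  have h2 : Tendsto (fun n => m n ^ (p : ℝ)) atTop (𝓝 (L ^ (p : ℝ))) := hcont.tendsto.comp hmL
  refine cauchySeq_tendsto_of_complete (rpow_cauchy fun η hη => ?_)
  set B := L ^ (p : ℝ) with hB
  have hL0 : 0 ≤ L := ge_of_tendsto' hmL hm0
  have hB0 : 0 ≤ B := Real.rpow_nonneg hL0 _
  obtain ⟨c, hc, hcε⟩ := norm_sub_rpow_le (μ := μ) (p := p)
    (ε := η / (4 * (B + 1))) (by positivity)
  set δ := min 1 (η / (4 * (c + 1))) with hδ
  have hδ0 : 0 < δ := lt_min one_pos (by positivity)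
  have ev1 := h1.eventually (Metric.ball_mem_nhds B hδ0)
  have ev2 := h2.eventually (Metric.ball_mem_nhds B hδ0)
  obtain ⟨n₀, hn₀⟩ := eventually_atTop.1 (ev1.and ev2)
  refine ⟨n₀, fun n k hn hk => ?_⟩
  have a1 := abs_lt.1 (Real.dist_eq _ _ ▸ Metric.mem_ball.1 (hn₀ n hn).1)
  have a2 := abs_lt.1 (Real.dist_eq _ _ ▸ Metric.mem_ball.1 (hn₀ k (hn.trans hk)).1)
  have a3 := abs_lt.1 (Real.dist_eq _ _ ▸ Metric.mem_ball.1 (hn₀ n hn).2)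
  have hmid : (1 / 2 : ℝ) • (z n + z k) ∈ A n := by
    rw [smul_add]
    exact hconv n (hzA n) (hA hk (hzA k)) (by norm_num) (by norm_num) (by norm_num)
  have a4 : m n ^ (p : ℝ) ≤ ‖(1 / 2 : ℝ) • (N (z n) + N (z k))‖ ^ (p : ℝ) :=
    Real.rpow_le_rpow (hm0 n)
      ((hm_le n _ hmid).trans (LpFunctional.norm_mono (hN0 _) (hN _ _))) hp0.le
  have a5 := hcε (N (z n)) (N (z k)) (hN0 _) (hN0 _)
  have hδ1 : δ ≤ 1 := min_le_left _ _
  have hδ2 : δ * (4 * (c + 1)) ≤ η := by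
    have := min_le_right 1 (η / (4 * (c + 1)))
    rw [← hδ, le_div_iff₀ (by positivity)] at this
    exact this
  have b1 : η / (4 * (B + 1)) * (‖N (z n)‖ ^ (p : ℝ) + ‖N (z k)‖ ^ (p : ℝ)) ≤ η / 2 := by
    have : ‖N (z n)‖ ^ (p : ℝ) + ‖N (z k)‖ ^ (p : ℝ) ≤ 2 * (B + 1) := by linarith [a1.2, a2.2]
    calc _ ≤ η / (4 * (B + 1)) * (2 * (B + 1)) := by gcongr
      _ = η / 2 := by field_simp; norm_num
  have b2 : c * ((‖N (z n)‖ ^ (p : ℝ) + ‖N (z k)‖ ^ (p : ℝ)) / 2 -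
      ‖(1 / 2 : ℝ) • (N (z n) + N (z k))‖ ^ (p : ℝ)) ≤ c * (2 * δ) := by
    refine mul_le_mul_of_nonneg_left ?_ hc
    linarith [a1.2, a2.2, a3.1]
  have b3 : c * (2 * δ) < η / 2 := by nlinarith
  linarith

theorem smul_nonneg' {c : ℝ} (hc : 0 ≤ c) {u : Lp ℝ p μ} (hu : 0 ≤ u) : 0 ≤ c • u := by
  rw [← Lp.coeFn_nonneg] at hu ⊢
  filter_upwards [hu, Lp.coeFn_smul c u] with x h1 h2
  rw [h2]
  exact mul_nonneg hc h1

theorem convex_nonneg : Convex ℝ {u : Lp ℝ p μ | 0 ≤ u} := fun _ hu _ hv _ _ ha hb _ =>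
  add_nonneg (smul_nonneg' ha hu) (smul_nonneg' hb hv)

theorem TendstoWeakly.nonneg {u : ℕ → Lp ℝ p μ} {a : Lp ℝ p μ} (h : TendstoWeakly u a)
    (hu : ∀ n, 0 ≤ u n) : 0 ≤ a := by
  by_contra ha
  obtain ⟨φ, s, h1, h2⟩ := geometric_hahn_banach_point_closed
    (convex_nonneg (μ := μ) (p := p)) isClosed_Ici ha
  have := ge_of_tendsto' (h φ) fun n => (h2 (u n) (hu n)).le
  linarith

theorem TendstoWeakly.bounded {E : Type*} [NormedAddCommGroup E] [NormedSpace ℝ E] {u : ℕ → E}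
    {a : E} (h : TendstoWeakly u a) : ∃ C, ∀ n, ‖u n‖ ≤ C := by
  obtain ⟨C, hC⟩ := banach_steinhaus (g := fun n => NormedSpace.inclusionInDoubleDual ℝ E (u n))
    (fun φ => by
      obtain ⟨C, hC⟩ := (h φ).norm.bddAbove_range
      exact ⟨C, fun n => hC ⟨n, rfl⟩⟩)
  refine ⟨C, fun n => ?_⟩
  have := hC n
  rwa [← (NormedSpace.inclusionInDoubleDualLi ℝ (E := E)).norm_map (u n)]

theorem _root_.Filter.Tendsto.tendstoWeakly {E : Type*} [NormedAddCommGroup E] [NormedSpace ℝ E]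
    {u : ℕ → E} {a : E} (h : Tendsto u atTop (𝓝 a)) : TendstoWeakly u a :=
  fun φ => (φ.continuous.tendsto a).comp h

theorem TendstoWeakly.add {E : Type*} [NormedAddCommGroup E] [NormedSpace ℝ E]
    {u v : ℕ → E} {a b : E} (hu : TendstoWeakly u a) (hv : TendstoWeakly v b) :
    TendstoWeakly (fun n => u n + v n) (a + b) := fun φ => by
  simpa using (hu φ).add (hv φ)

theorem TendstoWeakly.sub {E : Type*} [NormedAddCommGroup E] [NormedSpace ℝ E]
    {u v : ℕ → E} {a b : E} (hu : TendstoWeakly u a) (hv : TendstoWeakly v b) :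
    TendstoWeakly (fun n => u n - v n) (a - b) := fun φ => by
  simpa using (hu φ).sub (hv φ)

theorem TendstoWeakly.const_smul {E : Type*} [NormedAddCommGroup E] [NormedSpace ℝ E]
    {u : ℕ → E} {a : E} (c : ℝ) (hu : TendstoWeakly u a) :
    TendstoWeakly (fun n => c • u n) (c • a) := fun φ => by
  simpa using (hu φ).const_mul c

theorem TendstoWeakly.subseq {E : Type*} [NormedAddCommGroup E] [NormedSpace ℝ E]
    {u : ℕ → E} {a : E} (hu : TendstoWeakly u a) {φ : ℕ → ℕ} (hφ : StrictMono φ) :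
    TendstoWeakly (fun n => u (φ n)) a := fun ψ => (hu ψ).comp hφ.tendsto_atTop

end Lebesgue

namespace LpFunctional

variable {μ : Measure M} {p : ℝ≥0} [Fact (1 < p)] {V : Type*} [AddCommGroup V] [Module ℝ V]
  (F : LpFunctional μ p V)

/-- The lower semicontinuous hull `inf {liminf ∫ g_{f_n}^p dμ : f_n → g in L⁰(μ)}` of the energy
`f ↦ ∫ g_f^p dμ = ‖g_f‖^p`. -/
def relaxedEnergy (g : M →ₘ[μ] ℝ) : ℝ≥0∞ :=
  ⨅ (f : ℕ → V) (_ : TendstoL0 (fun n => F.toL0 (f n)) g),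
    liminf (fun n => ‖F.val (f n)‖ₑ ^ (p : ℝ)) atTop

/-- The set of all `G ∈ L^p(μ)` with `G ≤ G'` whenever `f_n → g` in `L⁰(μ)` and `g_{f_n} ⇀ G'`
weakly in `L^p(μ)`. -/
def lowerSet (g : M →ₘ[μ] ℝ) : Set (Lp ℝ p μ) :=
  {G | ∀ (f : ℕ → V) (G' : Lp ℝ p μ), TendstoL0 (fun n => F.toL0 (f n)) g →
    TendstoWeakly (fun n => F.val (f n)) G' → G ≤ G'}

theorem val_add_smul_le {a b : ℝ} (ha : 0 ≤ a) (hb : 0 ≤ b) (v w : V) :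
    F.val (a • v + b • w) ≤ a • F.val v + b • F.val w := by
  refine (F.add_le' _ _).trans ?_
  rw [F.smul', F.smul', abs_of_nonneg ha, abs_of_nonneg hb]

/-- Almost everywhere convergence of a sequence in `V`. -/
def TendstoAE (f : ℕ → V) (g : M →ₘ[μ] ℝ) : Prop :=
  ∀ᵐ x ∂μ, Tendsto (fun n => F.toL0 (f n) x) atTop (𝓝 (g x))

theorem relaxedEnergy_lt_top_iff [SigmaFinite μ] {g : M →ₘ[μ] ℝ} :
    F.relaxedEnergy g < ∞ ↔ ∃ (f : ℕ → V) (C : ℝ), F.TendstoAE f g ∧ ∀ n, ‖F.val (f n)‖ ≤ C := by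
  have hp0 : 0 < (p : ℝ) := zero_lt_one.trans (one_lt_coe (p := p))
  constructor
  · intro h
    simp only [relaxedEnergy, iInf_lt_iff] at h
    obtain ⟨f, hf, h⟩ := h
    obtain ⟨C, hC, hCtop⟩ := exists_between h
    have hfr : ∃ᶠ n in atTop, ‖F.val (f n)‖ₑ ^ (p : ℝ) < C :=
      frequently_lt_of_liminf_lt (by isBoundedDefault) hC
    obtain ⟨φ, hφ, hφC⟩ := extraction_of_frequently_atTop hfr
    have hf' : TendstoL0 (fun n => F.toL0 (f (φ n))) g := fun E hE hE' ε hε =>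
      (hf E hE hE' ε hε).comp hφ.tendsto_atTop
    obtain ⟨ψ, hψ, hψ'⟩ := hf'.exists_subseq_ae
    refine ⟨fun n => f (φ (ψ n)), (C ^ ((p : ℝ)⁻¹)).toReal, hψ', fun n => ?_⟩
    have h1 := (hφC (ψ n)).le
    rw [← ENNReal.le_rpow_inv_iff hp0] at h1
    rw [← toReal_enorm]
    exact ENNReal.toReal_mono (ENNReal.rpow_ne_top_of_nonneg (inv_nonneg.2 hp0.le) hCtop.ne) h1
  · rintro ⟨f, C, hf, hC⟩
    have h1 : F.relaxedEnergy g ≤ liminf (fun n => ‖F.val (f n)‖ₑ ^ (p : ℝ)) atTop :=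
      iInf₂_le f (TendstoL0.of_ae hf)
    have h2 : liminf (fun n => ‖F.val (f n)‖ₑ ^ (p : ℝ)) atTop ≤
        liminf (fun _ : ℕ => ENNReal.ofReal C ^ (p : ℝ)) atTop := by
      refine liminf_le_liminf (Eventually.of_forall fun n => ?_)
      refine ENNReal.rpow_le_rpow ?_ hp0.le
      rw [← ofReal_norm]
      exact ENNReal.ofReal_le_ofReal (hC n)
    rw [liminf_const] at h2
    exact (h1.trans h2).trans_lt (ENNReal.rpow_lt_top_of_nonneg hp0.le ENNReal.ofReal_ne_top)

theorem TendstoAE.add {f h : ℕ → V} {g k : M →ₘ[μ] ℝ} (hf : F.TendstoAE f g)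
    (hh : F.TendstoAE h k) : F.TendstoAE (fun n => f n + h n) (g + k) := by
  have e : ∀ᵐ x ∂μ, ∀ n, F.toL0 (f n + h n) x = F.toL0 (f n) x + F.toL0 (h n) x :=
    ae_all_iff.2 fun n => by
      rw [map_add]; exact AEEqFun.coeFn_add _ _
  filter_upwards [hf, hh, e, AEEqFun.coeFn_add g k] with x h1 h2 h3 h4
  simp only [h3, h4, Pi.add_apply]
  exact h1.add h2

theorem TendstoAE.const_smul {f : ℕ → V} {g : M →ₘ[μ] ℝ} (hf : F.TendstoAE f g) (c : ℝ) :
    F.TendstoAE (fun n => c • f n) (c • g) := by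
  have e : ∀ᵐ x ∂μ, ∀ n, F.toL0 (c • f n) x = c * F.toL0 (f n) x :=
    ae_all_iff.2 fun n => by
      rw [map_smul]; exact AEEqFun.coeFn_smul _ _
  filter_upwards [hf, e, AEEqFun.coeFn_smul c g] with x h1 h3 h4
  simp only [h3, h4, Pi.smul_apply, smul_eq_mul]
  exact h1.const_mul c

theorem tendstoAE_const (v : V) : F.TendstoAE (fun _ => v) (F.toL0 v) :=
  ae_of_all _ fun _ => tendsto_const_nhds

theorem TendstoAE.convex {w : ℕ → V × Lp ℝ p μ} {g : M →ₘ[μ] ℝ}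
    (hw : F.TendstoAE (fun n => (w n).1) g) {z : ℕ → V × Lp ℝ p μ}
    (hz : ∀ n, z n ∈ convexHull ℝ (w '' Ici n)) : F.TendstoAE (fun n => (z n).1) g := by
  have key : ∀ n, ∀ᵐ x ∂μ, ∀ r : ℝ, (∀ k ∈ Ici n, |F.toL0 (w k).1 x - g x| ≤ r) →
      |F.toL0 (z n).1 x - g x| ≤ r := by
    intro n
    have hsub : convexHull ℝ (w '' Ici n) ⊆ {v : V × Lp ℝ p μ | ∀ᵐ x ∂μ, ∀ r : ℝ,
        (∀ k ∈ Ici n, |F.toL0 (w k).1 x - g x| ≤ r) → |F.toL0 v.1 x - g x| ≤ r} := by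
      refine convexHull_min ?_ ?_
      · rintro _ ⟨k, hk, rfl⟩
        exact ae_of_all _ fun x r h => h k hk
      · intro u hu v hv a b ha hb hab
        have e : ∀ᵐ x ∂μ, F.toL0 (a • u + b • v).1 x = a * F.toL0 u.1 x + b * F.toL0 v.1 x := by
          rw [Prod.fst_add, Prod.smul_fst, Prod.smul_fst, map_add, map_smul, map_smul]
          filter_upwards [AEEqFun.coeFn_add (a • F.toL0 u.1) (b • F.toL0 v.1),
            AEEqFun.coeFn_smul a (F.toL0 u.1), AEEqFun.coeFn_smul b (F.toL0 v.1)] with x h1 h2 h3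
          rw [h1, Pi.add_apply, h2, h3]; rfl
        filter_upwards [hu, hv, e] with x h1 h2 h3 r hr
        have i1 := h1 r hr
        have i2 := h2 r hr
        rw [h3]
        have : a * F.toL0 u.1 x + b * F.toL0 v.1 x - g x =
            a * (F.toL0 u.1 x - g x) + b * (F.toL0 v.1 x - g x) := by
          linear_combination g x * hab
        rw [this]
        calc _ ≤ a * |F.toL0 u.1 x - g x| + b * |F.toL0 v.1 x - g x| := by
              refine (abs_add_le _ _).trans ?_
              rw [abs_mul, abs_mul, abs_of_nonneg ha, abs_of_nonneg hb]
          _ ≤ a * r + b * r := by gcongr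
          _ = r := by rw [← add_mul, hab, one_mul]
    exact hsub (hz n)
  filter_upwards [hw, ae_all_iff.2 key] with x h1 h2
  rw [Metric.tendsto_atTop] at h1 ⊢
  intro ε hε
  obtain ⟨N, hN⟩ := h1 (ε / 2) (half_pos hε)
  refine ⟨N, fun n hn => ?_⟩
  rw [Real.dist_eq]
  refine (h2 n (ε / 2) fun k hk => ?_).trans_lt (half_lt_self hε)
  have := hN k (hn.trans hk)
  rw [Real.dist_eq] at this
  exact this.le

theorem weakly_convex {w : ℕ → V × Lp ℝ p μ} {a : Lp ℝ p μ}
    (hw : TendstoWeakly (fun n => (w n).2) a) {z : ℕ → V × Lp ℝ p μ}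
    (hz : ∀ n, z n ∈ convexHull ℝ (w '' Ici n)) : TendstoWeakly (fun n => (z n).2) a := by
  intro φ
  rw [Metric.tendsto_atTop]
  intro ε hε
  obtain ⟨N, hN⟩ := Metric.tendsto_atTop.1 (hw φ) (ε / 2) (half_pos hε)
  refine ⟨N, fun n hn => ?_⟩
  have hsub : convexHull ℝ (w '' Ici n) ⊆
      {v : V × Lp ℝ p μ | φ v.2 ∈ Metric.closedBall (φ a) (ε / 2)} := by
    refine convexHull_min ?_ ?_
    · rintro _ ⟨k, hk, rfl⟩
      exact (hN k (hn.trans hk)).le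
    · intro u hu v hv b c hb hc hbc
      have := convex_closedBall (φ a) (ε / 2) hu hv hb hc hbc
      simpa using this
  exact (Metric.mem_closedBall.1 (hsub (hz n))).trans_lt (half_lt_self hε)

/-- From a sequence with bounded values one obtains, by convex combinations of the tails,
a sequence with strongly convergent values. -/
theorem exists_strong {f : ℕ → V} {c : ℕ → Lp ℝ p μ} {g : M →ₘ[μ] ℝ} (hf : F.TendstoAE f g)
    (hc : ∀ n, F.val (f n) ≤ c n) {C : ℝ} (hC : ∀ n, ‖c n‖ ≤ C) :
    ∃ (z : ℕ → V) (G : Lp ℝ p μ), F.TendstoAE z g ∧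
      Tendsto (fun n => F.val (z n)) atTop (𝓝 G) ∧ ∀ a, TendstoWeakly c a → G ≤ a := by
  let w : ℕ → V × Lp ℝ p μ := fun n => (f n, c n)
  obtain ⟨z, hz, G, hG⟩ := exists_tendsto_of_midpoint (W := V × Lp ℝ p μ) (fun q => F.val q.1)
    (fun q => F.nonneg' q.1) (fun u v => by
      have := F.val_add_smul_le (a := 1 / 2) (b := 1 / 2) (by norm_num) (by norm_num) u.1 v.1
      simpa only [Prod.smul_fst, Prod.fst_add, smul_add] using this)
    (fun n => convexHull ℝ (w '' Ici n))
    (fun a b hab => convexHull_mono (image_mono (Ici_subset_Ici.2 hab)))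
    (fun n => convex_convexHull ℝ _) C
    (fun n => ⟨w n, subset_convexHull ℝ _ ⟨n, self_mem_Ici, rfl⟩,
      (norm_mono (F.nonneg' _) (hc n)).trans (hC n)⟩)
  refine ⟨fun n => (z n).1, G, TendstoAE.convex F (w := w) hf hz, hG, fun a ha => ?_⟩
  have h1 : TendstoWeakly (fun n => (z n).2) a := weakly_convex (w := w) ha hz
  have h2 : ∀ n, F.val (z n).1 ≤ (z n).2 := fun n => by
    have hsub : convexHull ℝ (w '' Ici n) ⊆ {v : V × Lp ℝ p μ | 0 ≤ v.2 - F.val v.1} := by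
      refine convexHull_min ?_ ?_
      · rintro _ ⟨k, -, rfl⟩
        exact sub_nonneg.2 (hc k)
      · intro u hu v hv a b ha hb hab
        refine (add_nonneg (smul_nonneg' ha hu) (smul_nonneg' hb hv)).trans ?_
        rw [smul_sub, smul_sub, sub_add_sub_comm]
        exact sub_le_sub_left (F.val_add_smul_le ha hb u.1 v.1) _
    exact sub_nonneg.1 (hsub (hz n))
  have h3 := (h1.sub hG.tendstoWeakly).nonneg fun n => sub_nonneg.2 (h2 n)
  exact sub_nonneg.1 h3

theorem mem_lowerSet_iff [SigmaFinite μ] {g : M →ₘ[μ] ℝ} {G : Lp ℝ p μ} :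
    G ∈ F.lowerSet g ↔ ∀ (f : ℕ → V) (G' : Lp ℝ p μ), F.TendstoAE f g →
      TendstoWeakly (fun n => F.val (f n)) G' → G ≤ G' := by
  constructor
  · intro h f G' hf hG'
    exact h f G' (TendstoL0.of_ae hf) hG'
  · intro h f G' hf hG'
    obtain ⟨φ, hφ, hφ'⟩ := hf.exists_subseq_ae
    exact h (fun n => f (φ n)) G' hφ' (hG'.subseq hφ)

/-- The functions of finite relaxed energy. -/
def relaxedDomain [SigmaFinite μ] : Submodule ℝ (M →ₘ[μ] ℝ) where
  carrier := {g | F.relaxedEnergy g < ∞}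
  zero_mem' := F.relaxedEnergy_lt_top_iff.2
    ⟨fun _ => 0, ‖F.val 0‖, by simpa using F.tendstoAE_const 0, fun _ => le_rfl⟩
  add_mem' := by
    intro g k hg hk
    obtain ⟨f, C, hf, hC⟩ := F.relaxedEnergy_lt_top_iff.1 hg
    obtain ⟨h, D, hh, hD⟩ := F.relaxedEnergy_lt_top_iff.1 hk
    refine F.relaxedEnergy_lt_top_iff.2 ⟨_, C + D, hf.add F hh, fun n => ?_⟩
    exact (norm_mono (F.nonneg' _) (F.add_le' _ _)).trans
      ((norm_add_le _ _).trans (add_le_add (hC n) (hD n)))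
  smul_mem' := by
    intro c g hg
    obtain ⟨f, C, hf, hC⟩ := F.relaxedEnergy_lt_top_iff.1 hg
    refine F.relaxedEnergy_lt_top_iff.2 ⟨_, |c| * C, hf.const_smul F c, fun n => ?_⟩
    rw [F.smul', norm_smul, Real.norm_eq_abs, abs_abs]
    exact mul_le_mul_of_nonneg_left (hC n) (abs_nonneg c)

theorem sup_mem_lowerSet {g : M →ₘ[μ] ℝ} {G H : Lp ℝ p μ} (hG : G ∈ F.lowerSet g)
    (hH : H ∈ F.lowerSet g) : G ⊔ H ∈ F.lowerSet g :=
  fun f G' h1 h2 => sup_le (hG f G' h1 h2) (hH f G' h1 h2)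

theorem zero_mem_lowerSet (g : M →ₘ[μ] ℝ) : (0 : Lp ℝ p μ) ∈ F.lowerSet g :=
  fun _ _ _ h => h.nonneg fun _ => F.nonneg' _

theorem exists_isGreatest_lowerSet [SigmaFinite μ] {g : M →ₘ[μ] ℝ} (hg : F.relaxedEnergy g < ∞) :
    ∃ G, IsGreatest (F.lowerSet g) G := by
  have hp0 : 0 < (p : ℝ) := zero_lt_one.trans (one_lt_coe (p := p))
  obtain ⟨f, C, hf, hC⟩ := F.relaxedEnergy_lt_top_iff.1 hg
  obtain ⟨z, T, hz, hT, -⟩ := F.exists_strong hf (fun n => le_rfl) hC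
  have hST : ∀ H ∈ F.lowerSet g, H ≤ T := fun H hH =>
    F.mem_lowerSet_iff.1 hH z T hz hT.tendstoWeakly
  let S : Set ℝ := (fun H => ‖H‖) '' (F.lowerSet g ∩ Ici 0)
  have hSne : S.Nonempty := ⟨_, 0, ⟨F.zero_mem_lowerSet g, self_mem_Ici⟩, rfl⟩
  have hSb : BddAbove S := ⟨‖T‖, by
    rintro _ ⟨H, hH, rfl⟩
    exact norm_mono hH.2 (hST H hH.1)⟩
  set R := sSup S
  have hex : ∀ n : ℕ, ∃ H ∈ F.lowerSet g ∩ Ici 0, R - 1 / ((n : ℝ) + 1) < ‖H‖ := fun n => by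
    obtain ⟨_, ⟨H, hH, rfl⟩, h⟩ := exists_lt_of_lt_csSup hSne
      (sub_lt_self R (by positivity : (0 : ℝ) < 1 / ((n : ℝ) + 1)))
    exact ⟨H, hH, h⟩
  choose H hH hHR using hex
  let K : ℕ → Lp ℝ p μ := fun n => partialSups H n
  have hKmono : Monotone K := (partialSups H).monotone
  have hKS : ∀ n, K n ∈ F.lowerSet g := fun n => by
    induction n with
    | zero => simpa [K] using (hH 0).1
    | succ n ih =>
      simp only [K, partialSups_add_one]
      exact F.sup_mem_lowerSet ih (hH (n + 1)).1
  have hHK : ∀ n, H n ≤ K n := fun n => le_partialSups H n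
  have hK0 : ∀ n, 0 ≤ K n := fun n => (show 0 ≤ H n from (hH n).2).trans (hHK n)
  have hKR : ∀ n, ‖K n‖ ≤ R := fun n => le_csSup hSb ⟨K n, ⟨hKS n, hK0 n⟩, rfl⟩
  have hKlim : Tendsto (fun n => ‖K n‖) atTop (𝓝 R) := by
    refine tendsto_of_tendsto_of_tendsto_of_le_of_le ?_ tendsto_const_nhds
      (fun n => (hHR n).le.trans (norm_mono (hH n).2 (hHK n))) hKR
    simpa using tendsto_const_nhds.sub (tendsto_one_div_add_atTop_nhds_zero_nat (𝕜 := ℝ))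
  have hpow : Tendsto (fun n => ‖K n‖ ^ (p : ℝ)) atTop (𝓝 (R ^ (p : ℝ))) :=
    ((Real.continuous_rpow_const hp0.le).continuousAt).tendsto.comp hKlim
  have hcau : CauchySeq K := rpow_cauchy fun η hη => by
    obtain ⟨N, hN⟩ := eventually_atTop.1 (hpow.eventually (Metric.ball_mem_nhds _ (half_pos hη)))
    refine ⟨N, fun n k hn hk => ?_⟩
    have a1 := abs_lt.1 (Real.dist_eq _ _ ▸ Metric.mem_ball.1 (hN n hn))
    have a2 := abs_lt.1 (Real.dist_eq _ _ ▸ Metric.mem_ball.1 (hN k (hn.trans hk)))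
    have a3 := norm_superadd (hK0 n) (hKmono hk)
    rw [norm_sub_rev]
    linarith [a1.1, a2.2]
  obtain ⟨G, hG⟩ := cauchySeq_tendsto_of_complete hcau
  have hGS : G ∈ F.lowerSet g := fun f G' h1 h2 => le_of_tendsto' hG fun n => hKS n f G' h1 h2
  have hG0 : 0 ≤ G := ge_of_tendsto' hG hK0
  have hGR : ‖G‖ = R := tendsto_nhds_unique hG.norm hKlim
  refine ⟨G, hGS, fun L hL => ?_⟩
  have h1 : ‖G ⊔ L‖ ≤ R := le_csSup hSb ⟨G ⊔ L,
    ⟨F.sup_mem_lowerSet hGS hL, hG0.trans le_sup_left⟩, rfl⟩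
  have h2 := norm_superadd hG0 (le_sup_left : G ≤ G ⊔ L)
  have h3 : ‖G ⊔ L‖ ^ (p : ℝ) ≤ ‖G‖ ^ (p : ℝ) := by
    rw [hGR]; exact Real.rpow_le_rpow (norm_nonneg _) h1 hp0.le
  have h4 : ‖G ⊔ L - G‖ ^ (p : ℝ) ≤ 0 := by linarith
  have h5 : ‖G ⊔ L - G‖ = 0 := by
    by_contra hne
    exact absurd h4 (not_le.2 (Real.rpow_pos_of_pos ((norm_nonneg _).lt_of_ne' hne) _))
  rw [norm_eq_zero, sub_eq_zero] at h5
  exact h5 ▸ le_sup_right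

/-- The lower relaxation at `g`: the greatest element of `lowerSet g`. -/
def lowerRelaxation [SigmaFinite μ] (g : F.relaxedDomain) : Lp ℝ p μ :=
  (F.exists_isGreatest_lowerSet g.2).choose

theorem isGreatest_lowerRelaxation [SigmaFinite μ] (g : F.relaxedDomain) :
    IsGreatest (F.lowerSet (g : M →ₘ[μ] ℝ)) (F.lowerRelaxation g) :=
  (F.exists_isGreatest_lowerSet g.2).choose_spec

theorem lowerRelaxation_add_le [SigmaFinite μ] (g k : F.relaxedDomain) :
    F.lowerRelaxation (g + k) ≤ F.lowerRelaxation g + F.lowerRelaxation k := by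
  have key : ∀ (f h : ℕ → V) (G₁ G₂ : Lp ℝ p μ), F.TendstoAE f (g : M →ₘ[μ] ℝ) →
      TendstoWeakly (fun n => F.val (f n)) G₁ → F.TendstoAE h (k : M →ₘ[μ] ℝ) →
      TendstoWeakly (fun n => F.val (h n)) G₂ → F.lowerRelaxation (g + k) ≤ G₁ + G₂ := by
    intro f h G₁ G₂ hf h1 hh h2
    obtain ⟨C, hC⟩ := (h1.add h2).bounded
    obtain ⟨z, G, hz, hG, hle⟩ := F.exists_strong (hf.add F hh) (fun n => F.add_le' _ _) hC
    refine le_trans ?_ (hle _ (h1.add h2))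
    exact F.mem_lowerSet_iff.1 (F.isGreatest_lowerRelaxation (g + k)).1 z G hz hG.tendstoWeakly
  have step : ∀ (h : ℕ → V) (G₂ : Lp ℝ p μ), F.TendstoAE h (k : M →ₘ[μ] ℝ) →
      TendstoWeakly (fun n => F.val (h n)) G₂ →
      F.lowerRelaxation (g + k) - F.lowerRelaxation g ≤ G₂ := by
    intro h G₂ hh h2
    have : F.lowerRelaxation (g + k) - G₂ ∈ F.lowerSet (g : M →ₘ[μ] ℝ) :=
      F.mem_lowerSet_iff.2 fun f G₁ hf h1 => sub_le_iff_le_add.2 (key f h G₁ G₂ hf h1 hh h2)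
    have := (F.isGreatest_lowerRelaxation g).2 this
    rwa [sub_le_comm] at this
  have : F.lowerRelaxation (g + k) - F.lowerRelaxation g ∈ F.lowerSet (k : M →ₘ[μ] ℝ) :=
    F.mem_lowerSet_iff.2 fun h G₂ hh h2 => step h G₂ hh h2
  have := (F.isGreatest_lowerRelaxation k).2 this
  exact sub_le_iff_le_add'.1 this

theorem lowerRelaxation_nonneg [SigmaFinite μ] (g : F.relaxedDomain) :
    0 ≤ F.lowerRelaxation g :=
  (F.isGreatest_lowerRelaxation g).2 (F.zero_mem_lowerSet _)

theorem lowerRelaxation_smul_le [SigmaFinite μ] {c : ℝ} (hc : c ≠ 0) (g : F.relaxedDomain) :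
    F.lowerRelaxation (c • g) ≤ |c| • F.lowerRelaxation g := by
  have hc' : 0 < |c| := abs_pos.2 hc
  have smul_mono : ∀ {r : ℝ} {u v : Lp ℝ p μ}, 0 ≤ r → u ≤ v → r • u ≤ r • v := by
    intro r u v hr h
    rw [← sub_nonneg, ← smul_sub]
    exact smul_nonneg' hr (sub_nonneg.2 h)
  have : |c|⁻¹ • F.lowerRelaxation (c • g) ∈ F.lowerSet (g : M →ₘ[μ] ℝ) := by
    refine F.mem_lowerSet_iff.2 fun f G hf hG => ?_
    have h1 := F.mem_lowerSet_iff.1 (F.isGreatest_lowerRelaxation (c • g)).1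
      (fun n => c • f n) (|c| • G) (hf.const_smul F c) (by
        simp only [F.smul']
        exact hG.const_smul |c|)
    have h2 := smul_mono (inv_nonneg.2 hc'.le) h1
    rwa [smul_smul, inv_mul_cancel₀ hc'.ne', one_smul] at h2
  have h3 := smul_mono hc'.le ((F.isGreatest_lowerRelaxation g).2 this)
  rwa [smul_smul, mul_inv_cancel₀ hc'.ne', one_smul] at h3

/-- The lower relaxation of the functional `F`, as a functional on the functions of finite
relaxed energy. -/
def relaxed [SigmaFinite μ] : LpFunctional μ p F.relaxedDomain where
  toL0 := F.relaxedDomain.subtype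
  val := F.lowerRelaxation
  nonneg' := F.lowerRelaxation_nonneg
  add_le' := F.lowerRelaxation_add_le
  smul' c g := by
    rcases eq_or_ne c 0 with rfl | hc
    · rw [abs_zero, zero_smul, zero_smul]
      refine le_antisymm ?_ (F.lowerRelaxation_nonneg 0)
      refine F.mem_lowerSet_iff.1 (F.isGreatest_lowerRelaxation 0).1 (fun _ => 0) 0 ?_ ?_
      · have := F.tendstoAE_const 0
        rwa [map_zero] at this
      · rw [F.val_zero]
        exact fun φ => tendsto_const_nhds
    · refine le_antisymm (F.lowerRelaxation_smul_le hc g) ?_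
      have h := F.lowerRelaxation_smul_le (inv_ne_zero hc) (c • g)
      rw [smul_smul, inv_mul_cancel₀ hc, one_smul] at h
      rw [← sub_nonneg] at h ⊢
      have h2 := smul_nonneg' (abs_nonneg c) h
      rwa [smul_sub, smul_smul, ← abs_mul, mul_inv_cancel₀ hc, abs_one, one_smul] at h2

/-- The inclusion of the domain of `F` into the domain of its relaxation. -/
def toRelaxed [SigmaFinite μ] : V →ₗ[ℝ] F.relaxedDomain :=
  F.toL0.codRestrict F.relaxedDomain fun v =>
    F.relaxedEnergy_lt_top_iff.2 ⟨fun _ => v, ‖F.val v‖, F.tendstoAE_const v, fun _ => le_rfl⟩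

end LpFunctional
end General

section Metric

variable {M : Type*} [MetricSpace M]

/-- The local Lipschitz constant `lip f (x) = limsup_{y → x} |f y - f x| / d(y, x)`
(equal to `0` at isolated points). -/
def locLip (f : M → ℝ) (x : M) : ℝ :=
  limsup (fun y => |f y - f x| / dist y x) (𝓝[≠] x)

/-- `f` is Lipschitz (with some constant). -/
def IsLipschitz (f : M → ℝ) : Prop := ∃ K : ℝ≥0, LipschitzWith K f

theorem IsLipschitz.quot_le {f : M → ℝ} {K : ℝ≥0} (hf : LipschitzWith K f) (x y : M) :
    |f y - f x| / dist y x ≤ K := by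
  refine div_le_of_le_mul₀ dist_nonneg K.2 ?_
  rw [← Real.dist_eq]
  exact hf.dist_le_mul y x

theorem locLip_nonneg {f : M → ℝ} (hf : IsLipschitz f) (x : M) : 0 ≤ locLip f x := by
  obtain ⟨K, hK⟩ := hf
  rcases eq_or_neBot (𝓝[≠] x) with h | h
  · simp [locLip, h, limsup_eq]
  · exact le_limsup_of_frequently_le (Frequently.of_forall fun y => by positivity)
      ⟨K, eventually_map.2 (Eventually.of_forall fun y => IsLipschitz.quot_le hK x y)⟩

theorem locLip_le_iff {f : M → ℝ} (hf : IsLipschitz f) (x : M) {c : ℝ} (hc : 0 ≤ c) :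
    locLip f x ≤ c ↔ ∀ ε > 0, ∀ᶠ y in 𝓝[≠] x, |f y - f x| ≤ (c + ε) * dist y x := by
  obtain ⟨K, hK⟩ := hf
  have hiff : ∀ b : ℝ, (∀ᶠ y in 𝓝[≠] x, |f y - f x| / dist y x ≤ b) ↔
      ∀ᶠ y in 𝓝[≠] x, |f y - f x| ≤ b * dist y x := fun b => by
    refine eventually_congr ?_
    filter_upwards [self_mem_nhdsWithin] with y hy
    exact div_le_iff₀ (dist_pos.2 hy)
  constructor
  · intro h ε hε
    rw [← hiff]
    have : limsup (fun y => |f y - f x| / dist y x) (𝓝[≠] x) < c + ε := by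
      have : locLip f x < c + ε := by linarith
      exact this
    filter_upwards [eventually_lt_of_limsup_lt this
      ⟨K, eventually_map.2 (Eventually.of_forall fun y => IsLipschitz.quot_le hK x y)⟩] with y hy
      using hy.le
  · intro h
    rcases eq_or_neBot (𝓝[≠] x) with h0 | h0
    · simpa [locLip, h0, limsup_eq] using hc
    · refine le_of_forall_pos_le_add fun ε hε => ?_
      have := (hiff _).2 (h ε hε)
      exact limsup_le_of_le (IsCoboundedUnder.of_frequently_ge
        (a := 0) (Frequently.of_forall fun y => by positivity)) this

theorem IsLipschitz.add {f h : M → ℝ} (hf : IsLipschitz f) (hh : IsLipschitz h) :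
    IsLipschitz (f + h) := by
  obtain ⟨K, hK⟩ := hf
  obtain ⟨L, hL⟩ := hh
  exact ⟨K + L, hK.add hL⟩

theorem IsLipschitz.const_smul {f : M → ℝ} (hf : IsLipschitz f) (c : ℝ) : IsLipschitz (c • f) := by
  obtain ⟨K, hK⟩ := hf
  refine ⟨‖c‖₊ * K, LipschitzWith.of_dist_le_mul fun x y => ?_⟩
  rw [Pi.smul_apply, Pi.smul_apply, dist_smul₀, NNReal.coe_mul, coe_nnnorm, mul_assoc]
  exact mul_le_mul_of_nonneg_left (hK.dist_le_mul x y) (norm_nonneg c)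

theorem IsLipschitz.zero : IsLipschitz (0 : M → ℝ) := ⟨0, LipschitzWith.const 0⟩

theorem locLip_add_le {f h : M → ℝ} (hf : IsLipschitz f) (hh : IsLipschitz h) (x : M) :
    locLip (f + h) x ≤ locLip f x + locLip h x := by
  rw [locLip_le_iff (hf.add hh) x (add_nonneg (locLip_nonneg hf x) (locLip_nonneg hh x))]
  intro ε hε
  filter_upwards [(locLip_le_iff hf x (locLip_nonneg hf x)).1 le_rfl (ε / 2) (half_pos hε),
    (locLip_le_iff hh x (locLip_nonneg hh x)).1 le_rfl (ε / 2) (half_pos hε)] with y h1 h2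
  calc |(f + h) y - (f + h) x| = |(f y - f x) + (h y - h x)| := by
        simp only [Pi.add_apply]; ring_nf
    _ ≤ _ := (abs_add_le _ _).trans (add_le_add h1 h2)
    _ = _ := by ring

theorem locLip_smul_le {f : M → ℝ} (hf : IsLipschitz f) (c : ℝ) (x : M) :
    locLip (c • f) x ≤ |c| * locLip f x := by
  rw [locLip_le_iff (hf.const_smul c) x (mul_nonneg (abs_nonneg c) (locLip_nonneg hf x))]
  intro ε hε
  have hc : 0 < |c| + 1 := by positivity
  filter_upwards [(locLip_le_iff hf x (locLip_nonneg hf x)).1 le_rfl (ε / (|c| + 1))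
    (by positivity)] with y h1
  have e : (c • f) y - (c • f) x = c * (f y - f x) := by simp [mul_sub]
  rw [e, abs_mul]
  refine (mul_le_mul_of_nonneg_left h1 (abs_nonneg c)).trans ?_
  rw [← mul_assoc]
  refine mul_le_mul_of_nonneg_right ?_ dist_nonneg
  rw [mul_add]
  refine add_le_add_right ?_ _
  rw [mul_div_assoc', div_le_iff₀ hc]
  nlinarith [abs_nonneg c]

theorem locLip_smul {f : M → ℝ} (hf : IsLipschitz f) (c : ℝ) (x : M) :
    locLip (c • f) x = |c| * locLip f x := by
  refine le_antisymm (locLip_smul_le hf c x) ?_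
  rcases eq_or_ne c 0 with rfl | hc
  · rw [abs_zero, zero_mul]
    exact locLip_nonneg (hf.const_smul 0) x
  · have h := locLip_smul_le (hf.const_smul c) c⁻¹ x
    rw [smul_smul, inv_mul_cancel₀ hc, one_smul, abs_inv] at h
    rwa [inv_mul_eq_div, le_div_iff₀ (abs_pos.2 hc), mul_comm] at h

variable [MeasurableSpace M] [BorelSpace M]

theorem measurable_locLip {f : M → ℝ} (hf : IsLipschitz f) : Measurable (locLip f) := by
  have hfc : Continuous f := hf.choose_spec.continuous
  refine measurable_of_Iic fun c => ?_
  rcases lt_or_ge c 0 with hc | hc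
  · have : locLip f ⁻¹' Iic c = ∅ := by
      ext x
      simp only [mem_preimage, mem_Iic, mem_empty_iff_false, iff_false, not_le]
      exact hc.trans_le (locLip_nonneg hf x)
    rw [this]
    exact MeasurableSet.empty
  · let A : ℕ → ℕ → Set M := fun k n =>
      {x | ∀ y, dist y x < 1 / ((n : ℝ) + 1) → |f y - f x| ≤ (c + 1 / ((k : ℝ) + 1)) * dist y x}
    have hA : ∀ k n, IsClosed (A k n) := fun k n => by
      have : A k n = ⋂ y, ({x | 1 / ((n : ℝ) + 1) ≤ dist y x} ∪
          {x | |f y - f x| ≤ (c + 1 / ((k : ℝ) + 1)) * dist y x}) := by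
        ext x
        simp only [A, mem_iInter, mem_union]
        refine forall_congr' fun y => ?_
        change (dist y x < 1 / ((n : ℝ) + 1) → _) ↔ (1 / ((n : ℝ) + 1) ≤ dist y x) ∨ _
        rw [imp_iff_not_or, not_lt]
        rfl
      rw [this]
      exact isClosed_iInter fun y => (isClosed_le (by fun_prop) (by fun_prop)).union
        (isClosed_le (by fun_prop) (by fun_prop))
    have : locLip f ⁻¹' Iic c = ⋂ k, ⋃ n, A k n := by
      ext x
      rw [mem_preimage, mem_Iic, locLip_le_iff hf x hc, mem_iInter]
      constructor
      · intro h k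
        have h1 := h (1 / ((k : ℝ) + 1)) (by positivity)
        rw [eventually_nhdsWithin_iff, Metric.eventually_nhds_iff] at h1
        obtain ⟨r, hr, h1⟩ := h1
        obtain ⟨n, hn⟩ := exists_nat_one_div_lt hr
        refine mem_iUnion.2 ⟨n, fun y hy => ?_⟩
        rcases eq_or_ne y x with rfl | hne
        · simp
        · exact h1 (hy.trans hn) hne
      · intro h ε hε
        obtain ⟨k, hk⟩ := exists_nat_one_div_lt hε
        obtain ⟨n, hn⟩ := mem_iUnion.1 (h k)
        rw [eventually_nhdsWithin_iff, Metric.eventually_nhds_iff]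
        refine ⟨1 / ((n : ℝ) + 1), by positivity, fun y hy _ => (hn y hy).trans ?_⟩
        exact mul_le_mul_of_nonneg_right (by linarith) dist_nonneg
    rw [this]
    exact MeasurableSet.iInter fun k => MeasurableSet.iUnion fun n => (hA k n).measurableSet

variable (μ : Measure M) (p : ℝ≥0) [Fact (1 < p)]

/-- The Lipschitz functions `f` with `lip f ∈ L^p(μ)`. -/
def lipDomain : Submodule ℝ (M → ℝ) where
  carrier := {f | IsLipschitz f ∧ MemLp (locLip f) p μ}
  zero_mem' := by
    refine ⟨IsLipschitz.zero, ?_⟩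
    have : locLip (0 : M → ℝ) = 0 := funext fun x => by
      have := locLip_smul (IsLipschitz.zero (M := M)) 0 x
      simpa using this
    rw [this]
    exact MemLp.zero
  add_mem' := by
    rintro f h ⟨hf, hf'⟩ ⟨hh, hh'⟩
    refine ⟨hf.add hh, (hf'.add hh').mono
      (measurable_locLip (hf.add hh)).aestronglyMeasurable (ae_of_all _ fun x => ?_)⟩
    rw [Real.norm_of_nonneg (locLip_nonneg (hf.add hh) x)]
    exact (locLip_add_le hf hh x).trans (le_abs_self _)
  smul_mem' := by
    rintro c f ⟨hf, hf'⟩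
    refine ⟨hf.const_smul c, ?_⟩
    have : locLip (c • f) = fun x => |c| * locLip f x := funext fun x => locLip_smul hf c x
    rw [this]
    exact hf'.const_mul _

variable {μ p}

theorem isLipschitz_coe (f : lipDomain μ p) : IsLipschitz (f : M → ℝ) := f.2.1

theorem memLp_coe (f : lipDomain μ p) : MemLp (locLip (f : M → ℝ)) p μ := f.2.2

theorem aestronglyMeasurable_coe (f : lipDomain μ p) : AEStronglyMeasurable (f : M → ℝ) μ :=
  (isLipschitz_coe f).choose_spec.continuous.aestronglyMeasurable

/-- `lip f` as an element of `L^p(μ)`. -/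
def lipVal (f : lipDomain μ p) : Lp ℝ p μ := (memLp_coe f).toLp (locLip (f : M → ℝ))

theorem coeFn_lipVal (f : lipDomain μ p) : lipVal f =ᵐ[μ] locLip (f : M → ℝ) :=
  (memLp_coe f).coeFn_toLp

theorem lipVal_nonneg (f : lipDomain μ p) : 0 ≤ lipVal f := by
  rw [← Lp.coeFn_nonneg]
  filter_upwards [coeFn_lipVal f] with x hx
  rw [hx]
  exact locLip_nonneg (isLipschitz_coe f) x

theorem lipVal_add_le (f h : lipDomain μ p) : lipVal (f + h) ≤ lipVal f + lipVal h := by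
  rw [← Lp.coeFn_le]
  filter_upwards [coeFn_lipVal f, coeFn_lipVal h, coeFn_lipVal (f + h),
    Lp.coeFn_add (lipVal f) (lipVal h)] with x h1 h2 h3 h4
  rw [h3, h4, Pi.add_apply, h1, h2]
  exact locLip_add_le (isLipschitz_coe f) (isLipschitz_coe h) x

theorem lipVal_smul (c : ℝ) (f : lipDomain μ p) : lipVal (c • f) = |c| • lipVal f := by
  refine Lp.ext ?_
  filter_upwards [coeFn_lipVal f, coeFn_lipVal (c • f), Lp.coeFn_smul (|c|) (lipVal f)]
    with x h1 h2 h3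
  rw [h2, h3, Pi.smul_apply, h1]
  exact locLip_smul (isLipschitz_coe f) c x

variable (μ p)

/-- The functional `f ↦ lip f` on the Lipschitz functions with `lip f ∈ L^p(μ)`. -/
def lipFunctional : LpFunctional μ p (lipDomain μ p) where
  toL0 :=
    { toFun := fun f => AEEqFun.mk f (aestronglyMeasurable_coe f)
      map_add' := fun _ _ => rfl
      map_smul' := fun _ _ => rfl }
  val := lipVal
  nonneg' := lipVal_nonneg
  add_le' := lipVal_add_le
  smul' := lipVal_smul

/-- The `L^p`-Lipschitz module `L^p_lip(T^*M)`. -/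
abbrev LipschitzModule : Type _ := (lipFunctional μ p).Mod

/-- The functional `f ↦ |Df|_{*,p}` (relaxed slope): the lower relaxation of `f ↦ lip f`. -/
abbrev relaxedSlope [SigmaFinite μ] : LpFunctional μ p (lipFunctional μ p).relaxedDomain :=
  (lipFunctional μ p).relaxed

/-- The `L^p`-cotangent module `L^p(T^*M)`. -/
abbrev CotangentModule [SigmaFinite μ] : Type _ := (relaxedSlope μ p).Mod

/-- The `Lipschitz_0` module `L^p_{lip_0}(T^*M)`. -/
abbrev lipschitzZeroModule : Submodule ℝ (LipschitzModule μ p) := (lipFunctional μ p).zeroModule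

end Metric

end NormedModules

end

open NormedModules

/-! ### Multiplication by `L^∞` functions and the pointwise norm. -/

namespace NormedModules

namespace LpFunctional

section Module

variable {M : Type*} [MeasurableSpace M] {μ : Measure M} {p : ℝ≥0} [Fact (1 < p)]
  {V : Type*} [AddCommGroup V] [Module ℝ V] (F : LpFunctional μ p V)

/-! Reading a family `(f_i, A_i)` in the relaxed functional defines `relaxMap`, from the Lipschitz
module to the cotangent module. It is `L^∞`-linear and contracts pointwise norms, because constant
sequences give `|Df|_* ≤ lip f`. The theorem amounts to finding its kernel, its norm and its range.

Closedness (`relaxMap_eq_of_tendsto`). Let `f_n → g` and `d f_n → ω`. As `m → ∞`, `f_n - f_m → f_n -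
g` while `lip (f_n - f_m) = |d f_n - d f_m|` tends strongly to `|d f_n - ω|`. Hence `|D(f_n - g)|_*
≤ |d f_n - ω|`, and `relaxMap ω = d_p g`. With `g = 0` this puts the Lipschitz_0 module in the
kernel.

Lower bound (`le_relaxed_val`). Let `h_n → f` and `lip h_n ⇀ G`. Weak reflexivity gives a weak limit
`ω` of a subsequence of `d h_n`. By Mazur's lemma it is a strong limit along convex combinations
that still converge to `f`, so `ω - d f` lies in the Lipschitz_0 module. Since `{|v| ≤ u}` is convex
and closed, `|ω| ≤ G`. A common lower bound of all `|d f + w|` is therefore below every competitor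
`G`, hence below `|Df|_*`. Localization to the pieces of a pre-form and density extend this to the
whole module (`isGLB_pnorm_relaxMap`).

From pointwise norms to norms. Cutting and pasting along a set realizes the minimum of two pointwise
norms inside a coset. Together with the uniform convexity of `L^p`, this shows that the infimum of
the pointwise norms of a coset has norm equal to the quotient norm (`exists_tendsto_pnorm_coset`).
So `relaxMap` is isometric on the quotient and its range is closed. The range contains every `d_p
g`, by weak reflexivity, Mazur and closedness, and so it is everything.

Closability says that limits of differentials along null sequences vanish, that is, the Lipschitz_0
module is trivial; then `relaxMap` itself preserves pointwise norms. A Lipschitz `f` with class in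
`D_p` need not have `lip f ∈ L^p` a priori, so `|Df|_* = lip f` is proved on small balls with
truncated, compactly cut-off competitors (`pnorm_eq_locLip_on_ball`) and transferred to `M` by inner
regularity. -/

theorem ae_abs_le_norm (a : Lp ℝ ∞ μ) : ∀ᵐ x ∂μ, |a x| ≤ ‖a‖ := by
  have h0 : ∀ᵐ x ∂μ, ‖a x‖ₑ ≤ eLpNorm a ∞ μ := by
    rw [eLpNorm_exponent_top]
    exact enorm_ae_le_eLpNormEssSup a μ
  filter_upwards [h0] with x hx
  rw [← Real.norm_eq_abs, Lp.norm_def, ← toReal_enorm]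
  exact ENNReal.toReal_mono (Lp.eLpNorm_ne_top a) hx

theorem exists_ae_tendsto_subseq {u : ℕ → Lp ℝ p μ} {v : Lp ℝ p μ} (h : Tendsto u atTop (𝓝 v)) :
    ∃ φ : ℕ → ℕ, StrictMono φ ∧ ∀ᵐ x ∂μ, Tendsto (fun n => u (φ n) x) atTop (𝓝 (v x)) :=
  (tendstoInMeasure_of_tendsto_Lp h).exists_seq_tendsto_ae

/-- Multiplication of the module by a bounded function with countably many values. -/
noncomputable def pcMul (c : M → ℝ) (hc : IsPiecewiseConst c) (K : ℝ) (hK : ∀ᵐ x ∂μ, |c x| ≤ K) :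
    F.Mod →L[ℝ] F.Mod :=
  (F.mulPfm c hc K hK).completion

theorem pcMul_coe (c : M → ℝ) (hc : IsPiecewiseConst c) (K : ℝ) (hK : ∀ᵐ x ∂μ, |c x| ≤ K)
    (s : F.Pfm) : F.pcMul c hc K hK (s : F.Mod) = (F.mulPfmFun c hc K hK s : F.Pfm) :=
  ContinuousLinearMap.completion_apply_coe _ _

theorem ext_coe {E : Type*} [NormedAddCommGroup E] [NormedSpace ℝ E] {S T : F.Mod →L[ℝ] E}
    (h : ∀ s : F.Pfm, S (s : F.Mod) = T (s : F.Mod)) : S = T := by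
  ext v
  induction v using UniformSpace.Completion.induction_on with
  | hp => exact isClosed_eq S.continuous T.continuous
  | ih s => exact h s

theorem exists_seq_pfm (v : F.Mod) :
    ∃ s : ℕ → F.Pfm, Tendsto (fun n => (s n : F.Mod)) atTop (𝓝 v) := by
  obtain ⟨u, hu, h⟩ := mem_closure_iff_seq_limit.1
    ((UniformSpace.Completion.denseRange_coe (α := F.Pfm)) v)
  choose s hs using hu
  exact ⟨s, by simpa only [hs] using h⟩

/-- On pre-forms the difference of the two operators is multiplication by `c - c'`. -/
theorem norm_pcMul_sub_le {c c' : M → ℝ} (hc : IsPiecewiseConst c) (hc' : IsPiecewiseConst c')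
    {K K' : ℝ} (hK : ∀ᵐ x ∂μ, |c x| ≤ K) (hK' : ∀ᵐ x ∂μ, |c' x| ≤ K') {ε : ℝ} (hε : 0 ≤ ε)
    (h : ∀ᵐ x ∂μ, |c x - c' x| ≤ ε) :
    ‖F.pcMul c hc K hK - F.pcMul c' hc' K' hK'‖ ≤ ε := by
  refine ContinuousLinearMap.opNorm_le_bound _ hε fun v => ?_
  induction v using UniformSpace.Completion.induction_on with
  | hp => exact isClosed_le (by fun_prop) (by fun_prop)
  | ih s =>
    rw [sub_apply, pcMul_coe, pcMul_coe,
      ← UniformSpace.Completion.coe_sub, UniformSpace.Completion.norm_coe,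
      UniformSpace.Completion.norm_coe]
    have h3 : IsPiecewiseConst (fun x => c x - c' x) := hc.map₂ (· - ·) hc'
    have key : F.mulPfmFun c hc K hK s - F.mulPfmFun c' hc' K' hK' s =
        F.mulPfmFun _ h3 ε h s :=
      Subtype.ext (funext fun x => (sub_smul (c x) (c' x) (s.fn x)).symm)
    rw [key]
    exact F.norm_mulPfmFun_le _ _ _ _ s

theorem mulApprox_eq (a : Lp ℝ ∞ μ) (n : ℕ) : F.mulApprox a n = F.pcMul (quant n a)
    (isPiecewiseConst_quant n (Lp.stronglyMeasurable a).measurable) (‖a‖ + 1)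
    (ae_quant_le n a) := rfl

/-- Frees `mul a` from the particular approximation `quant n a`: the distance to `mulApprox a n` is
at most `ε + 1 / (n + 1)`, and `n → ∞`. -/
theorem norm_pcMul_sub_mul_le {c : M → ℝ} (hc : IsPiecewiseConst c) {K : ℝ}
    (hK : ∀ᵐ x ∂μ, |c x| ≤ K) (a : Lp ℝ ∞ μ) {ε : ℝ} (hε : 0 ≤ ε)
    (h : ∀ᵐ x ∂μ, |c x - a x| ≤ ε) : ‖F.pcMul c hc K hK - F.mul a‖ ≤ ε := by
  have h1 : Tendsto (fun n => ‖F.pcMul c hc K hK - F.mulApprox a n‖) atTop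
      (𝓝 ‖F.pcMul c hc K hK - F.mul a‖) :=
    (tendsto_const_nhds.sub (F.tendsto_mulApprox a)).norm
  have h2 : Tendsto (fun n : ℕ => ε + 1 / ((n : ℝ) + 1)) atTop (𝓝 ε) := by
    simpa using tendsto_const_nhds.add (tendsto_one_div_add_atTop_nhds_zero_nat (𝕜 := ℝ))
  refine le_of_tendsto_of_tendsto' h1 h2 fun n => ?_
  rw [mulApprox_eq]
  refine F.norm_pcMul_sub_le _ _ _ _ (by positivity) ?_
  filter_upwards [h] with x hx
  have e := abs_quant_sub_le n a x
  rw [abs_sub_comm] at e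
  exact (abs_sub_le _ (a x) _).trans (add_le_add hx e)

theorem mul_eq_pcMul {c : M → ℝ} (hc : IsPiecewiseConst c) {K : ℝ}
    (hK : ∀ᵐ x ∂μ, |c x| ≤ K) (a : Lp ℝ ∞ μ) (h : a =ᵐ[μ] c) :
    F.mul a = F.pcMul c hc K hK := by
  have := F.norm_pcMul_sub_mul_le hc hK a le_rfl (by
    filter_upwards [h] with x hx
    simp [hx])
  have h2 : ‖F.pcMul c hc K hK - F.mul a‖ = 0 := le_antisymm this (norm_nonneg _)
  exact (sub_eq_zero.1 (norm_eq_zero.1 h2)).symm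

theorem mul_eq_of_tendsto {T : ℕ → F.Mod →L[ℝ] F.Mod} {S : F.Mod →L[ℝ] F.Mod}
    (hT : Tendsto T atTop (𝓝 S)) (a : Lp ℝ ∞ μ) (C : ℝ)
    (h : ∀ n : ℕ, ‖T n - F.mul a‖ ≤ C * (1 / ((n : ℝ) + 1))) : S = F.mul a := by
  refine tendsto_nhds_unique hT ?_
  rw [tendsto_iff_norm_sub_tendsto_zero]
  refine squeeze_zero (fun n => norm_nonneg _) h ?_
  simpa using (tendsto_one_div_add_atTop_nhds_zero_nat (𝕜 := ℝ)).const_mul C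

/-- The identity is clear for countably valued factors, and composition is continuous in operator
norm. It remains that `quant n a * quant n b` approximates `a b` uniformly. -/
theorem mul_comp_mul {a b c : Lp ℝ ∞ μ} (h : ∀ᵐ x ∂μ, c x = a x * b x) :
    (F.mul a).comp (F.mul b) = F.mul c := by
  have ha := fun n => isPiecewiseConst_quant n (Lp.stronglyMeasurable a).measurable
  have hb := fun n => isPiecewiseConst_quant n (Lp.stronglyMeasurable b).measurable
  have hab : ∀ n, IsPiecewiseConst fun x => quant n a x * quant n b x :=
    fun n => (ha n).map₂ (· * ·) (hb n)
  have hK : ∀ n, ∀ᵐ x ∂μ, |quant n a x * quant n b x| ≤ (‖a‖ + 1) * (‖b‖ + 1) := fun n => by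
    filter_upwards [ae_quant_le n a, ae_quant_le n b] with x h1 h2
    rw [abs_mul]
    exact mul_le_mul h1 h2 (abs_nonneg _) (by positivity)
  have e : ∀ n, (F.mulApprox a n).comp (F.mulApprox b n) = F.pcMul _ (hab n) _ (hK n) := fun n => by
    refine F.ext_coe fun s => ?_
    rw [ContinuousLinearMap.comp_apply, mulApprox_eq, mulApprox_eq, pcMul_coe, pcMul_coe, pcMul_coe]
    congr 1
    exact Subtype.ext (funext fun x => smul_smul (quant n a x) (quant n b x) (s.fn x))
  refine F.mul_eq_of_tendsto (T := fun n => (F.mulApprox a n).comp (F.mulApprox b n))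
    (((ContinuousLinearMap.compL ℝ F.Mod F.Mod F.Mod).continuous₂.tendsto (F.mul a, F.mul b)).comp
      ((F.tendsto_mulApprox a).prodMk_nhds (F.tendsto_mulApprox b))) c
    (‖a‖ + 1 + ‖b‖) fun n => ?_
  rw [e]
  refine F.norm_pcMul_sub_mul_le _ _ _ (by positivity) ?_
  filter_upwards [h, ae_quant_le n a, ae_abs_le_norm b] with x h1 h2 h3
  have e1 := abs_quant_sub_le n a x
  have e2 := abs_quant_sub_le n b x
  -- `‖a‖ + 1` bounds `quant n a` and `‖b‖` bounds `b`, whence the constant `‖a‖ + 1 + ‖b‖`.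
  have : quant n a x * quant n b x - c x =
      quant n a x * (quant n b x - b x) + b x * (quant n a x - a x) := by rw [h1]; ring
  rw [this, add_mul]
  refine (abs_add_le _ _).trans (add_le_add ?_ ?_)
  · rw [abs_mul]
    exact mul_le_mul h2 e2 (abs_nonneg _) (by positivity)
  · rw [abs_mul]
    exact mul_le_mul h3 e1 (abs_nonneg _) (by positivity)

theorem mul_mul {a b c : Lp ℝ ∞ μ} (h : ∀ᵐ x ∂μ, c x = a x * b x) (v : F.Mod) :
    F.mul a (F.mul b v) = F.mul c v := by
  rw [← F.mul_comp_mul h]; rfl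

theorem mul_add_mul {a b c : Lp ℝ ∞ μ} (h : ∀ᵐ x ∂μ, c x = a x + b x) (v : F.Mod) :
    F.mul a v + F.mul b v = F.mul c v := by
  have ha := fun n => isPiecewiseConst_quant n (Lp.stronglyMeasurable a).measurable
  have hb := fun n => isPiecewiseConst_quant n (Lp.stronglyMeasurable b).measurable
  have hab : ∀ n, IsPiecewiseConst fun x => quant n a x + quant n b x :=
    fun n => (ha n).map₂ (· + ·) (hb n)
  have hK : ∀ n, ∀ᵐ x ∂μ, |quant n a x + quant n b x| ≤ (‖a‖ + 1) + (‖b‖ + 1) := fun n => by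
    filter_upwards [ae_quant_le n a, ae_quant_le n b] with x h1 h2
    exact (abs_add_le _ _).trans (add_le_add h1 h2)
  have e : ∀ n, F.mulApprox a n + F.mulApprox b n = F.pcMul _ (hab n) _ (hK n) := fun n => by
    refine F.ext_coe fun s => ?_
    rw [add_apply, mulApprox_eq, mulApprox_eq, pcMul_coe, pcMul_coe, pcMul_coe,
      ← UniformSpace.Completion.coe_add]
    congr 1
    exact Subtype.ext (funext fun x => (add_smul (quant n a x) (quant n b x) (s.fn x)).symm)
  have : F.mul a + F.mul b = F.mul c := by
    refine F.mul_eq_of_tendsto (T := fun n => F.mulApprox a n + F.mulApprox b n)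
      ((F.tendsto_mulApprox a).add (F.tendsto_mulApprox b)) c 2 fun n => ?_
    rw [e]
    refine F.norm_pcMul_sub_mul_le _ _ _ (by positivity) ?_
    filter_upwards [h] with x h1
    have : quant n a x + quant n b x - c x = (quant n a x - a x) + (quant n b x - b x) := by
      rw [h1]; ring
    rw [this, two_mul]
    exact (abs_add_le _ _).trans (add_le_add (abs_quant_sub_le n a x) (abs_quant_sub_le n b x))
  rw [← this]; rfl

theorem coeFn_chi (A : Set M) (hA : MeasurableSet A) :
    chi μ A hA =ᵐ[μ] A.indicator fun _ => (1 : ℝ) :=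
  MemLp.coeFn_toLp _

theorem isPiecewiseConst_indicator {A : Set M} (hA : MeasurableSet A) :
    IsPiecewiseConst (A.indicator fun _ => (1 : ℝ)) := by
  refine IsPiecewiseConst.of_countable ?_ (measurable_const.indicator hA)
  refine (Set.countable_insert.2 (countable_singleton (1 : ℝ)) : ({0, 1} : Set ℝ).Countable).mono ?_
  rintro _ ⟨x, rfl⟩
  by_cases hx : x ∈ A <;> simp [hx]

theorem abs_indicator_one_le (A : Set M) (x : M) : |A.indicator (fun _ => (1 : ℝ)) x| ≤ 1 := by
  by_cases hx : x ∈ A <;> simp [hx]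

/-- An indicator is already countably valued, so no limit is involved; identities for restrictions
of pre-forms become identities between maps `M → V`. -/
theorem mul_chi_coe {A : Set M} (hA : MeasurableSet A) (s : F.Pfm) :
    F.mul (chi μ A hA) (s : F.Mod) = (F.mulPfmFun _ (isPiecewiseConst_indicator hA) 1
      (ae_of_all _ (abs_indicator_one_le A)) s : F.Pfm) := by
  rw [F.mul_eq_pcMul (isPiecewiseConst_indicator hA) (ae_of_all _ (abs_indicator_one_le A)) _
    (coeFn_chi A hA), pcMul_coe]

theorem mul_chi_univ (v : F.Mod) : F.mul (chi μ univ MeasurableSet.univ) v = v := by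
  have : F.mul (chi μ univ MeasurableSet.univ) = ContinuousLinearMap.id ℝ F.Mod := by
    refine F.ext_coe fun s => ?_
    rw [mul_chi_coe]
    congr 1
    exact Subtype.ext (funext fun x => by
      change (univ.indicator (fun _ => (1 : ℝ)) x) • s.fn x = s.fn x
      simp)
  rw [this]; rfl

theorem mul_chi_mul_chi {A B : Set M} (hA : MeasurableSet A) (hB : MeasurableSet B) (v : F.Mod) :
    F.mul (chi μ A hA) (F.mul (chi μ B hB) v) = F.mul (chi μ (A ∩ B) (hA.inter hB)) v := by
  refine F.mul_mul ?_ v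
  filter_upwards [coeFn_chi (μ := μ) A hA, coeFn_chi (μ := μ) B hB,
    coeFn_chi (μ := μ) _ (hA.inter hB)] with x h1 h2 h3
  rw [h1, h2, h3]
  by_cases hxA : x ∈ A <;> by_cases hxB : x ∈ B <;> simp [hxA, hxB]

theorem mul_chi_add_of_disjoint {A B : Set M} (hA : MeasurableSet A) (hB : MeasurableSet B)
    (h : Disjoint A B) (v : F.Mod) :
    F.mul (chi μ A hA) v + F.mul (chi μ B hB) v = F.mul (chi μ (A ∪ B) (hA.union hB)) v := by
  refine F.mul_add_mul ?_ v
  filter_upwards [coeFn_chi (μ := μ) A hA, coeFn_chi (μ := μ) B hB,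
    coeFn_chi (μ := μ) _ (hA.union hB)] with x h1 h2 h3
  rw [h1, h2, h3]
  by_cases hxA : x ∈ A
  · have hxB : x ∉ B := fun hxB => disjoint_left.1 h hxA hxB
    simp [hxA, hxB]
  · by_cases hxB : x ∈ B <;> simp [hxA, hxB]

theorem mul_chi_add_compl {A : Set M} (hA : MeasurableSet A) (v : F.Mod) :
    F.mul (chi μ A hA) v + F.mul (chi μ Aᶜ hA.compl) v = v := by
  rw [F.mul_chi_add_of_disjoint hA hA.compl disjoint_compl_right]
  conv_rhs => rw [← F.mul_chi_univ v]
  simp only [union_compl_self]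

theorem continuous_pnorm : Continuous F.pnorm := UniformSpace.Completion.continuous_extension

theorem norm_pnorm (v : F.Mod) : ‖F.pnorm v‖ = ‖v‖ := by
  induction v using UniformSpace.Completion.induction_on with
  | hp => exact isClosed_eq F.continuous_pnorm.norm continuous_norm
  | ih s => rw [pnorm_coe, UniformSpace.Completion.norm_coe, norm_pfm]

theorem pnorm_nonneg (v : F.Mod) : 0 ≤ F.pnorm v := by
  induction v using UniformSpace.Completion.induction_on with
  | hp => exact isClosed_le continuous_const F.continuous_pnorm
  | ih s => rw [pnorm_coe]; exact s.pnorm_nonneg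

theorem pnorm_add_le (v w : F.Mod) : F.pnorm (v + w) ≤ F.pnorm v + F.pnorm w := by
  have hc := F.continuous_pnorm
  induction v, w using UniformSpace.Completion.induction_on₂ with
  | hp => exact isClosed_le (by fun_prop) (by fun_prop)
  | ih s t =>
    rw [← UniformSpace.Completion.coe_add, pnorm_coe, pnorm_coe, pnorm_coe]
    exact s.pnorm_add_le t

theorem pnorm_smul (c : ℝ) (v : F.Mod) : F.pnorm (c • v) = |c| • F.pnorm v := by
  induction v using UniformSpace.Completion.induction_on with
  | hp =>
    exact isClosed_eq (F.continuous_pnorm.comp (continuous_const_smul c))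
      (F.continuous_pnorm.const_smul |c|)
  | ih s => rw [← UniformSpace.Completion.coe_smul, pnorm_coe, pnorm_coe, Pfm.pnorm_smul]

theorem pnorm_zero : F.pnorm 0 = 0 := by
  simpa using F.pnorm_smul 0 0

theorem pnorm_eq_zero {v : F.Mod} : F.pnorm v = 0 ↔ v = 0 := by
  rw [← norm_eq_zero, norm_pnorm, norm_eq_zero]

theorem pnorm_le_add_sub (v w : F.Mod) : F.pnorm v ≤ F.pnorm w + F.pnorm (v - w) := by
  have := F.pnorm_add_le w (v - w)
  rwa [add_sub_cancel] at this

theorem norm_le_of_pnorm_le {v : F.Mod} {u : Lp ℝ p μ} (h : F.pnorm v ≤ u) : ‖v‖ ≤ ‖u‖ := by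
  rw [← norm_pnorm]
  exact norm_mono (F.pnorm_nonneg v) h

theorem ae_pnorm_nonneg (v : F.Mod) : ∀ᵐ x ∂μ, 0 ≤ F.pnorm v x :=
  (Lp.coeFn_nonneg _).2 (F.pnorm_nonneg v)

theorem norm_d (f : V) : ‖F.d f‖ = ‖F.val f‖ := by rw [← norm_pnorm, pnorm_d]

/-- On pre-forms the formula is pointwise. The diagonal sequence `quant n a · s_n` converges to `a ·
v`, and the formula passes to the limit almost everywhere along a subsequence. -/
theorem pnorm_mul (a : Lp ℝ ∞ μ) (v : F.Mod) :
    ∀ᵐ x ∂μ, F.pnorm (F.mul a v) x = |a x| * F.pnorm v x := by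
  obtain ⟨s, hs⟩ := F.exists_seq_pfm v
  have h1 : Tendsto (fun n => F.mulApprox a n (s n : F.Mod)) atTop (𝓝 (F.mul a v)) :=
    
    ((isBoundedBilinearMap_apply (𝕜 := ℝ) (E := F.Mod) (F := F.Mod)).continuous.tendsto
      (F.mul a, v)).comp ((F.tendsto_mulApprox a).prodMk_nhds hs)
  obtain ⟨φ, hφ, hφ'⟩ := exists_ae_tendsto_subseq ((F.continuous_pnorm.tendsto _).comp h1)
  -- The second extraction is made inside the first, so that the norms of the products and of the
  -- `s_n` both converge a.e. along `φ ∘ ψ`.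
  obtain ⟨ψ, hψ, hψ'⟩ := exists_ae_tendsto_subseq
    ((F.continuous_pnorm.tendsto _).comp (hs.comp hφ.tendsto_atTop))
  have h2 : ∀ᵐ x ∂μ, ∀ n, F.pnorm (F.mulApprox a n (s n : F.Mod)) x =
      |quant n a x| * F.pnorm (s n : F.Mod) x := ae_all_iff.2 fun n => by
    rw [mulApprox_eq, pcMul_coe, pnorm_coe, pnorm_coe]
    exact F.pnorm_mulPfmFun _ _ _ _ _
  filter_upwards [hφ', hψ', h2] with x h3 h4 h5
  have h6 : Tendsto (fun n => quant n a x) atTop (𝓝 (a x)) := by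
    rw [tendsto_iff_norm_sub_tendsto_zero]
    exact squeeze_zero (fun n => norm_nonneg _) (fun n => abs_quant_sub_le n a x)
      tendsto_one_div_add_atTop_nhds_zero_nat
  have h7 := (h6.comp (hφ.comp hψ).tendsto_atTop).abs.mul h4
  refine tendsto_nhds_unique (h3.comp hψ.tendsto_atTop) (h7.congr fun n => ?_)
  exact (h5 (φ (ψ n))).symm

theorem pnorm_mul_chi {A : Set M} (hA : MeasurableSet A) (v : F.Mod) :
    ∀ᵐ x ∂μ, F.pnorm (F.mul (chi μ A hA) v) x = A.indicator (F.pnorm v) x := by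
  filter_upwards [F.pnorm_mul (chi μ A hA) v, coeFn_chi (μ := μ) A hA] with x h1 h2
  rw [h1, h2]
  by_cases h : x ∈ A <;> simp [h]

/-- Turns vanishing on a set into an a.e. statement; locality and glueing are checked through it. -/
theorem mul_chi_eq_zero_iff {A : Set M} (hA : MeasurableSet A) (v : F.Mod) :
    F.mul (chi μ A hA) v = 0 ↔ ∀ᵐ x ∂μ, x ∈ A → F.pnorm v x = 0 := by
  rw [← F.pnorm_eq_zero, Lp.eq_zero_iff_ae_eq_zero]
  constructor <;> intro h
  · filter_upwards [h, F.pnorm_mul_chi hA v] with x h1 h2 hx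
    rw [h2, indicator_of_mem hx] at h1
    exact h1
  · filter_upwards [h, F.pnorm_mul_chi hA v] with x h1 h2
    rw [h2]
    by_cases hx : x ∈ A <;> simp [hx, h1]

end Module

end LpFunctional

end NormedModules

/-! ### Restriction to sets: locality, glueing, and the submodule generated by `zeroSet`. -/

namespace NormedModules

section Lebesgue

variable {M : Type*} [MeasurableSpace M] {μ : Measure M} {p : ℝ≥0} [Fact (1 < p)]

theorem tendsto_zero_of_norm_rpow {E : Type*} [NormedAddCommGroup E] {q : ℝ} (hq : 0 < q)
    {u : ℕ → E} (h : Tendsto (fun n => ‖u n‖ ^ q) atTop (𝓝 0)) : Tendsto u atTop (𝓝 0) := by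
  rw [tendsto_zero_iff_norm_tendsto_zero]
  have h2 := ((Real.continuous_rpow_const (inv_nonneg.2 hq.le)).tendsto 0).comp h
  rw [Real.zero_rpow (inv_ne_zero hq.ne')] at h2
  refine h2.congr fun n => ?_
  rw [Function.comp_apply, ← Real.rpow_mul (norm_nonneg _), mul_inv_cancel₀ hq.ne', Real.rpow_one]

theorem tendsto_zero_of_dominated {u : ℕ → Lp ℝ p μ} (w : Lp ℝ p μ)
    (hw : ∀ n, ∀ᵐ x ∂μ, |u n x| ≤ |w x|) (h : ∀ᵐ x ∂μ, Tendsto (fun n => u n x) atTop (𝓝 0)) :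
    Tendsto u atTop (𝓝 0) := by
  have hp0 : 0 < (p : ℝ) := zero_lt_one.trans (one_lt_coe (p := p))
  refine tendsto_zero_of_norm_rpow hp0 ?_
  simp only [norm_rpow_eq]
  have key := tendsto_integral_of_dominated_convergence (μ := μ)
    (F := fun n x => |u n x| ^ (p : ℝ)) (f := fun _ => 0) (fun x => |w x| ^ (p : ℝ))
    (fun n => (integrable_rpow (u n)).aestronglyMeasurable) (integrable_rpow w)
    (fun n => by
      filter_upwards [hw n] with x hx
      rw [Real.norm_of_nonneg (by positivity)]
      exact Real.rpow_le_rpow (abs_nonneg _) hx hp0.le)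
    (by
      filter_upwards [h] with x hx
      have := ((Real.continuous_rpow_const hp0.le).tendsto |(0 : ℝ)|).comp hx.abs
      rwa [abs_zero, Real.zero_rpow hp0.ne'] at this)
  simpa using key

end Lebesgue

namespace LpFunctional

section Submodule

variable {M : Type*} [MeasurableSpace M] {μ : Measure M} {p : ℝ≥0} [Fact (1 < p)]
  {V : Type*} [AddCommGroup V] [Module ℝ V] (F : LpFunctional μ p V)

/-- The remainder is the restriction to the complement of `A n`; its pointwise norm is dominated by
`|v|` and eventually vanishes at almost every point. -/
theorem tendsto_mul_chi {A : ℕ → Set M} (hA : ∀ n, MeasurableSet (A n))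
    (h : ∀ᵐ x ∂μ, ∀ᶠ n in atTop, x ∈ A n) (v : F.Mod) :
    Tendsto (fun n => F.mul (chi μ (A n) (hA n)) v) atTop (𝓝 v) := by
  have e : ∀ n, v - F.mul (chi μ (A n) (hA n)) v = F.mul (chi μ (A n)ᶜ (hA n).compl) v := fun n =>
    sub_eq_iff_eq_add'.2 (F.mul_chi_add_compl (hA n) v).symm
  have hmul := fun n => F.pnorm_mul_chi (hA n).compl v
  have h1 : Tendsto (fun n => F.pnorm (F.mul (chi μ (A n)ᶜ (hA n).compl) v)) atTop (𝓝 0) := by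
    refine tendsto_zero_of_dominated (F.pnorm v) (fun n => ?_) ?_
    · filter_upwards [hmul n] with x hx
      rw [hx]
      by_cases hxA : x ∈ A n <;> simp [hxA]
    · filter_upwards [ae_all_iff.2 hmul, h] with x hx hx'
      refine tendsto_const_nhds.congr' ?_
      filter_upwards [hx'] with n hn
      rw [hx, indicator_of_notMem (by simpa using hn)]
  have h2 : Tendsto (fun n => v - F.mul (chi μ (A n) (hA n)) v) atTop (𝓝 0) := by
    rw [tendsto_zero_iff_norm_tendsto_zero] at h1 ⊢
    refine h1.congr fun n => ?_
    rw [e, norm_pnorm]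
  simpa using (tendsto_const_nhds (x := v)).sub h2

theorem mul_zero_left (v : F.Mod) : F.mul 0 v = 0 := by
  rw [← F.pnorm_eq_zero, Lp.eq_zero_iff_ae_eq_zero]
  filter_upwards [F.pnorm_mul 0 v, Lp.coeFn_zero ℝ ∞ μ] with x h1 h2
  rw [h1, h2]
  simp

theorem add_mul (a b : Lp ℝ ∞ μ) (v : F.Mod) : F.mul (a + b) v = F.mul a v + F.mul b v :=
  (F.mul_add_mul (Lp.coeFn_add a b) v).symm

theorem sum_mul {ι : Type*} (T : Finset ι) (a : ι → Lp ℝ ∞ μ) (v : F.Mod) :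
    F.mul (∑ i ∈ T, a i) v = ∑ i ∈ T, F.mul (a i) v := by
  classical
  induction T using Finset.induction_on with
  | empty => simpa using F.mul_zero_left v
  | insert i T hi ih => rw [Finset.sum_insert hi, Finset.sum_insert hi, add_mul, ih]

theorem chi_nonneg {A : Set M} (hA : MeasurableSet A) : 0 ≤ chi μ A hA := by
  rw [← Lp.coeFn_nonneg]
  filter_upwards [coeFn_chi (μ := μ) A hA] with x hx
  rw [hx]
  exact indicator_nonneg (fun _ _ => zero_le_one) x

theorem mul_chi_mul_eq_self {A B : Set M} (hA : MeasurableSet A) (hB : MeasurableSet B)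
    (h : B ⊆ A) (v : F.Mod) :
    F.mul (chi μ A hA) (F.mul (chi μ B hB) v) = F.mul (chi μ B hB) v := by
  rw [mul_chi_mul_chi]
  simp only [inter_eq_self_of_subset_right h]

theorem mul_chi_comm {A B : Set M} (hA : MeasurableSet A) (hB : MeasurableSet B) (v : F.Mod) :
    F.mul (chi μ A hA) (F.mul (chi μ B hB) v) = F.mul (chi μ B hB) (F.mul (chi μ A hA) v) := by
  rw [mul_chi_mul_chi, mul_chi_mul_chi]
  simp only [inter_comm]

theorem mul_chi_mul_of_disjoint {A B : Set M} (hA : MeasurableSet A) (hB : MeasurableSet B)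
    (h : Disjoint A B) (v : F.Mod) : F.mul (chi μ A hA) (F.mul (chi μ B hB) v) = 0 := by
  rw [mul_chi_mul_chi, mul_chi_eq_zero_iff]
  exact ae_of_all _ fun x hx => absurd hx (by simp [disjoint_iff_inter_eq_empty.1 h])

theorem locality (v : F.Mod) {A : ℕ → Set M} (hA : ∀ n, MeasurableSet (A n))
    (h : ∀ n, F.mul (chi μ (A n) (hA n)) v = 0) :
    F.mul (chi μ (⋃ n, A n) (MeasurableSet.iUnion hA)) v = 0 := by
  simp only [mul_chi_eq_zero_iff] at h ⊢
  filter_upwards [ae_all_iff.2 h] with x hx hxA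
  obtain ⟨n, hn⟩ := mem_iUnion.1 hxA
  exact hx n hn

/-- As `w n` is a restriction of `w m`, one has `|w m - w n| = |w m| - |w n|`. By `norm_superadd`
its norm to the power `p` is at most the increment of the bounded monotone sequence `‖w n‖ ^ p`. -/
theorem cauchySeq_of_mul_chi {w : ℕ → F.Mod} {U : ℕ → Set M} (hU : ∀ n, MeasurableSet (U n))
    (hw : ∀ n m, n ≤ m → F.mul (chi μ (U n) (hU n)) (w m) = w n)
    (hb : BddAbove (range fun n => ‖w n‖)) : CauchySeq w := by
  have hp0 : 0 < (p : ℝ) := zero_lt_one.trans (one_lt_coe (p := p))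
  have hle : ∀ n m, n ≤ m → F.pnorm (w n) ≤ F.pnorm (w m) := fun n m h => by
    rw [← hw n m h, ← Lp.coeFn_le]
    filter_upwards [F.pnorm_mul_chi (hU n) (w m), F.ae_pnorm_nonneg (w m)] with x h1 h2
    rw [h1]
    exact indicator_le_self' (fun _ _ => h2) x
  have hsub : ∀ n m, n ≤ m → F.pnorm (w m - w n) = F.pnorm (w m) - F.pnorm (w n) := fun n m h => by
    have e : w m - w n = F.mul (chi μ (U n)ᶜ (hU n).compl) (w m) := by
      rw [sub_eq_iff_eq_add']
      conv_rhs => rw [← hw n m h]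
      exact (F.mul_chi_add_compl (hU n) (w m)).symm
    refine Lp.ext ?_
    filter_upwards [F.pnorm_mul_chi (hU n) (w m), F.pnorm_mul_chi (hU n).compl (w m),
      Lp.coeFn_sub (F.pnorm (w m)) (F.pnorm (w n))] with x h1 h2 h3
    rw [h3, Pi.sub_apply, e, h2]
    rw [hw n m h] at h1
    rw [h1]
    by_cases hx : x ∈ U n <;> simp [hx]
  have hmono : Monotone fun n => ‖w n‖ := fun n m h => by
    simp only [← F.norm_pnorm]
    exact norm_mono (F.pnorm_nonneg _) (hle n m h)
  have hlim := tendsto_atTop_ciSup hmono hb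
  have hpow : Tendsto (fun n => ‖w n‖ ^ (p : ℝ)) atTop (𝓝 ((⨆ n, ‖w n‖) ^ (p : ℝ))) :=
    ((Real.continuous_rpow_const hp0.le).tendsto _).comp hlim
  have hc : CauchySeq fun n => F.pnorm (w n) := rpow_cauchy fun η hη => by
    obtain ⟨N, hN⟩ := eventually_atTop.1 (hpow.eventually (Metric.ball_mem_nhds _ (half_pos hη)))
    refine ⟨N, fun n k hn hk => ?_⟩
    have a1 := abs_lt.1 (Real.dist_eq _ _ ▸ Metric.mem_ball.1 (hN n hn))
    have a2 := abs_lt.1 (Real.dist_eq _ _ ▸ Metric.mem_ball.1 (hN k (hn.trans hk)))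
    have a3 := norm_superadd (F.pnorm_nonneg (w n)) (hle n k hk)
    rw [norm_pnorm, norm_pnorm] at a3
    rw [norm_sub_rev]
    linarith [a1.1, a2.2]
  rw [Metric.cauchySeq_iff'] at hc ⊢
  intro ε hε
  obtain ⟨N, hN⟩ := hc ε hε
  refine ⟨N, fun n hn => ?_⟩
  have := hN n hn
  rwa [dist_eq_norm, ← hsub N n hn, norm_pnorm, ← dist_eq_norm] at this

theorem mul_chi_sum_of_disjoint {D : ℕ → Set M} (hD : ∀ i, MeasurableSet (D i))
    (hdisj : Pairwise (Function.onFun Disjoint D)) (v : ℕ → F.Mod) {j n : ℕ} (hj : j < n) :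
    F.mul (chi μ (D j) (hD j)) (∑ i ∈ Finset.range n, F.mul (chi μ (D i) (hD i)) (v i)) =
      F.mul (chi μ (D j) (hD j)) (v j) := by
  rw [map_sum, Finset.sum_eq_single j]
  · exact F.mul_chi_mul_eq_self _ _ Subset.rfl _
  · intro i _ hij
    exact F.mul_chi_mul_of_disjoint _ _ (hdisj hij.symm) _
  · intro h
    exact absurd (Finset.mem_range.2 hj) h

theorem mul_chi_iUnion_sum {D : ℕ → Set M} (hD : ∀ i, MeasurableSet (D i))
    (hdisj : Pairwise (Function.onFun Disjoint D)) (v : ℕ → F.Mod) {n m : ℕ} (hnm : n ≤ m) :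
    F.mul (chi μ (⋃ i ∈ Finset.range n, D i) (Finset.measurableSet_biUnion _ fun i _ => hD i))
      (∑ i ∈ Finset.range m, F.mul (chi μ (D i) (hD i)) (v i)) =
    ∑ i ∈ Finset.range n, F.mul (chi μ (D i) (hD i)) (v i) := by
  rw [map_sum, ← Finset.sum_subset (Finset.range_mono hnm)]
  · exact Finset.sum_congr rfl fun i hi => F.mul_chi_mul_eq_self _ _ (subset_biUnion_of_mem hi) _
  · intro i _ hi
    refine F.mul_chi_mul_of_disjoint _ _ ?_ _
    refine disjoint_iUnion₂_left.2 fun j hj => hdisj ?_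
    rintro rfl
    exact hi hj

/-- The sets are made disjoint, `D = disjointed A`, and the glued element is the limit of `∑ χ_{D_i}
v_i`. These sums extend one another, so `cauchySeq_of_mul_chi` applies once they are bounded, and
they are pointwise smaller than the given sums. -/
theorem glueing {N : Submodule ℝ F.Mod} (hN : IsClosed (N : Set F.Mod))
    (hmul : ∀ (a : Lp ℝ ∞ μ), ∀ v ∈ N, F.mul a v ∈ N) (v : ℕ → F.Mod) (hv : ∀ n, v n ∈ N)
    (A : ℕ → Set M) (hA : ∀ n, MeasurableSet (A n))
    (hcomp : ∀ i j, F.mul (chi μ (A i ∩ A j) ((hA i).inter (hA j))) (v i) =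
      F.mul (chi μ (A i ∩ A j) ((hA i).inter (hA j))) (v j))
    (hb : BddAbove (range fun n => ‖∑ i ∈ Finset.range n, F.mul (chi μ (A i) (hA i)) (v i)‖)) :
    ∃ w ∈ N, (∀ i, F.mul (chi μ (A i) (hA i)) w = F.mul (chi μ (A i) (hA i)) (v i)) ∧
      ‖w‖ ≤ liminf (fun n => ‖∑ i ∈ Finset.range n, F.mul (chi μ (A i) (hA i)) (v i)‖) atTop := by
  set S : ℕ → F.Mod := fun n => ∑ i ∈ Finset.range n, F.mul (chi μ (A i) (hA i)) (v i) with hS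
  set D := disjointed A with hDdef
  have hD : ∀ i, MeasurableSet (D i) := fun i => MeasurableSet.disjointed hA i
  have hDA : ∀ i, D i ⊆ A i := fun i => disjointed_subset A i
  have hdisj : Pairwise (Function.onFun Disjoint D) := disjoint_disjointed A
  have hcover : ∀ i, ∀ x ∈ A i, ∃ j, j ≤ i ∧ x ∈ D j := fun i x hx => by
    have h1 : x ∈ partialSups D i := by
      rw [hDdef, partialSups_disjointed]
      exact le_partialSups A i hx
    rw [partialSups_eq_biUnion_range] at h1
    obtain ⟨j, hj, hxj⟩ := mem_iUnion₂.1 h1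
    exact ⟨j, Nat.lt_succ_iff.1 (Finset.mem_range.1 hj), hxj⟩
  set w : ℕ → F.Mod := fun n => ∑ i ∈ Finset.range n, F.mul (chi μ (D i) (hD i)) (v i) with hw
  have hU : ∀ n, MeasurableSet (⋃ i ∈ Finset.range n, D i) := fun n =>
    Finset.measurableSet_biUnion _ fun i _ => hD i
  have hwU : ∀ n m, n ≤ m → F.mul (chi μ _ (hU n)) (w m) = w n := fun n m h =>
    F.mul_chi_iUnion_sum hD hdisj v h
  -- Since `D j ⊆ A j`, the part of `A i` in `D j` lies in `A i ∩ A j`, where `v i` and `v j` agree.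
  have hDv : ∀ i j, F.mul (chi μ (D j) (hD j)) (F.mul (chi μ (A i) (hA i)) (v i)) =
      F.mul (chi μ (D j) (hD j)) (F.mul (chi μ (A i) (hA i)) (v j)) := fun i j => by
    have h1 : ∀ u : F.Mod, F.mul (chi μ (D j) (hD j)) (F.mul (chi μ (A i) (hA i)) u) =
        F.mul (chi μ (D j) (hD j)) (F.mul (chi μ (A i ∩ A j) ((hA i).inter (hA j))) u) :=
        fun u => by
      rw [mul_chi_mul_chi, mul_chi_mul_chi]
      have : D j ∩ A i = D j ∩ (A i ∩ A j) := by
        ext x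
        exact ⟨fun h => ⟨h.1, h.2, hDA j h.1⟩, fun h => ⟨h.1, h.2.1⟩⟩
      simp only [this]
    rw [h1, h1, hcomp]
  -- On `D j` the sum `S n` equals `(∑ χ_{A_i}) v_j`. The coefficient counts the `A i` with `i < n`
  -- that contain the point, and is at least `1` because `j` is among them.
  have hDS : ∀ n, ∀ j < n, F.pnorm (F.mul (chi μ (D j) (hD j)) (w n)) ≤
      F.pnorm (F.mul (chi μ (D j) (hD j)) (S n)) := fun n j hj => by
    have e : F.mul (chi μ (D j) (hD j)) (S n) =
        F.mul (chi μ (D j) (hD j)) (F.mul (∑ i ∈ Finset.range n, chi μ (A i) (hA i)) (v j)) := by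
      rw [sum_mul, hS, map_sum, map_sum]
      exact Finset.sum_congr rfl fun i _ => hDv i j
    have h1 : chi μ (A j) (hA j) ≤ ∑ i ∈ Finset.range n, chi μ (A i) (hA i) :=
      Finset.single_le_sum (f := fun i => chi μ (A i) (hA i)) (fun i _ => chi_nonneg (hA i))
        (Finset.mem_range.2 hj)
    rw [e, hw, F.mul_chi_sum_of_disjoint hD hdisj v hj, ← Lp.coeFn_le]
    rw [← Lp.coeFn_le] at h1
    filter_upwards [F.pnorm_mul_chi (hD j) (v j), F.pnorm_mul_chi (hD j)
      (F.mul (∑ i ∈ Finset.range n, chi μ (A i) (hA i)) (v j)),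
      F.pnorm_mul (∑ i ∈ Finset.range n, chi μ (A i) (hA i)) (v j), h1,
      coeFn_chi (μ := μ) (A j) (hA j), F.ae_pnorm_nonneg (v j)] with x h2 h3 h4 h5 h6 h7
    rw [h2, h3]
    by_cases hx : x ∈ D j
    · rw [indicator_of_mem hx, indicator_of_mem hx, h4]
      rw [h6, indicator_of_mem (hDA j hx)] at h5
      exact le_mul_of_one_le_left h7 (h5.trans (le_abs_self _))
    · rw [indicator_of_notMem hx, indicator_of_notMem hx]
  have hwS : ∀ n, ‖w n‖ ≤ ‖S n‖ := fun n => by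
    rw [← F.norm_pnorm (S n)]
    refine F.norm_le_of_pnorm_le ?_
    rw [← Lp.coeFn_le]
    -- The pieces `D j` with `j < n` carry all of `w n`; off their union `w n` vanishes.
    have h1 : ∀ᵐ x ∂μ, ∀ j < n, x ∈ D j → F.pnorm (w n) x ≤ F.pnorm (S n) x := by
      refine ae_all_iff.2 fun j => ?_
      by_cases hj : j < n
      · have := (Lp.coeFn_le _ _).2 (hDS n j hj)
        filter_upwards [this, F.pnorm_mul_chi (hD j) (w n), F.pnorm_mul_chi (hD j) (S n)]
          with x h1 h2 h3 _ hx
        rwa [h2, h3, indicator_of_mem hx, indicator_of_mem hx] at h1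
      · exact ae_of_all _ fun x h => absurd h hj
    have h2 := F.pnorm_mul_chi (hU n) (w n)
    rw [hwU n n le_rfl] at h2
    filter_upwards [h1, h2, F.ae_pnorm_nonneg (S n)] with x h3 h4 h5
    by_cases hx : x ∈ ⋃ i ∈ Finset.range n, D i
    · obtain ⟨j, hj, hxj⟩ := mem_iUnion₂.1 hx
      exact h3 j (Finset.mem_range.1 hj) hxj
    · rw [h4, indicator_of_notMem hx]
      exact h5
  obtain ⟨C, hC⟩ := hb
  have hwb : BddAbove (range fun n => ‖w n‖) := ⟨C, by
    rintro _ ⟨n, rfl⟩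
    exact (hwS n).trans (hC ⟨n, rfl⟩)⟩
  obtain ⟨W, hW⟩ := cauchySeq_tendsto_of_complete (F.cauchySeq_of_mul_chi hU hwU hwb)
  refine ⟨W, hN.mem_of_tendsto hW (Eventually.of_forall fun n =>
    N.sum_mem fun i _ => hmul _ _ (hv i)), fun i => ?_, ?_⟩
  · refine tendsto_nhds_unique (((F.mul (chi μ (A i) (hA i))).continuous.tendsto W).comp hW)
      (tendsto_const_nhds.congr' ?_)
    -- For `n > i` the restriction of `w n` to `A i` is already final, because the `D j` with `j ≤
    -- i` cover `A i`.
    filter_upwards [eventually_gt_atTop i] with n hn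
    rw [Function.comp_apply, eq_comm, ← sub_eq_zero, ← map_sub, mul_chi_eq_zero_iff]
    have h1 : ∀ j, ∀ᵐ x ∂μ, j < n → x ∈ D j → x ∈ A i → F.pnorm (w n - v i) x = 0 := fun j => by
      by_cases hj : j < n
      · have h2 : F.mul (chi μ (D j ∩ A i) ((hD j).inter (hA i))) (w n - v i) = 0 := by
          rw [← F.mul_chi_mul_chi (hD j) (hA i), map_sub, map_sub, hDv i j, mul_chi_comm, hw,
            F.mul_chi_sum_of_disjoint hD hdisj v hj, mul_chi_comm, sub_self]
        filter_upwards [(F.mul_chi_eq_zero_iff _ _).1 h2] with x hx _ h3 h4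
        exact hx ⟨h3, h4⟩
      · exact ae_of_all _ fun x h => absurd h hj
    filter_upwards [ae_all_iff.2 h1] with x hx hxA
    obtain ⟨j, hj, hxj⟩ := hcover i x hxA
    exact hx j (hj.trans_lt hn) hxj hxA
  · rw [← hW.norm.liminf_eq]
    -- The liminf is taken in `ℝ`, so the comparison needs bounds on both sequences.
    refine liminf_le_liminf (Eventually.of_forall hwS) ?_ ?_
    · exact hW.norm.isBoundedUnder_ge
    · exact IsBoundedUnder.isCoboundedUnder_ge
        ⟨C, eventually_map.2 (Eventually.of_forall fun n => hC ⟨n, rfl⟩)⟩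

theorem exists_ae_eq_mul (a b : Lp ℝ ∞ μ) : ∃ c : Lp ℝ ∞ μ, ∀ᵐ x ∂μ, c x = a x * b x :=
  ⟨((Lp.memLp b).mul (Lp.memLp a) : MemLp (fun x => a x * b x) ∞ μ).toLp _, MemLp.coeFn_toLp _⟩

/-- By associativity the generators `b · ω` are permuted among themselves; linearity and continuity
do the rest. -/
theorem mul_mem_zeroModule (a : Lp ℝ ∞ μ) {v : F.Mod} (hv : v ∈ F.zeroModule) :
    F.mul a v ∈ F.zeroModule := by
  refine map_mem_closure (F.mul a).continuous hv fun u hu => ?_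
  induction hu using Submodule.span_induction with
  | mem x hx =>
    obtain ⟨b, ω, hω, rfl⟩ := hx
    obtain ⟨c, hc⟩ := exists_ae_eq_mul a b
    rw [F.mul_mul hc]
    exact Submodule.subset_span ⟨c, ω, hω, rfl⟩
  | zero => rw [map_zero]; exact Submodule.zero_mem _
  | add x y _ _ hx hy => rw [map_add]; exact Submodule.add_mem _ hx hy
  | smul r x _ hx => rw [map_smul]; exact Submodule.smul_mem _ r hx

theorem zeroSet_subset_zeroModule {ω : F.Mod} (hω : ω ∈ F.zeroSet) : ω ∈ F.zeroModule :=
  Submodule.le_topologicalClosure _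
    (Submodule.subset_span ⟨_, ω, hω, (F.mul_chi_univ ω).symm⟩)

theorem isClosed_zeroModule : IsClosed (F.zeroModule : Set F.Mod) :=
  Submodule.isClosed_topologicalClosure _

theorem isLpNormedSubmodule_zeroModule : F.IsLpNormedSubmodule F.zeroModule where
  isClosed := F.isClosed_zeroModule
  mul_mem a _ hv := F.mul_mem_zeroModule a hv
  locality v _ _ hA h := F.locality v hA h
  glueing v hv A hA hcomp hb :=
    F.glueing F.isClosed_zeroModule (fun a _ hv => F.mul_mem_zeroModule a hv) v hv A hA hcomp hb

/-- A closed set stable under `L^∞`-multiplication and containing `zeroSet` contains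
`zeroModule`. -/
theorem zeroModule_le {N : Submodule ℝ F.Mod} (hN : IsClosed (N : Set F.Mod))
    (hmul : ∀ (a : Lp ℝ ∞ μ), ∀ v ∈ N, F.mul a v ∈ N) (h : F.zeroSet ⊆ N) : F.zeroModule ≤ N := by
  refine Submodule.topologicalClosure_minimal _ (Submodule.span_le.2 ?_) hN
  rintro _ ⟨a, ω, hω, rfl⟩
  exact hmul a ω (h hω)

end Submodule

end LpFunctional

end NormedModules

/-! ### Weak convergence and Mazur's lemma in the module. -/

namespace NormedModules

section Weak

variable {E : Type*} [NormedAddCommGroup E] [NormedSpace ℝ E]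

theorem TendstoWeakly.map {E' : Type*} [NormedAddCommGroup E'] [NormedSpace ℝ E'] {u : ℕ → E}
    {a : E} (h : TendstoWeakly u a) (T : E →L[ℝ] E') : TendstoWeakly (fun n => T (u n)) (T a) :=
  fun φ => h (φ.comp T)

theorem TendstoWeakly.prodMk {E' : Type*} [NormedAddCommGroup E'] [NormedSpace ℝ E'] {u : ℕ → E}
    {a : E} {v : ℕ → E'} {b : E'} (hu : TendstoWeakly u a) (hv : TendstoWeakly v b) :
    TendstoWeakly (fun n => (u n, v n)) (a, b) := by
  have := (hu.map (ContinuousLinearMap.inl ℝ E E')).add (hv.map (ContinuousLinearMap.inr ℝ E E'))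
  simpa using this

/-- A functional that separates `a` strictly from `K` would contradict the convergence of its
values. -/
theorem TendstoWeakly.mem_of_convex {u : ℕ → E} {a : E} (h : TendstoWeakly u a) {K : Set E}
    (hK : Convex ℝ K) (hK' : IsClosed K) (hu : ∀ᶠ n in atTop, u n ∈ K) : a ∈ K := by
  by_contra ha
  obtain ⟨φ, r, h1, h2⟩ := geometric_hahn_banach_closed_point hK hK' ha
  exact absurd (le_of_tendsto (h φ) (hu.mono fun n hn => (h1 _ hn).le)) (not_le.2 h2)

end Weak

namespace LpFunctional

section Relaxation

variable {M : Type*} [MeasurableSpace M] {μ : Measure M} {p : ℝ≥0} [Fact (1 < p)]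
  {V : Type*} [AddCommGroup V] [Module ℝ V] (F : LpFunctional μ p V)

theorem smul_le_smul_Lp {r : ℝ} (hr : 0 ≤ r) {u v : Lp ℝ p μ} (h : u ≤ v) : r • u ≤ r • v := by
  rw [← sub_nonneg, ← smul_sub]
  exact smul_nonneg' hr (sub_nonneg.2 h)

/-- The set of pairs with `|v| ≤ u` is convex and closed in the product, hence weakly sequentially
closed. -/
theorem pnorm_le_of_tendstoWeakly {v : ℕ → F.Mod} {ω : F.Mod} {c : ℕ → Lp ℝ p μ} {a : Lp ℝ p μ}
    (hv : TendstoWeakly v ω) (hc : TendstoWeakly c a) (h : ∀ n, F.pnorm (v n) ≤ c n) :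
    F.pnorm ω ≤ a := by
  refine (hv.prodMk hc).mem_of_convex (K := {q : F.Mod × Lp ℝ p μ | F.pnorm q.1 ≤ q.2}) ?_ ?_
    (Eventually.of_forall h)
  · intro x hx y hy s t hs ht _
    refine (F.pnorm_add_le _ _).trans (add_le_add ?_ ?_)
    · rw [Prod.smul_fst, pnorm_smul, abs_of_nonneg hs]
      exact smul_le_smul_Lp hs hx
    · rw [Prod.smul_fst, pnorm_smul, abs_of_nonneg ht]
      exact smul_le_smul_Lp ht hy
  · exact isClosed_le (F.continuous_pnorm.comp continuous_fst) continuous_snd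

/-- Mazur's lemma for differentials: convex combinations of the tails converge strongly. -/
theorem exists_tendsto_d {f : ℕ → V} {g : M →ₘ[μ] ℝ} {ω : F.Mod} (hf : F.TendstoAE f g)
    (hω : TendstoWeakly (fun n => F.d (f n)) ω) :
    ∃ z : ℕ → V, F.TendstoAE z g ∧ Tendsto (fun n => F.d (z n)) atTop (𝓝 ω) := by
  have h1 : ∀ n : ℕ, ∃ z ∈ convexHull ℝ (f '' Ici n), ‖F.d z - ω‖ < 1 / ((n : ℝ) + 1) := fun n => by
    have h2 : ω ∈ closure (convexHull ℝ (F.d '' (f '' Ici n))) := by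
      refine hω.mem_of_convex (convex_convexHull ℝ _).closure isClosed_closure ?_
      filter_upwards [eventually_ge_atTop n] with k hk
      exact subset_closure (subset_convexHull ℝ _ ⟨f k, ⟨k, hk, rfl⟩, rfl⟩)
    -- The hull is pulled back to `V`: the same convex combinations act on the functions, which
    -- keeps their a.e. convergence.
    rw [← LinearMap.image_convexHull] at h2
    obtain ⟨_, ⟨z, hz, rfl⟩, h⟩ := Metric.mem_closure_iff.1 h2 (1 / ((n : ℝ) + 1)) (by positivity)
    exact ⟨z, hz, by rwa [dist_comm, dist_eq_norm] at h⟩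
  choose z hz hz' using h1
  -- `TendstoAE.convex` is stated for pairs in `V × L^p`; the second component is filled with `0`.
  refine ⟨z, TendstoAE.convex F (w := fun n => (f n, 0)) hf (z := fun n => (z n, 0))
    fun n => ?_, ?_⟩
  · have h2 := mem_image_of_mem (LinearMap.inl ℝ V (Lp ℝ p μ)) (hz n)
    rw [LinearMap.image_convexHull, image_image] at h2
    exact h2
  · rw [tendsto_iff_norm_sub_tendsto_zero]
    exact squeeze_zero (fun n => norm_nonneg _) (fun n => (hz' n).le)
      tendsto_one_div_add_atTop_nhds_zero_nat

theorem TendstoAE.sub_const {f : ℕ → V} {v : V} (h : F.TendstoAE f (F.toL0 v)) :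
    F.TendstoAE (fun n => f n - v) 0 := by
  have := h.add F (F.tendstoAE_const (-v))
  simpa [sub_eq_add_neg] using this

theorem TendstoAE.subseq {f : ℕ → V} {g : M →ₘ[μ] ℝ} (h : F.TendstoAE f g) {φ : ℕ → ℕ}
    (hφ : StrictMono φ) : F.TendstoAE (fun n => f (φ n)) g := by
  filter_upwards [h] with x hx using hx.comp hφ.tendsto_atTop

/-- Places limits of differentials along sequences converging to `v` in the coset of `d v`. -/
theorem sub_mem_zeroSet {f : ℕ → V} {v : V} {ω : F.Mod} (h : F.TendstoAE f (F.toL0 v))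
    (hω : Tendsto (fun n => F.d (f n)) atTop (𝓝 ω)) : ω - F.d v ∈ F.zeroSet :=
  ⟨fun n => f n - v, TendstoL0.of_ae (h.sub_const F), by
    simpa only [map_sub] using hω.sub_const (F.d v)⟩

theorem WeaklyReflexive.exists_tendstoWeakly (hF : F.WeaklyReflexive) {f : ℕ → V} {g : M →ₘ[μ] ℝ}
    (hf : F.TendstoAE f g) {C : ℝ} (hC : ∀ n, ‖F.val (f n)‖ ≤ C) :
    ∃ (φ : ℕ → ℕ) (ω : F.Mod), StrictMono φ ∧ TendstoWeakly (fun n => F.d (f (φ n))) ω :=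
  hF f g (TendstoL0.of_ae hf) ⟨C, by
    rintro _ ⟨n, rfl⟩
    exact (F.norm_d _).trans_le (hC n)⟩

theorem tendsto_mulApprox_apply (a : Lp ℝ ∞ μ) (v : F.Mod) :
    Tendsto (fun n => F.mulApprox a n v) atTop (𝓝 (F.mul a v)) :=
  ((ContinuousLinearMap.apply ℝ F.Mod v).continuous.tendsto _).comp (F.tendsto_mulApprox a)

/-- Every pre-form is a differential on each of its pieces; this is what reduces statements about
the module to statements about `d v`. -/
theorem mul_chi_coe_preimage (s : F.Pfm) (v : V) :
    F.mul (chi μ _ (s.isPiecewiseConst.2 v)) (s : F.Mod) =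
      F.mul (chi μ _ (s.isPiecewiseConst.2 v)) (F.d v) := by
  change _ = F.mul _ ((F.mkPfm (fun _ => v) (IsPiecewiseConst.const v) (Lp.memLp (F.val v)) :
    F.Pfm) : F.Mod)
  rw [mul_chi_coe, mul_chi_coe]
  congr 1
  refine Subtype.ext (funext fun x => ?_)
  change (s.fn ⁻¹' {v}).indicator (fun _ => (1 : ℝ)) x • s.fn x =
    (s.fn ⁻¹' {v}).indicator (fun _ => (1 : ℝ)) x • v
  by_cases hx : x ∈ s.fn ⁻¹' {v}
  · rw [show s.fn x = v from hx]
  · rw [indicator_of_notMem hx, zero_smul, zero_smul]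

theorem exists_indicator_Lp {A : Set M} (hA : MeasurableSet A) (H : Lp ℝ p μ) :
    ∃ H' : Lp ℝ p μ, H' =ᵐ[μ] A.indicator H :=
  ⟨((Lp.memLp H).indicator hA).toLp _, MemLp.coeFn_toLp _⟩

/-! ### The canonical map to the module of the relaxed functional, and its pointwise norm. -/

variable [SigmaFinite μ]

theorem relaxed_val_le {f : ℕ → V} {g : F.relaxedDomain} {G : Lp ℝ p μ} (hf : F.TendstoAE f g)
    (hG : TendstoWeakly (fun n => F.val (f n)) G) : F.relaxed.val g ≤ G :=
  F.mem_lowerSet_iff.1 (F.isGreatest_lowerRelaxation g).1 f G hf hG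

/-- The constant sequence is a competitor. -/
theorem relaxed_val_toRelaxed_le (f : V) : F.relaxed.val (F.toRelaxed f) ≤ F.val f :=
  F.relaxed_val_le (f := fun _ => f) (F.tendstoAE_const f) tendsto_const_nhds.tendstoWeakly

theorem ae_eval_toRelaxed_le {s : M → V} (hs : IsPiecewiseConst s) :
    ∀ᵐ x ∂μ, F.relaxed.eval (fun x => F.toRelaxed (s x)) x ≤ F.eval s x :=
  ae_eval hs (P := fun v x => F.relaxed.val (F.toRelaxed v) x ≤ F.val v x) fun v =>
    (Lp.coeFn_le _ _).2 (F.relaxed_val_toRelaxed_le v)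

theorem isPiecewiseConst_toRelaxed {s : M → V} (hs : IsPiecewiseConst s) :
    IsPiecewiseConst fun x => F.toRelaxed (s x) :=
  hs.map₂ (fun v _ => F.toRelaxed v) hs

/-- The family `(f_i, A_i)` read as a pre-form of the relaxed functional. -/
noncomputable def relaxPfmFun (s : F.Pfm) : F.relaxed.Pfm :=
  F.relaxed.mkPfm (fun x => F.toRelaxed (s.fn x)) (F.isPiecewiseConst_toRelaxed s.isPiecewiseConst)
    (s.memLp.mono (F.relaxed.measurable_eval
      (F.isPiecewiseConst_toRelaxed s.isPiecewiseConst)).aestronglyMeasurable (by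
      filter_upwards [F.ae_eval_toRelaxed_le s.isPiecewiseConst,
        F.relaxed.ae_eval_nonneg (F.isPiecewiseConst_toRelaxed s.isPiecewiseConst)] with x h1 h2
      rw [Real.norm_of_nonneg h2]
      exact h1.trans (le_abs_self _)))

theorem pnorm_relaxPfmFun_le (s : F.Pfm) : (F.relaxPfmFun s).pnorm ≤ s.pnorm := by
  rw [← Lp.coeFn_le]
  filter_upwards [(F.relaxPfmFun s).coeFn_pnorm, s.coeFn_pnorm,
    F.ae_eval_toRelaxed_le s.isPiecewiseConst] with x h1 h2 h3
  rw [h1, h2]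
  exact h3

/-- `relaxPfmFun` as a continuous linear map. -/
noncomputable def relaxPfm : F.Pfm →L[ℝ] F.relaxed.Pfm :=
  LinearMap.mkContinuous
    { toFun := F.relaxPfmFun
      map_add' := fun s t => Subtype.ext (funext fun x => map_add F.toRelaxed (s.fn x) (t.fn x))
      map_smul' := fun r s => Subtype.ext (funext fun x => map_smul F.toRelaxed r (s.fn x)) }
    1 (fun s => by
      rw [one_mul]
      exact norm_mono (Pfm.pnorm_nonneg _) (F.pnorm_relaxPfmFun_le s))

/-- The canonical map, from the module generated by `F` to the module generated by its
relaxation, that sends `d f` to `d f`. -/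
noncomputable def relaxMap : F.Mod →L[ℝ] F.relaxed.Mod := F.relaxPfm.completion

theorem relaxMap_coe (s : F.Pfm) : F.relaxMap (s : F.Mod) = (F.relaxPfmFun s : F.relaxed.Pfm) :=
  ContinuousLinearMap.completion_apply_coe _ _

theorem relaxMap_d (f : V) : F.relaxMap (F.d f) = F.relaxed.d (F.toRelaxed f) :=
  F.relaxMap_coe _

theorem relaxMap_mul (a : Lp ℝ ∞ μ) (v : F.Mod) :
    F.relaxMap (F.mul a v) = F.relaxed.mul a (F.relaxMap v) := by
  have h : ∀ n, F.relaxMap.comp (F.mulApprox a n) = (F.relaxed.mulApprox a n).comp F.relaxMap :=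
    fun n => by
      refine F.ext_coe fun s => ?_
      rw [ContinuousLinearMap.comp_apply, ContinuousLinearMap.comp_apply, mulApprox_eq,
        mulApprox_eq, pcMul_coe, relaxMap_coe, relaxMap_coe, pcMul_coe]
      congr 1
      exact Subtype.ext (funext fun x => map_smul F.toRelaxed (quant n a x) (s.fn x))
  have h1 := (F.relaxMap.continuous.tendsto _).comp (F.tendsto_mulApprox_apply a v)
  have h2 := F.relaxed.tendsto_mulApprox_apply a (F.relaxMap v)
  exact tendsto_nhds_unique h1 (h2.congr fun n => (DFunLike.congr_fun (h n) v).symm)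

theorem pnorm_relaxMap_le (v : F.Mod) : F.relaxed.pnorm (F.relaxMap v) ≤ F.pnorm v := by
  induction v using UniformSpace.Completion.induction_on with
  | hp =>
    exact isClosed_le (F.relaxed.continuous_pnorm.comp F.relaxMap.continuous) F.continuous_pnorm
  | ih s =>
    rw [relaxMap_coe, pnorm_coe, pnorm_coe]
    exact F.pnorm_relaxPfmFun_le s

/-- Closedness of the relaxed differential, and the source of both the inclusion of `zeroModule` in
the kernel and the surjectivity. -/
theorem relaxMap_eq_of_tendsto {f : ℕ → V} {g : F.relaxedDomain} {ω : F.Mod}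
    (hf : F.TendstoAE f g) (hω : Tendsto (fun n => F.d (f n)) atTop (𝓝 ω)) :
    F.relaxMap ω = F.relaxed.d g := by
  refine tendsto_nhds_unique ((F.relaxMap.continuous.tendsto ω).comp hω) ?_
  -- Competitor for `f n - g`: the sequence `f n - f m` in `m`. Its values are `|d (f n) - d (f
  -- m)|`, which converge strongly to `|d (f n) - ω|`.
  have key : ∀ n, F.relaxed.val (F.toRelaxed (f n) - g) ≤ F.pnorm (F.d (f n) - ω) := fun n => by
    refine F.relaxed_val_le (f := fun m => f n - f m) ?_ ?_
    · have := (F.tendstoAE_const (f n)).add F (hf.const_smul F (-1))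
      simp only [neg_smul, one_smul, ← sub_eq_add_neg] at this
      exact this
    · have h := (F.continuous_pnorm.tendsto _).comp ((tendsto_const_nhds (x := F.d (f n))).sub hω)
      refine (h.congr fun m => ?_).tendstoWeakly
      rw [Function.comp_apply, ← map_sub, pnorm_d]
  rw [tendsto_iff_norm_sub_tendsto_zero] at hω ⊢
  refine squeeze_zero (fun n => norm_nonneg _) (fun n => ?_) hω
  rw [Function.comp_apply, relaxMap_d, ← map_sub, norm_d, ← F.norm_pnorm (F.d (f n) - ω)]
  exact norm_mono (F.relaxed.nonneg' _) (key n)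

/-- The kernel is closed and stable under `L^∞`, so it suffices to treat `zeroSet`, which is the
case `g = 0` of `relaxMap_eq_of_tendsto`. -/
theorem zeroModule_le_ker_relaxMap : F.zeroModule ≤ LinearMap.ker F.relaxMap.toLinearMap := by
  refine F.zeroModule_le F.relaxMap.isClosed_ker (fun a v hv => ?_) ?_
  · change F.relaxMap v = 0 at hv
    change F.relaxMap (F.mul a v) = 0
    rw [relaxMap_mul, hv, map_zero]
  · rintro ω ⟨f, hf, hω⟩
    obtain ⟨φ, hφ, h⟩ := hf.exists_subseq_ae
    have := F.relaxMap_eq_of_tendsto (f := fun n => f (φ n)) (g := 0) h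
      (hω.comp hφ.tendsto_atTop)
    rw [map_zero] at this
    exact this

theorem relaxMap_add_zeroModule (v : F.Mod) {w : F.Mod} (hw : w ∈ F.zeroModule) :
    F.relaxMap (v + w) = F.relaxMap v := by
  have : F.relaxMap w = 0 := F.zeroModule_le_ker_relaxMap hw
  rw [map_add, this, add_zero]

/-- Weak reflexivity enters here. Each competitor `h n → f` with values `⇀ G` yields an `ω` in the
coset of `d f` with `|ω| ≤ G`, so `H ≤ G`; thus `H` belongs to `lowerSet`. -/
theorem le_relaxed_val (hF : F.WeaklyReflexive) (f : V) {H : Lp ℝ p μ}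
    (hH : ∀ w ∈ F.zeroModule, H ≤ F.pnorm (F.d f + w)) : H ≤ F.relaxed.val (F.toRelaxed f) := by
  refine (F.isGreatest_lowerRelaxation (F.toRelaxed f)).2 (F.mem_lowerSet_iff.2 fun h G hh hG => ?_)
  obtain ⟨C, hC⟩ := hG.bounded
  obtain ⟨φ, ω, hφ, hω⟩ := hF.exists_tendstoWeakly F hh hC
  obtain ⟨z, hz, hzω⟩ := F.exists_tendsto_d (hh.subseq F hφ) hω
  -- The hypothesis is used with `w = ω - d f`.
  have h1 := hH _ (F.zeroSet_subset_zeroModule (F.sub_mem_zeroSet hz hzω))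
  rw [add_sub_cancel] at h1
  exact h1.trans (F.pnorm_le_of_tendstoWeakly hω (hG.subseq hφ) fun n => (F.pnorm_d _).le)

/-- On the piece `{s = v}` the elements `s + w` and `d v + w` agree, so the bound can be tested
piece by piece with `le_relaxed_val`. -/
theorem le_pnorm_relaxMap_coe (hF : F.WeaklyReflexive) (s : F.Pfm) {H : Lp ℝ p μ}
    (hH : ∀ w ∈ F.zeroModule, H ≤ F.pnorm ((s : F.Mod) + w)) :
    H ≤ F.relaxed.pnorm (F.relaxMap (s : F.Mod)) := by
  have key : ∀ v : V, ∀ᵐ x ∂μ, s.fn x = v → H x ≤ F.relaxed.val (F.toRelaxed v) x := fun v => by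
    set A := s.fn ⁻¹' {v} with hAdef
    have hA : MeasurableSet A := s.isPiecewiseConst.2 v
    -- Cutting `H` to zero off `A` keeps it a lower bound of `|d v + w|` there, as pointwise norms
    -- are nonnegative.
    obtain ⟨H', hH'⟩ := exists_indicator_Lp hA H
    have h1 : H' ≤ F.relaxed.val (F.toRelaxed v) := by
      refine F.le_relaxed_val hF v fun w hw => ?_
      have h2 : F.mul (chi μ A hA) (F.d v + w) = F.mul (chi μ A hA) ((s : F.Mod) + w) := by
        rw [map_add, map_add, ← F.mul_chi_coe_preimage s v]
      have h3 := F.pnorm_mul_chi hA (F.d v + w)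
      rw [h2] at h3
      rw [← Lp.coeFn_le]
      filter_upwards [hH', h3, F.pnorm_mul_chi hA ((s : F.Mod) + w), (Lp.coeFn_le _ _).2 (hH w hw),
        F.ae_pnorm_nonneg (F.d v + w)] with x h4 h5 h6 h7 h8
      rw [h4]
      by_cases hx : x ∈ A
      · rw [h6, indicator_of_mem hx, indicator_of_mem hx] at h5
        rw [indicator_of_mem hx, ← h5]
        exact h7
      · rw [indicator_of_notMem hx]
        exact h8
    filter_upwards [hH', (Lp.coeFn_le _ _).2 h1] with x h2 h3 hx
    rw [h2, indicator_of_mem (show x ∈ A from hx)] at h3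
    exact h3
  rw [relaxMap_coe, pnorm_coe, ← Lp.coeFn_le]
  filter_upwards [ae_eval s.isPiecewiseConst key, (F.relaxPfmFun s).coeFn_pnorm] with x h1 h2
  rw [h2]
  exact h1 rfl

/-- It is a lower bound because `relaxMap` contracts pointwise norms and is constant on cosets. It
is the greatest one on pre-forms by `le_pnorm_relaxMap_coe`, and in general by density. -/
theorem isGLB_pnorm_relaxMap (hF : F.WeaklyReflexive) (v : F.Mod) :
    IsGLB (range fun w : F.zeroModule => F.pnorm (v + w)) (F.relaxed.pnorm (F.relaxMap v)) := by
  constructor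
  · rintro _ ⟨w, rfl⟩
    change _ ≤ F.pnorm (v + w)
    rw [← F.relaxMap_add_zeroModule v w.2]
    exact F.pnorm_relaxMap_le _
  · intro H hH
    obtain ⟨s, hs⟩ := F.exists_seq_pfm v
    -- Replacing `v` by `s n` lowers the bound by at most `|v - s n|`, uniformly in `w`.
    have h1 : ∀ n, H ≤ F.relaxed.pnorm (F.relaxMap (s n : F.Mod)) + F.pnorm (v - s n) := fun n => by
      rw [← sub_le_iff_le_add]
      refine F.le_pnorm_relaxMap_coe hF (s n) fun w hw => ?_
      rw [sub_le_iff_le_add]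
      refine (hH ⟨⟨w, hw⟩, rfl⟩).trans ?_
      have := F.pnorm_le_add_sub (v + w) (s n + w)
      rwa [add_sub_add_right_eq_sub] at this
    have h2 : Tendsto (fun n => F.relaxed.pnorm (F.relaxMap (s n : F.Mod)) + F.pnorm (v - s n))
        atTop (𝓝 (F.relaxed.pnorm (F.relaxMap v) + F.pnorm (v - v))) :=
      (((F.relaxed.continuous_pnorm.comp F.relaxMap.continuous).tendsto v).comp hs).add
        ((F.continuous_pnorm.tendsto _).comp (tendsto_const_nhds.sub hs))
    rw [sub_self, pnorm_zero, add_zero] at h2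
    exact ge_of_tendsto' h2 h1

end Relaxation

end LpFunctional

end NormedModules

/-! ### The quotient norm, surjectivity, and closability. -/

namespace NormedModules

namespace LpFunctional

section Quotient

variable {M : Type*} [MeasurableSpace M] {μ : Measure M} {p : ℝ≥0} [Fact (1 < p)]
  {V : Type*} [AddCommGroup V] [Module ℝ V] (F : LpFunctional μ p V)

theorem coeFn_pnorm_eq_of_mul_chi_eq {A : Set M} (hA : MeasurableSet A) {v w : F.Mod}
    (h : F.mul (chi μ A hA) v = F.mul (chi μ A hA) w) :
    ∀ᵐ x ∂μ, x ∈ A → F.pnorm v x = F.pnorm w x := by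
  have h1 := F.pnorm_mul_chi hA v
  rw [h] at h1
  filter_upwards [h1, F.pnorm_mul_chi hA w] with x h2 h3 hx
  rw [h3, indicator_of_mem hx, indicator_of_mem hx] at h2
  exact h2.symm

/-- Take `v` where `|v| < |w|` and `w` elsewhere. Made by `L^∞`-multiplications, this element stays
in any coset of a stable submodule that contains both `v` and `w`. -/
theorem exists_pnorm_eq_inf (v w : F.Mod) : ∃ (A : Set M) (hA : MeasurableSet A),
    F.pnorm (F.mul (chi μ A hA) v + F.mul (chi μ Aᶜ hA.compl) w) = F.pnorm v ⊓ F.pnorm w := by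
  have hA : MeasurableSet {x | F.pnorm v x < F.pnorm w x} :=
    measurableSet_lt (Lp.stronglyMeasurable _).measurable (Lp.stronglyMeasurable _).measurable
  refine ⟨_, hA, Lp.ext ?_⟩
  set A := {x | F.pnorm v x < F.pnorm w x}
  have h1 : F.mul (chi μ A hA) (F.mul (chi μ A hA) v + F.mul (chi μ Aᶜ hA.compl) w) =
      F.mul (chi μ A hA) v := by
    rw [map_add, F.mul_chi_mul_eq_self _ _ Subset.rfl,
      F.mul_chi_mul_of_disjoint _ _ disjoint_compl_right, add_zero]
  have h2 : F.mul (chi μ Aᶜ hA.compl) (F.mul (chi μ A hA) v + F.mul (chi μ Aᶜ hA.compl) w) =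
      F.mul (chi μ Aᶜ hA.compl) w := by
    rw [map_add, F.mul_chi_mul_eq_self _ _ Subset.rfl,
      F.mul_chi_mul_of_disjoint _ _ disjoint_compl_left, zero_add]
  filter_upwards [F.coeFn_pnorm_eq_of_mul_chi_eq _ h1, F.coeFn_pnorm_eq_of_mul_chi_eq _ h2,
    Lp.coeFn_inf (F.pnorm v) (F.pnorm w)] with x h3 h4 h5
  rw [h5, Pi.inf_apply]
  by_cases hx : x ∈ A
  · rw [h3 hx]
    exact (inf_eq_left.2 (le_of_lt hx)).symm
  · rw [h4 hx]
    exact (inf_eq_right.2 (not_lt.1 hx)).symm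

/-- The infimum of the pointwise norms of a coset of a submodule is the limit of a minimizing
sequence, and its norm is the quotient norm. -/
theorem exists_tendsto_pnorm_coset {N : Submodule ℝ F.Mod}
    (hN : ∀ (a : Lp ℝ ∞ μ), ∀ v ∈ N, F.mul a v ∈ N) (v : F.Mod) :
    ∃ U : Lp ℝ p μ, 0 ≤ U ∧ ‖U‖ = ‖(Submodule.Quotient.mk v : F.Mod ⧸ N)‖ ∧
      ∀ w ∈ N, U ≤ F.pnorm (v + w) := by
  have hp0 : 0 < (p : ℝ) := zero_lt_one.trans (one_lt_coe (p := p))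
  set m := ‖(Submodule.Quotient.mk v : F.Mod ⧸ N)‖ with hm
  have hle : ∀ z, z - v ∈ N → m ≤ ‖z‖ := fun z hz => by
    rw [hm, ← (Submodule.Quotient.eq N).2 hz]
    exact Submodule.Quotient.norm_mk_le N z
  -- Almost minimal representatives of the coset. These sets are convex and decreasing, so uniform
  -- convexity of `L^p` provides representatives whose pointwise norms converge strongly.
  let A : ℕ → Set F.Mod := fun n => {z | ‖z‖ ≤ m + 1 / ((n : ℝ) + 1) ∧ z - v ∈ N}
  have hA : Antitone A := fun a b hab z hz => by
    refine ⟨hz.1.trans ?_, hz.2⟩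
    gcongr
  have hconv : ∀ n, Convex ℝ (A n) := fun n => by
    intro x hx y hy a b ha hb hab
    refine ⟨?_, ?_⟩
    · have := convex_closedBall (0 : F.Mod) (m + 1 / ((n : ℝ) + 1))
        (mem_closedBall_zero_iff.2 hx.1) (mem_closedBall_zero_iff.2 hy.1) ha hb hab
      exact mem_closedBall_zero_iff.1 this
    · have : a • x + b • y - v = a • (x - v) + b • (y - v) := by
        have hv : v = a • v + b • v := by rw [← add_smul, hab, one_smul]
        conv_lhs => rw [hv]
        rw [smul_sub, smul_sub]
        abel
      rw [this]
      exact N.add_mem (N.smul_mem a hx.2) (N.smul_mem b hy.2)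
  have hne : ∀ n, ∃ z ∈ A n, ‖F.pnorm z‖ ≤ m + 1 := fun n => by
    have hpos : (0 : ℝ) < 1 / ((n : ℝ) + 1) := by positivity
    obtain ⟨z, hz, hz'⟩ := Submodule.Quotient.norm_mk_lt (Submodule.Quotient.mk v : F.Mod ⧸ N) hpos
    refine ⟨z, ⟨hz'.le, (Submodule.Quotient.eq N).1 hz⟩, ?_⟩
    rw [norm_pnorm]
    refine hz'.le.trans (add_le_add le_rfl ?_)
    rw [div_le_one (by positivity)]
    linarith [Nat.cast_nonneg (α := ℝ) n]
  obtain ⟨z, hz, U, hU⟩ := exists_tendsto_of_midpoint F.pnorm F.pnorm_nonneg (fun v w => by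
    rw [pnorm_smul, abs_of_pos (by norm_num : (0 : ℝ) < 1 / 2)]
    exact smul_le_smul_Lp (by norm_num) (F.pnorm_add_le v w)) A hA hconv (m + 1) hne
  have hUm : ‖U‖ = m := by
    refine tendsto_nhds_unique hU.norm ?_
    simp only [norm_pnorm]
    refine tendsto_of_tendsto_of_tendsto_of_le_of_le tendsto_const_nhds ?_
      (fun n => hle _ (hz n).2) (fun n => (hz n).1)
    simpa using tendsto_const_nhds.add (tendsto_one_div_add_atTop_nhds_zero_nat (𝕜 := ℝ))
  have hU0 : 0 ≤ U := ge_of_tendsto' hU fun n => F.pnorm_nonneg _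
  refine ⟨U, hU0, hUm, fun w hw => ?_⟩
  -- The minimum of the two pointwise norms is the pointwise norm of a representative, so its norm
  -- is at least the quotient norm.
  have h1 : ∀ n, m ≤ ‖F.pnorm (z n) ⊓ F.pnorm (v + w)‖ := fun n => by
    obtain ⟨B, hB, h⟩ := F.exists_pnorm_eq_inf (z n) (v + w)
    rw [← h, norm_pnorm]
    refine hle _ ?_
    have e : F.mul (chi μ B hB) (z n) + F.mul (chi μ Bᶜ hB.compl) (v + w) - v =
        F.mul (chi μ B hB) (z n - v) + F.mul (chi μ Bᶜ hB.compl) w := by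
      rw [map_sub, map_add]
      calc _ = F.mul (chi μ B hB) (z n) + (F.mul (chi μ Bᶜ hB.compl) v +
            F.mul (chi μ Bᶜ hB.compl) w) -
            (F.mul (chi μ B hB) v + F.mul (chi μ Bᶜ hB.compl) v) := by rw [mul_chi_add_compl]
        _ = _ := by abel
    rw [e]
    exact N.add_mem (hN _ _ (hz n).2) (hN _ _ hw)
  have h2 : m ≤ ‖U ⊓ F.pnorm (v + w)‖ :=
    ge_of_tendsto' (hU.inf_nhds tendsto_const_nhds).norm h1
  -- `U ⊓ |v + w|` lies below `U` without having smaller norm, hence equals `U`.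
  have h3 := norm_superadd (le_inf hU0 (F.pnorm_nonneg (v + w)))
    (inf_le_left : U ⊓ F.pnorm (v + w) ≤ U)
  have h4 : ‖U‖ ^ (p : ℝ) ≤ ‖U ⊓ F.pnorm (v + w)‖ ^ (p : ℝ) := by
    rw [hUm]
    exact Real.rpow_le_rpow (norm_nonneg _) h2 hp0.le
  have h5 : ‖U - U ⊓ F.pnorm (v + w)‖ ^ (p : ℝ) ≤ 0 := by linarith
  have h6 : ‖U - U ⊓ F.pnorm (v + w)‖ = 0 := by
    by_contra hne
    exact absurd h5 (not_le.2 (Real.rpow_pos_of_pos ((norm_nonneg _).lt_of_ne' hne) _))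
  rw [norm_eq_zero, sub_eq_zero] at h6
  exact inf_eq_left.1 h6.symm

/-- The pieces of `s` are countably many; restrictions to finite unions of them lie in `N` and
converge to `s`. -/
theorem coe_mem_of_forall_mul_chi_mem {N : Submodule ℝ F.Mod} (hN : IsClosed (N : Set F.Mod))
    (hmul : ∀ (a : Lp ℝ ∞ μ), ∀ v ∈ N, F.mul a v ∈ N) (s : F.Pfm)
    (h : ∀ v, F.mul (chi μ _ (s.isPiecewiseConst.2 v)) (s : F.Mod) ∈ N) : (s : F.Mod) ∈ N := by
  -- Inserting `0` makes the set of values nonempty even when `M` is empty, so that it can be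
  -- enumerated.
  obtain ⟨e, he⟩ := (s.isPiecewiseConst.1.insert 0).exists_eq_range (insert_nonempty _ _)
  let B : ℕ → Set M := fun n => ⋃ i ∈ Finset.range n, s.fn ⁻¹' {e i}
  have hB : ∀ n, MeasurableSet (B n) := fun n =>
    Finset.measurableSet_biUnion _ fun i _ => s.isPiecewiseConst.2 (e i)
  have hmem : ∀ n, F.mul (chi μ (B n) (hB n)) (s : F.Mod) ∈ N := fun n => by
    induction n with
    | zero =>
      have : F.mul (chi μ (B 0) (hB 0)) (s : F.Mod) = 0 :=
        (F.mul_chi_eq_zero_iff _ _).2 (ae_of_all _ fun x hx => by simp [B] at hx)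
      rw [this]
      exact N.zero_mem
    | succ n ih =>
      have hC := s.isPiecewiseConst.2 (e n)
      -- The enumeration may repeat values, so only the part of the new piece outside `B n` is
      -- added.
      have e1 : B (n + 1) = B n ∪ ((B n)ᶜ ∩ s.fn ⁻¹' {e n}) := by
        have : B (n + 1) = s.fn ⁻¹' {e n} ∪ B n := by
          simp only [B, Finset.range_add_one, Finset.set_biUnion_insert]
        rw [this, union_comm, ← sdiff_eq_compl_inter, union_sdiff_self]
      have e2 := F.mul_chi_add_of_disjoint (hB n) ((hB n).compl.inter hC)
        (disjoint_compl_right.mono_right inter_subset_left) (s : F.Mod)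
      rw [← F.mul_chi_mul_chi (hB n).compl hC] at e2
      simp only [e1]
      rw [← e2]
      exact N.add_mem ih (hmul _ _ (h _))
  refine hN.mem_of_tendsto (F.tendsto_mul_chi hB (ae_of_all _ fun x => ?_) (s : F.Mod))
    (Eventually.of_forall hmem)
  obtain ⟨i, hi⟩ : s.fn x ∈ range e := he ▸ mem_insert_of_mem _ (mem_range_self x)
  filter_upwards [eventually_gt_atTop i] with n hn
  exact mem_iUnion₂.2 ⟨i, Finset.mem_range.2 hn, hi.symm⟩

theorem eq_top_of_d_mem {N : Submodule ℝ F.Mod} (hN : IsClosed (N : Set F.Mod))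
    (hmul : ∀ (a : Lp ℝ ∞ μ), ∀ v ∈ N, F.mul a v ∈ N) (h : ∀ v, F.d v ∈ N) : N = ⊤ := by
  refine eq_top_iff.2 fun v _ => ?_
  obtain ⟨s, hs⟩ := F.exists_seq_pfm v
  refine hN.mem_of_tendsto hs (Eventually.of_forall fun n => ?_)
  refine F.coe_mem_of_forall_mul_chi_mem hN hmul (s n) fun v => ?_
  rw [mul_chi_coe_preimage]
  exact hmul _ _ (h v)

variable [SigmaFinite μ]

/-- For `≤`, the contraction is applied to almost minimal representatives. For `≥`, the function `U`
of `exists_tendsto_pnorm_coset` is a lower bound of the pointwise norms of the coset, hence below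
`|relaxMap v|`, and its norm is the quotient norm. -/
theorem norm_relaxMap (hF : F.WeaklyReflexive) (v : F.Mod) :
    ‖F.relaxMap v‖ = ‖(Submodule.Quotient.mk v : F.Mod ⧸ F.zeroModule)‖ := by
  refine le_antisymm (le_of_forall_pos_le_add fun ε hε => ?_) ?_
  · obtain ⟨z, hz, hz'⟩ := Submodule.Quotient.norm_mk_lt
      (Submodule.Quotient.mk v : F.Mod ⧸ F.zeroModule) hε
    have h1 := (Submodule.Quotient.eq F.zeroModule).1 hz
    have h2 : F.relaxMap v = F.relaxMap z := by
      rw [← F.relaxMap_add_zeroModule v h1, add_sub_cancel]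
    rw [h2, ← F.norm_pnorm z] at *
    exact (F.relaxed.norm_le_of_pnorm_le (F.pnorm_relaxMap_le z)).trans hz'.le
  · obtain ⟨U, hU0, hU, hle⟩ := F.exists_tendsto_pnorm_coset
      (fun a _ hv => F.mul_mem_zeroModule a hv) v
    rw [← hU, ← F.relaxed.norm_pnorm]
    refine norm_mono hU0 ((F.isGLB_pnorm_relaxMap hF v).2 ?_)
    rintro _ ⟨w, rfl⟩
    exact hle w w.2

/-- The isometry from the quotient by `zeroModule` into the module generated by the relaxation. -/
noncomputable def quotientRelaxMap (hF : F.WeaklyReflexive) :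
    (F.Mod ⧸ F.zeroModule) →ₗᵢ[ℝ] F.relaxed.Mod where
  toLinearMap := F.zeroModule.liftQ F.relaxMap.toLinearMap F.zeroModule_le_ker_relaxMap
  norm_map' x := by
    obtain ⟨v, rfl⟩ := Submodule.Quotient.mk_surjective _ x
    exact F.norm_relaxMap hF v

theorem exists_tendsto_d_of_mem_relaxedDomain (hF : F.WeaklyReflexive) (g : F.relaxedDomain) :
    ∃ (ω : F.Mod) (f : ℕ → V), F.TendstoAE f g ∧ Tendsto (fun n => F.d (f n)) atTop (𝓝 ω) := by
  obtain ⟨f, C, hf, hC⟩ := F.relaxedEnergy_lt_top_iff.1 g.2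
  obtain ⟨φ, ω, hφ, hω⟩ := hF.exists_tendstoWeakly F hf hC
  obtain ⟨z, hz, hzω⟩ := F.exists_tendsto_d (hf.subseq F hφ) hω
  exact ⟨ω, z, hz, hzω⟩

/-- The range is the isometric image of a complete quotient, hence closed. It is stable under `L^∞`
and contains all differentials, which generate the target. -/
theorem relaxMap_surjective (hF : F.WeaklyReflexive) : Function.Surjective F.relaxMap := by
  have hc : IsClosed (LinearMap.range F.relaxMap.toLinearMap : Set F.relaxed.Mod) := by
    have h1 : (LinearMap.range F.relaxMap.toLinearMap : Set F.relaxed.Mod) =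
        range (F.quotientRelaxMap hF) := by
      ext y
      constructor
      · rintro ⟨v, rfl⟩
        exact ⟨Submodule.Quotient.mk v, rfl⟩
      · rintro ⟨x, rfl⟩
        obtain ⟨v, rfl⟩ := Submodule.Quotient.mk_surjective _ x
        exact ⟨v, rfl⟩
    rw [h1]
    exact ((F.quotientRelaxMap hF).isometry.isUniformInducing.isComplete_range).isClosed
  have htop := F.relaxed.eq_top_of_d_mem hc (fun a v hv => ?_) fun g => ?_
  · exact LinearMap.range_eq_top.1 htop
  · obtain ⟨u, rfl⟩ := hv
    exact ⟨F.mul a u, F.relaxMap_mul a u⟩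
  · obtain ⟨ω, f, hf, hω⟩ := F.exists_tendsto_d_of_mem_relaxedDomain hF g
    exact ⟨ω, F.relaxMap_eq_of_tendsto hf hω⟩

theorem mem_zeroModule_of_relaxMap_eq_zero (hF : F.WeaklyReflexive) {v : F.Mod}
    (h : F.relaxMap v = 0) : v ∈ F.zeroModule := by
  have h1 : ‖(Submodule.Quotient.mk v : F.Mod ⧸ F.zeroModule)‖ = 0 := by
    rw [← F.norm_relaxMap hF, h, norm_zero]
  have h2 : v ∈ closure (F.zeroModule.toAddSubgroup : Set F.Mod) :=
    QuotientAddGroup.norm_mk_eq_zero_iff_mem_closure.1 h1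
  exact F.isClosed_zeroModule.closure_subset h2

/-- The quotient by `zeroModule` is isometric to the module generated by the relaxation. -/
noncomputable def quotientRelaxEquiv (hF : F.WeaklyReflexive) :
    (F.Mod ⧸ F.zeroModule) ≃ₗᵢ[ℝ] F.relaxed.Mod where
  toLinearEquiv := LinearEquiv.ofBijective (F.quotientRelaxMap hF).toLinearMap <| by
    refine ⟨LinearMap.ker_eq_bot.1 (eq_bot_iff.2 fun x hx => ?_), fun y => ?_⟩
    · obtain ⟨v, rfl⟩ := Submodule.Quotient.mk_surjective _ x
      exact (Submodule.Quotient.mk_eq_zero _).2 (F.mem_zeroModule_of_relaxMap_eq_zero hF hx)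
    · obtain ⟨v, rfl⟩ := F.relaxMap_surjective hF y
      exact ⟨Submodule.Quotient.mk v, rfl⟩
  norm_map' := (F.quotientRelaxMap hF).norm_map

/-- Both sides say that `zeroSet` is trivial: one direction compares with the zero sequence, the
other subtracts two sequences with the same limit. -/
theorem closable_iff : F.Closable ↔ F.zeroModule = ⊥ := by
  constructor
  · intro h
    refine eq_bot_iff.2 (F.zeroModule_le ?_ (fun a v hv => ?_) ?_)
    · exact isClosed_singleton
    · rw [Submodule.mem_bot] at hv ⊢
      rw [hv, map_zero]
    · rintro ω ⟨f, hf, hω⟩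
      refine h f (fun _ => 0) 0 ω 0 hf hω ?_ ?_
      · have := F.tendstoAE_const 0
        rw [map_zero] at this
        exact TendstoL0.of_ae this
      · rw [map_zero]
        exact tendsto_const_nhds
  · intro h f k g ω η hf hω hk hη
    obtain ⟨φ, hφ, hφ'⟩ := hf.exists_subseq_ae
    have hk' : TendstoL0 (fun n => F.toL0 (k (φ n))) g := fun E hE hE' ε hε =>
      (hk E hE hE' ε hε).comp hφ.tendsto_atTop
    -- Successive extraction makes both sequences converge a.e. along `φ ∘ ψ`, where the limits can
    -- be subtracted.
    obtain ⟨ψ, hψ, hψ'⟩ := hk'.exists_subseq_ae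
    have hmem : ω - η ∈ F.zeroSet := by
      refine ⟨fun n => f (φ (ψ n)) - k (φ (ψ n)), TendstoL0.of_ae ?_, ?_⟩
      · have h1 : F.TendstoAE (fun n => f (φ (ψ n))) g :=
          TendstoAE.subseq F (f := fun n => f (φ n)) hφ' hψ
        have h2 : F.TendstoAE (fun n => k (φ (ψ n))) g := hψ'
        have h3 := h1.add F (h2.const_smul F (-1))
        simpa [sub_eq_add_neg, TendstoAE] using h3
      · have h1 := (hφ.comp hψ).tendsto_atTop
        simp only [map_sub]
        exact (hω.comp h1).sub (hη.comp h1)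
    have := F.zeroSet_subset_zeroModule hmem
    rw [h, Submodule.mem_bot, sub_eq_zero] at this
    exact this

theorem pnorm_relaxMap_of_closable (hF : F.WeaklyReflexive) (hcl : F.Closable) (v : F.Mod) :
    F.relaxed.pnorm (F.relaxMap v) = F.pnorm v := by
  refine le_antisymm (F.pnorm_relaxMap_le v) ((F.isGLB_pnorm_relaxMap hF v).2 ?_)
  rintro _ ⟨⟨w, hw⟩, rfl⟩
  rw [F.closable_iff.1 hcl, Submodule.mem_bot] at hw
  simp only [hw, add_zero, le_refl]

end Quotient

end LpFunctional

end NormedModules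

/-! ### Truncation and cut-off of Lipschitz functions. -/

namespace NormedModules

section Metric

variable {M : Type*} [MetricSpace M]

theorem locLip_le_add_of_eventually {f g : M → ℝ} (hf : IsLipschitz f) (hg : IsLipschitz g) {x : M}
    {C : ℝ} (hC : 0 ≤ C) (h : ∀ᶠ y in 𝓝 x, |f y - f x| ≤ C * dist y x + |g y - g x|) :
    locLip f x ≤ C + locLip g x := by
  rw [locLip_le_iff hf x (add_nonneg hC (locLip_nonneg hg x))]
  intro ε hε
  filter_upwards [(locLip_le_iff hg x (locLip_nonneg hg x)).1 le_rfl ε hε,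
    mem_nhdsWithin_of_mem_nhds h] with y h1 h2
  calc _ ≤ C * dist y x + (locLip g x + ε) * dist y x := h2.trans (by gcongr)
    _ = _ := by ring

theorem locLip_le_of_lipschitzWith {f : M → ℝ} {K : ℝ≥0} (hf : LipschitzWith K f) (x : M) :
    locLip f x ≤ K := by
  refine (locLip_le_iff ⟨K, hf⟩ x K.2).2 fun ε hε => Eventually.of_forall fun y => ?_
  rw [← Real.dist_eq]
  refine (hf.dist_le_mul y x).trans (mul_le_mul_of_nonneg_right ?_ dist_nonneg)
  exact le_add_of_nonneg_right hε.le

theorem locLip_congr {f g : M → ℝ} {x : M} (h : ∀ᶠ y in 𝓝 x, f y - f x = g y - g x) :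
    locLip f x = locLip g x := by
  refine limsup_congr (mem_nhdsWithin_of_mem_nhds ?_)
  filter_upwards [h] with y hy
  rw [hy]

theorem locLip_eq_zero_of_eventually {f : M → ℝ} {x : M} (h : ∀ᶠ y in 𝓝 x, f y = f x) :
    locLip f x = 0 := by
  have h1 : locLip f x = locLip (0 : M → ℝ) x := locLip_congr (by
    filter_upwards [h] with y hy
    simp [hy])
  rw [h1]
  simpa using locLip_smul (IsLipschitz.zero (M := M)) 0 x

theorem IsLipschitz.sub {f h : M → ℝ} (hf : IsLipschitz f) (hh : IsLipschitz h) :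
    IsLipschitz (fun x => f x - h x) := by
  obtain ⟨K, hK⟩ := hf
  obtain ⟨L, hL⟩ := hh
  exact ⟨K + L, hK.sub hL⟩

/-- The truncation of a real number to `[-1, 1]`. -/
def clamp (t : ℝ) : ℝ := max (-1) (min 1 t)

theorem abs_clamp_le_one (t : ℝ) : |clamp t| ≤ 1 :=
  abs_le.2 ⟨le_max_left _ _, max_le (by norm_num) (min_le_left _ _)⟩

theorem clamp_of_abs_le {t : ℝ} (h : |t| ≤ 1) : clamp t = t := by
  rw [clamp, min_eq_right (abs_le.1 h).2, max_eq_right (abs_le.1 h).1]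

theorem abs_clamp_sub_le (s t : ℝ) : |clamp s - clamp t| ≤ |s - t| := by
  unfold clamp
  refine (abs_max_sub_max_le_max _ _ _ _).trans ?_
  rw [sub_self, abs_zero]
  refine max_le (abs_nonneg _) ((abs_min_sub_min_le_max _ _ _ _).trans ?_)
  rw [sub_self, abs_zero]
  exact max_le (abs_nonneg _) le_rfl

theorem abs_clamp_le (t : ℝ) : |clamp t| ≤ |t| := by
  have := abs_clamp_sub_le t 0
  rwa [clamp_of_abs_le (t := 0) (by simp), sub_zero, sub_zero] at this

/-- A cut-off function, equal to `1` on the ball of radius `r` and to `0` off the ball of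
radius `2 r`. -/
noncomputable def cutoff (x₀ : M) (r : ℝ) (y : M) : ℝ := max 0 (min 1 (2 - r⁻¹ * dist y x₀))

theorem abs_cutoff_le (x₀ : M) (r : ℝ) (y : M) : |cutoff x₀ r y| ≤ 1 :=
  abs_le.2 ⟨le_trans (by norm_num) (le_max_left _ _), max_le (by norm_num) (min_le_left _ _)⟩

theorem cutoff_eq_one {x₀ y : M} {r : ℝ} (hr : 0 < r) (h : dist y x₀ ≤ r) : cutoff x₀ r y = 1 := by
  have h1 : r⁻¹ * dist y x₀ ≤ 1 := by rwa [inv_mul_le_iff₀ hr, mul_one]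
  rw [cutoff, min_eq_left (by linarith), max_eq_right zero_le_one]

theorem cutoff_eq_zero {x₀ y : M} {r : ℝ} (hr : 0 < r) (h : 2 * r ≤ dist y x₀) :
    cutoff x₀ r y = 0 := by
  have h1 : 2 ≤ r⁻¹ * dist y x₀ := by rwa [le_inv_mul_iff₀ hr, mul_comm]
  exact max_eq_left ((min_le_right _ _).trans (by linarith))

theorem abs_cutoff_sub_le (x₀ : M) {r : ℝ} (hr : 0 < r) (y x : M) :
    |cutoff x₀ r y - cutoff x₀ r x| ≤ r⁻¹ * dist y x := by
  unfold cutoff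
  refine (abs_max_sub_max_le_max _ _ _ _).trans ?_
  rw [sub_self, abs_zero]
  refine max_le (by positivity) ((abs_min_sub_min_le_max _ _ _ _).trans ?_)
  rw [sub_self, abs_zero]
  refine max_le (by positivity) ?_
  have : 2 - r⁻¹ * dist y x₀ - (2 - r⁻¹ * dist x x₀) = r⁻¹ * (dist x x₀ - dist y x₀) := by ring
  rw [this, abs_mul, abs_of_pos (inv_pos.2 hr), dist_comm y x]
  exact mul_le_mul_of_nonneg_left (abs_dist_sub_le x y x₀) (inv_pos.2 hr).le

/-- The localized truncation of `k`. -/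
noncomputable def bump (x₀ : M) (r : ℝ) (k : M → ℝ) (y : M) : ℝ := cutoff x₀ r y * clamp (k y)

theorem abs_bump_le (x₀ : M) (r : ℝ) (k : M → ℝ) (y : M) : |bump x₀ r k y| ≤ |k y| := by
  rw [bump, abs_mul]
  exact (mul_le_of_le_one_left (abs_nonneg _) (abs_cutoff_le x₀ r y)).trans (abs_clamp_le _)

theorem bump_eq {x₀ y : M} {r : ℝ} (hr : 0 < r) {k : M → ℝ} (h : dist y x₀ ≤ r) (hk : |k y| ≤ 1) :
    bump x₀ r k y = k y := by
  rw [bump, cutoff_eq_one hr h, one_mul, clamp_of_abs_le hk]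

/-- Product rule: both factors are bounded by `1`, the cut-off is `r⁻¹`-Lipschitz, and clamping does
not increase differences. -/
theorem abs_bump_sub_le (x₀ : M) {r : ℝ} (hr : 0 < r) (k : M → ℝ) (y x : M) :
    |bump x₀ r k y - bump x₀ r k x| ≤ r⁻¹ * dist y x + |k y - k x| := by
  have : bump x₀ r k y - bump x₀ r k x = (cutoff x₀ r y - cutoff x₀ r x) * clamp (k y) +
      cutoff x₀ r x * (clamp (k y) - clamp (k x)) := by unfold bump; ring
  rw [this]
  refine (abs_add_le _ _).trans (add_le_add ?_ ?_)
  · rw [abs_mul]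
    exact (mul_le_of_le_one_right (abs_nonneg _) (abs_clamp_le_one _)).trans
      (abs_cutoff_sub_le x₀ hr y x)
  · rw [abs_mul]
    exact (mul_le_of_le_one_left (abs_nonneg _) (abs_cutoff_le x₀ r x)).trans
      (abs_clamp_sub_le _ _)

theorem isLipschitz_bump (x₀ : M) {r : ℝ} (hr : 0 < r) {k : M → ℝ} (hk : IsLipschitz k) :
    IsLipschitz (bump x₀ r k) := by
  obtain ⟨K, hK⟩ := hk
  refine ⟨r⁻¹.toNNReal + K, LipschitzWith.of_dist_le_mul fun y x => ?_⟩
  rw [Real.dist_eq, NNReal.coe_add, Real.coe_toNNReal _ (inv_pos.2 hr).le, _root_.add_mul]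
  refine (abs_bump_sub_le x₀ hr k y x).trans (add_le_add le_rfl ?_)
  rw [← Real.dist_eq]
  exact hK.dist_le_mul y x

theorem locLip_bump_le (x₀ : M) {r : ℝ} (hr : 0 < r) {k : M → ℝ} (hk : IsLipschitz k) (x : M) :
    locLip (bump x₀ r k) x ≤ r⁻¹ + locLip k x :=
  locLip_le_add_of_eventually (isLipschitz_bump x₀ hr hk) hk (inv_pos.2 hr).le
    (Eventually.of_forall fun y => abs_bump_sub_le x₀ hr k y x)

theorem locLip_bump_eq_zero {x₀ x : M} {r : ℝ} (hr : 0 < r) {k : M → ℝ}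
    (hx : x ∉ Metric.ball x₀ (3 * r)) : locLip (bump x₀ r k) x = 0 := by
  rw [Metric.mem_ball, not_lt] at hx
  have h0 : ∀ y, 2 * r ≤ dist y x₀ → bump x₀ r k y = 0 := fun y hy => by
    rw [bump, cutoff_eq_zero hr hy, zero_mul]
  -- The function vanishes beyond distance `2 r` from `x₀`, hence on the ball of radius `r` about
  -- `x`.
  refine locLip_eq_zero_of_eventually ?_
  filter_upwards [Metric.ball_mem_nhds x hr] with y hy
  rw [h0 x (by linarith), h0 y]
  have := dist_triangle x y x₀
  rw [Metric.mem_ball, dist_comm] at hy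
  linarith

variable [MeasurableSpace M] [BorelSpace M] {μ : Measure M} {p : ℝ≥0} [Fact (1 < p)]

/-- The reason for the cut-off: the local constant becomes bounded and supported in a ball of finite
measure, so no integrability of `locLip k` is required. -/
theorem bump_mem_lipDomain (x₀ : M) {r : ℝ} (hr : 0 < r) (hfin : μ (Metric.ball x₀ (3 * r)) ≠ ∞)
    {k : M → ℝ} (hk : IsLipschitz k) : bump x₀ r k ∈ lipDomain μ p := by
  have hb := isLipschitz_bump x₀ hr hk
  refine ⟨hb, ?_⟩
  obtain ⟨K, hK⟩ := hb
  refine (memLp_indicator_const (p : ℝ≥0∞) (measurableSet_ball (x := x₀) (ε := 3 * r)) (K : ℝ)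
    (Or.inr hfin)).mono (measurable_locLip ⟨K, hK⟩).aestronglyMeasurable (ae_of_all _ fun x => ?_)
  rw [Real.norm_of_nonneg (locLip_nonneg ⟨K, hK⟩ x)]
  by_cases hx : x ∈ Metric.ball x₀ (3 * r)
  · rw [indicator_of_mem hx]
    exact (locLip_le_of_lipschitzWith hK x).trans (le_abs_self _)
  · rw [locLip_bump_eq_zero hr hx]
    exact norm_nonneg _

theorem lipVal_bump_le (x₀ : M) {r : ℝ} (hr : 0 < r) (hfin : μ (Metric.ball x₀ (3 * r)) ≠ ∞)
    {k : M → ℝ} (hk : IsLipschitz k) {C : ℝ} {v : Lp ℝ p μ} (hv : 0 ≤ v)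
    (h : ∀ᵐ x ∂μ, locLip k x ≤ v x + C) :
    lipVal (μ := μ) (p := p) ⟨bump x₀ r k, bump_mem_lipDomain x₀ hr hfin hk⟩ ≤
      v + indicatorConstLp (p : ℝ≥0∞) (measurableSet_ball (x := x₀) (ε := 3 * r)) hfin
        (r⁻¹ + C) := by
  rw [← Lp.coeFn_le]
  rw [← Lp.coeFn_nonneg] at hv
  filter_upwards [coeFn_lipVal (μ := μ) (p := p) ⟨bump x₀ r k, bump_mem_lipDomain x₀ hr hfin hk⟩,
    Lp.coeFn_add v (indicatorConstLp (p : ℝ≥0∞) (measurableSet_ball (x := x₀) (ε := 3 * r)) hfin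
        (r⁻¹ + C)), hv, h, indicatorConstLp_coeFn (p := (p : ℝ≥0∞)) (c := r⁻¹ + C)
        (hs := measurableSet_ball (x := x₀) (ε := 3 * r)) (hμs := hfin)] with x h1 h2 h3 h4 h5
  rw [h1, h2, Pi.add_apply, h5]
  by_cases hx : x ∈ Metric.ball x₀ (3 * r)
  · rw [indicator_of_mem hx]
    have := locLip_bump_le x₀ hr hk x
    linarith
  · rw [indicator_of_notMem hx, add_zero]
    exact (locLip_bump_eq_zero hr hx).trans_le h3

end Metric

end NormedModules

/-! ### The relaxed slope of a Lipschitz function when `d` is closable. -/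

namespace NormedModules

section Metric

variable {M : Type*} [MetricSpace M] [MeasurableSpace M] [BorelSpace M] {μ : Measure M} {p : ℝ≥0}
  [Fact (1 < p)] [SigmaFinite μ]

theorem lipFunctional_val (f : lipDomain μ p) : (lipFunctional μ p).val f = lipVal f := rfl

theorem coeFn_lipFunctional_toL0 (f : lipDomain μ p) :
    (lipFunctional μ p).toL0 f =ᵐ[μ] (f : M → ℝ) :=
  AEEqFun.coeFn_mk _ _

theorem tendstoAE_lipFunctional_iff {f : ℕ → lipDomain μ p} {g : M →ₘ[μ] ℝ} :
    (lipFunctional μ p).TendstoAE f g ↔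
      ∀ᵐ x ∂μ, Tendsto (fun n => (f n : M → ℝ) x) atTop (𝓝 (g x)) := by
  have h := ae_all_iff.2 fun n => coeFn_lipFunctional_toL0 (f n)
  constructor <;> intro h' <;> filter_upwards [h, h'] with x h1 h2
  · simpa only [h1] using h2
  · simpa only [h1] using h2

/-- If `d` is closable, then a limit `ω` of differentials along a sequence converging to a
Lipschitz function `f` satisfies `|ω| = lip f` locally. -/
theorem pnorm_eq_locLip_on_ball (hF : (lipFunctional μ p).WeaklyReflexive)
    (hcl : (lipFunctional μ p).Closable) {f : M → ℝ} {L : ℝ≥0} (hf : LipschitzWith L f)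
    {h : ℕ → lipDomain μ p} {ω : LipschitzModule μ p}
    (hh : ∀ᵐ x ∂μ, Tendsto (fun n => (h n : M → ℝ) x) atTop (𝓝 (f x)))
    (hω : Tendsto (fun n => (lipFunctional μ p).d (h n)) atTop (𝓝 ω))
    (x₀ : M) {r : ℝ} (hr : 0 < r) (hLr : L * r < 1) (hfin : μ (Metric.ball x₀ (3 * r)) ≠ ∞) :
    ∀ᵐ x ∂μ, x ∈ Metric.ball x₀ r → (lipFunctional μ p).pnorm ω x = locLip f x := by
  set F := lipFunctional μ p with hFdef
  set U := Metric.ball x₀ r with hUdef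
  have hU : MeasurableSet U := measurableSet_ball
  have hk : ∀ n, IsLipschitz fun x => (h n : M → ℝ) x - f x := fun n =>
    (isLipschitz_coe (h n)).sub ⟨L, hf⟩
  have hk₀ : IsLipschitz fun x => f x - f x₀ :=
    IsLipschitz.sub ⟨L, hf⟩ ⟨0, LipschitzWith.const _⟩
  -- On the ball, `u n` is `h n - f` wherever the latter is below `1` in absolute value, and `f'` is
  -- `f - f x₀`. Unlike `f`, both are in the domain of `d`.
  set u : ℕ → lipDomain μ p := fun n => ⟨_, bump_mem_lipDomain x₀ hr hfin (hk n)⟩ with hu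
  set f' : lipDomain μ p := ⟨_, bump_mem_lipDomain x₀ hr hfin hk₀⟩ with hf'
  set κ : Lp ℝ p μ := indicatorConstLp (p : ℝ≥0∞) (measurableSet_ball (x := x₀) (ε := 3 * r)) hfin
        (r⁻¹ + L) with hκ
  have hvu : ∀ n, F.val (u n) ≤ F.val (h n) + κ := fun n => by
    refine lipVal_bump_le x₀ hr hfin (hk n) (F.nonneg' _) ?_
    filter_upwards [coeFn_lipVal (h n)] with x hx
    rw [lipFunctional_val, hx, add_comm]
    refine locLip_le_add_of_eventually (hk n) (isLipschitz_coe _) L.2 (Eventually.of_forall ?_)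
    intro y
    have e : (h n : M → ℝ) y - f y - ((h n : M → ℝ) x - f x) =
      -(f y - f x) + ((h n : M → ℝ) y - (h n : M → ℝ) x) := by ring
    rw [e]
    refine (abs_add_le _ _).trans (add_le_add ?_ le_rfl)
    rw [abs_neg, ← Real.dist_eq]
    exact hf.dist_le_mul y x
  have hvf' : F.val f' ≤ κ := by
    have := lipVal_bump_le (μ := μ) (p := p) x₀ hr hfin hk₀ (C := L) (v := 0) le_rfl (by
      filter_upwards [Lp.coeFn_zero ℝ p μ] with x hx
      rw [hx, Pi.zero_apply, zero_add]
      rw [show locLip (fun x => f x - f x₀) x = locLip f x from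
        locLip_congr (Eventually.of_forall fun y => by ring)]
      exact locLip_le_of_lipschitzWith hf x)
    rwa [zero_add] at this
  -- the truncations converge weakly to zero
  have hu0 : F.TendstoAE u 0 := by
    rw [tendstoAE_lipFunctional_iff]
    filter_upwards [hh, AEEqFun.coeFn_zero (μ := μ) (β := ℝ)] with x h1 h2
    rw [h2, Pi.zero_apply]
    refine squeeze_zero_norm (fun n => abs_bump_le x₀ r (fun x => (h n : M → ℝ) x - f x) x) ?_
    simpa using (h1.sub_const (f x)).abs
  obtain ⟨C, hC⟩ := hω.norm.bddAbove_range
  have hub : ∀ n, ‖F.val (u n)‖ ≤ C + ‖κ‖ := fun n => by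
    refine (LpFunctional.norm_mono (F.nonneg' _) (hvu n)).trans ((norm_add_le _ _).trans ?_)
    rw [← F.norm_d]
    exact add_le_add (hC ⟨n, rfl⟩) le_rfl
  obtain ⟨φ, ω₀, hφ, hω₀⟩ := hF.exists_tendstoWeakly F hu0 hub
  obtain ⟨z, hz, hzω⟩ := F.exists_tendsto_d (hu0.subseq F hφ) hω₀
  have hω₀0 : ω₀ = 0 := by
    have := F.zeroSet_subset_zeroModule ⟨z, TendstoL0.of_ae hz, hzω⟩
    rwa [F.closable_iff.1 hcl, Submodule.mem_bot] at this
  -- the error `u n - (h n - f')` is locally constant where `h n` is close to `f`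
  set S : ℕ → Set M := fun n => U ∩ {x | 1 ≤ |(h n : M → ℝ) x - f x|} with hSdef
  have hS : ∀ n, MeasurableSet (S n) := fun n =>
    hU.inter (isClosed_le continuous_const (hk n).choose_spec.continuous.abs).measurableSet
  -- Majorant for the error: its value is at most `2 lip (h n) + 2 κ`, and `lip (h n) ≤ |ω| + |d (h
  -- n) - ω|`. The last term is kept apart since it tends to `0`.
  set w : Lp ℝ p μ := (2 : ℝ) • F.pnorm ω + (2 : ℝ) • κ with hw
  choose e he using fun n => LpFunctional.exists_indicator_Lp (hS n) w
  have he0 : Tendsto e atTop (𝓝 0) := by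
    refine tendsto_zero_of_dominated w (fun n => ?_) ?_
    · filter_upwards [he n] with x hx
      rw [hx]
      by_cases hxS : x ∈ S n <;> simp [hxS]
    · filter_upwards [ae_all_iff.2 he, hh] with x h1 h2
      refine tendsto_const_nhds.congr' ?_
      have h3 := (h2.sub_const (f x)).abs
      rw [sub_self, abs_zero] at h3
      filter_upwards [h3.eventually_lt_const one_pos] with n hn
      rw [h1, indicator_of_notMem fun hx => absurd hx.2 (not_le.2 hn)]
  set q : ℕ → lipDomain μ p := fun n => u n - h n + f' with hq
  have hvq : ∀ n, F.val (q n) ≤ (2 : ℝ) • F.pnorm (F.d (h n) - ω) + w := fun n => by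
    have h1 : F.val (-h n) = F.val (h n) := by
      have := F.smul' (-1) (h n)
      simpa using this
    have h2 : F.val (h n) ≤ F.pnorm ω + F.pnorm (F.d (h n) - ω) := by
      rw [← F.pnorm_d]
      exact F.pnorm_le_add_sub _ _
    calc F.val (q n) ≤ F.val (u n) + F.val (-h n) + F.val f' := by
          simp only [hq, sub_eq_add_neg]
          exact (F.add_le' _ _).trans (add_le_add (F.add_le' _ _) le_rfl)
      _ ≤ (F.val (h n) + κ) + F.val (h n) + κ := by
          rw [h1]
          exact add_le_add (add_le_add (hvu n) le_rfl) hvf'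
      _ = (2 : ℝ) • F.val (h n) + (2 : ℝ) • κ := by
          rw [two_smul, two_smul]; abel
      _ ≤ (2 : ℝ) • (F.pnorm ω + F.pnorm (F.d (h n) - ω)) + (2 : ℝ) • κ :=
          add_le_add (LpFunctional.smul_le_smul_Lp (by norm_num) h2) le_rfl
      _ = _ := by rw [hw, smul_add]; abel
  -- `L r < 1` keeps the truncation of `f - f x₀` inactive on `U`.
  have hfU : ∀ y ∈ U, |f y - f x₀| ≤ 1 := fun y hy => by
    rw [← Real.dist_eq]
    refine (hf.dist_le_mul y x₀).trans (le_trans ?_ hLr.le)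
    exact mul_le_mul_of_nonneg_left (Metric.mem_ball.1 hy).le L.2
  have hUo : ∀ x ∈ U, U ∈ 𝓝 x := fun x hx => Metric.isOpen_ball.mem_nhds hx
  have hq0 : ∀ n, ∀ x ∈ U, x ∉ S n → locLip (q n : M → ℝ) x = 0 := fun n x hx hxS => by
    have hlt : |(h n : M → ℝ) x - f x| < 1 := not_le.1 fun h1 => hxS ⟨hx, h1⟩
    have hcont : Continuous fun y => |(h n : M → ℝ) y - f y| :=
      (hk n).choose_spec.continuous.abs
    -- Here `u n - h n + f' = (h n - f) - h n + (f - f x₀)`, a constant.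
    have hval : ∀ y ∈ U, |(h n : M → ℝ) y - f y| < 1 → (q n : M → ℝ) y = -f x₀ :=
        fun y hy hy1 => by
      change bump x₀ r (fun x => (h n : M → ℝ) x - f x) y - (h n : M → ℝ) y +
        bump x₀ r (fun x => f x - f x₀) y = _
      have hyr := (Metric.mem_ball.1 hy).le
      rw [bump_eq hr hyr hy1.le, bump_eq hr hyr (hfU y hy)]
      ring
    refine locLip_eq_zero_of_eventually ?_
    filter_upwards [hUo x hx, hcont.continuousAt.eventually_lt_const hlt] with y h1 h2
    rw [hval y h1 h2, hval x hx hlt]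
  set c : ℕ → Lp ℝ p μ := fun n => (2 : ℝ) • F.pnorm (F.d (h n) - ω) + e n with hc
  have hqc : ∀ n, F.pnorm (F.mul (LpFunctional.chi μ U hU) (F.d (q n))) ≤ c n := fun n => by
    rw [← Lp.coeFn_le]
    have h1 := F.pnorm_mul_chi hU (F.d (q n))
    rw [F.pnorm_d] at h1
    filter_upwards [h1, coeFn_lipVal (q n), he n, (Lp.coeFn_le _ _).2 (hvq n),
      Lp.coeFn_add ((2 : ℝ) • F.pnorm (F.d (h n) - ω)) (e n),
      Lp.coeFn_add ((2 : ℝ) • F.pnorm (F.d (h n) - ω)) w,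
      Lp.coeFn_smul (2 : ℝ) (F.pnorm (F.d (h n) - ω)),
      F.ae_pnorm_nonneg (F.d (h n) - ω)] with x h2 h3 h4 h5 h6 h7 h8 h9
    rw [h2, h6, Pi.add_apply, h4, h8]
    rw [h7, Pi.add_apply, h8] at h5
    have h10 : 0 ≤ ((2 : ℝ) • (F.pnorm (F.d (h n) - ω) : M → ℝ)) x := by
      rw [Pi.smul_apply, smul_eq_mul]
      positivity
    by_cases hxU : x ∈ U
    · rw [indicator_of_mem hxU]
      by_cases hxS : x ∈ S n
      · rwa [indicator_of_mem hxS]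
      · rw [indicator_of_notMem hxS, add_zero, lipFunctional_val, h3, hq0 n x hxU hxS]
        exact h10
    · rw [indicator_of_notMem hxU, indicator_of_notMem fun hx => hxU hx.1, add_zero]
      exact h10
  have hc0 : Tendsto c atTop (𝓝 0) := by
    have h1 : Tendsto (fun n => F.pnorm (F.d (h n) - ω)) atTop (𝓝 (F.pnorm (ω - ω))) :=
      (F.continuous_pnorm.tendsto _).comp (hω.sub_const ω)
    rw [sub_self, F.pnorm_zero] at h1
    simpa using (h1.const_smul (2 : ℝ)).add he0
  have hlim : TendstoWeakly (fun n => F.mul (LpFunctional.chi μ U hU) (F.d (q (φ n))))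
      (F.mul (LpFunctional.chi μ U hU) (ω₀ - ω + F.d f')) := by
    refine TendstoWeakly.map ?_ _
    have h1 := (hω₀.sub (hω.comp hφ.tendsto_atTop).tendstoWeakly).add
      (tendsto_const_nhds (x := F.d f')).tendstoWeakly
    simp only [hq, map_add, map_sub]
    exact h1
  -- The differentials of `q (φ n)` restricted to `U` tend to `0` in norm and weakly to the
  -- restriction of `ω₀ - ω + d f'`; as `ω₀ = 0`, `ω` and `d f'` agree on `U`.
  have hfinal : F.mul (LpFunctional.chi μ U hU) ω = F.mul (LpFunctional.chi μ U hU) (F.d f') := by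
    have h1 := F.pnorm_le_of_tendstoWeakly hlim (hc0.comp hφ.tendsto_atTop).tendstoWeakly
      fun n => hqc (φ n)
    have h2 := F.pnorm_eq_zero.1 (le_antisymm h1 (F.pnorm_nonneg _))
    rw [hω₀0, zero_sub, map_add, map_neg, neg_add_eq_zero] at h2
    exact h2
  have h1 := F.coeFn_pnorm_eq_of_mul_chi_eq hU hfinal
  rw [F.pnorm_d] at h1
  filter_upwards [h1, coeFn_lipVal f'] with x h2 h3 hx
  rw [h2 hx, lipFunctional_val, h3]
  refine locLip_congr ?_
  filter_upwards [hUo x hx] with y hy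
  have hb : ∀ y ∈ U, (f' : M → ℝ) y = f y - f x₀ := fun y hy =>
    bump_eq (k := fun x => f x - f x₀) hr (Metric.mem_ball.1 hy).le (hfU y hy)
  rw [hb y hy, hb x hx]
  ring

/-- The relaxed slope is `|ω|` for a strong limit `ω` of differentials along a sequence tending to
`f`, and `|ω| = lip f` on all small balls. An exceptional set of positive measure would contain a
compact set of positive measure, which is null near each of its points. -/
theorem relaxedSlope_eq_locLip [IsLocallyFiniteMeasure μ] [μ.InnerRegular]
    (hF : (lipFunctional μ p).WeaklyReflexive) (hcl : (lipFunctional μ p).Closable) {f : M → ℝ}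
    (g : (lipFunctional μ p).relaxedDomain) (hf : IsLipschitz f) (hg : (g : M →ₘ[μ] ℝ) =ᵐ[μ] f) :
    (relaxedSlope μ p).val g =ᵐ[μ] locLip f := by
  obtain ⟨L, hL⟩ := id hf
  obtain ⟨ω, h, hh, hω⟩ :=
    (lipFunctional μ p).exists_tendsto_d_of_mem_relaxedDomain hF g
  have hval : (relaxedSlope μ p).val g = (lipFunctional μ p).pnorm ω := by
    rw [← LpFunctional.pnorm_d, ← (lipFunctional μ p).relaxMap_eq_of_tendsto hh hω]
    exact (lipFunctional μ p).pnorm_relaxMap_of_closable hF hcl ω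
  have hh' : ∀ᵐ x ∂μ, Tendsto (fun n => (h n : M → ℝ) x) atTop (𝓝 (f x)) := by
    filter_upwards [tendstoAE_lipFunctional_iff.1 hh, hg] with x h1 h2
    rwa [h2] at h1
  rw [hval]
  set E := {x | (lipFunctional μ p).pnorm ω x ≠ locLip f x} with hE
  have hEm : MeasurableSet E :=
    (measurableSet_eq_fun (Lp.stronglyMeasurable _).measurable (measurable_locLip hf)).compl
  change μ E = 0
  by_contra hne
  obtain ⟨K, hKE, hK, hpos⟩ := hEm.exists_lt_isCompact (pos_iff_ne_zero.2 hne)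
  refine hpos.ne' (hK.measure_zero_of_nhdsWithin fun x₀ _ => ?_)
  obtain ⟨s, hs, hsfin⟩ := μ.finiteAt_nhds x₀
  obtain ⟨R, hR, hRs⟩ := Metric.mem_nhds_iff.1 hs
  -- The first bound puts the ball of radius `3 r` in a set of finite measure, the second gives `L r
  -- < 1`.
  set r := min (R / 3) (1 / (2 * (L + 1))) with hr
  have hr0 : 0 < r := lt_min (by positivity) (by positivity)
  have hLr : L * r < 1 := by
    have h1 : r * (2 * (L + 1)) ≤ 1 := by
      rw [← le_div_iff₀ (by positivity)]
      exact min_le_right _ _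
    nlinarith [L.2]
  have hfin : μ (Metric.ball x₀ (3 * r)) ≠ ∞ := by
    refine ne_top_of_le_ne_top hsfin.ne (measure_mono ((Metric.ball_subset_ball ?_).trans hRs))
    have : r ≤ R / 3 := min_le_left _ _
    linarith
  refine ⟨Metric.ball x₀ r ∩ K, inter_mem (mem_nhdsWithin_of_mem_nhds (Metric.ball_mem_nhds x₀ hr0))
    self_mem_nhdsWithin, ?_⟩
  refine measure_mono_null ?_ (pnorm_eq_locLip_on_ball hF hcl hL hh' hω x₀ hr0 hLr hfin)
  rintro x ⟨hx, hxK⟩ hcontra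
  exact hKE hxK (hcontra hx)

end Metric

end NormedModules

/-! ### The theorem for the Lipschitz and cotangent modules. -/

theorem mainTheorem3 {M : Type*} [MetricSpace M] [CompleteSpace M] [MeasurableSpace M]
    [BorelSpace M] (μ : Measure M) [IsLocallyFiniteMeasure μ] [μ.InnerRegular] [SigmaFinite μ]
    (p : ℝ≥0) [Fact (1 < p)] (hrefl : (lipFunctional μ p).WeaklyReflexive) :
    -- the Lipschitz_0 module is a submodule of the Lipschitz module
    (lipFunctional μ p).IsLpNormedSubmodule (lipschitzZeroModule μ p) ∧
    -- the quotient is isometric to the cotangent module, as an `L^p`-normed module,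
    -- by the map that sends the class of `d_lip f` to `d_p f`
    (∃ Φ : (LipschitzModule μ p ⧸ lipschitzZeroModule μ p) ≃ₗᵢ[ℝ] CotangentModule μ p,
      (∀ f : lipDomain μ p,
        Φ (Submodule.Quotient.mk ((lipFunctional μ p).d f)) =
          (relaxedSlope μ p).d ((lipFunctional μ p).toRelaxed f)) ∧
      (∀ (a : Lp ℝ ∞ μ) (v : LipschitzModule μ p),
        Φ (Submodule.Quotient.mk ((lipFunctional μ p).mul a v)) =
          (relaxedSlope μ p).mul a (Φ (Submodule.Quotient.mk v))) ∧
      (∀ v : LipschitzModule μ p,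
        IsGLB (Set.range fun w : lipschitzZeroModule μ p => (lipFunctional μ p).pnorm (v + w))
          ((relaxedSlope μ p).pnorm (Φ (Submodule.Quotient.mk v))))) ∧
    -- closability of `d_lip`
    ((lipFunctional μ p).Closable ↔ lipschitzZeroModule μ p = ⊥) ∧
    ((lipFunctional μ p).Closable →
      (∃ Ψ : LipschitzModule μ p ≃ₗᵢ[ℝ] CotangentModule μ p,
        (∀ f : lipDomain μ p,
          Ψ ((lipFunctional μ p).d f) =
            (relaxedSlope μ p).d ((lipFunctional μ p).toRelaxed f)) ∧
        (∀ (a : Lp ℝ ∞ μ) (v : LipschitzModule μ p),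
          Ψ ((lipFunctional μ p).mul a v) = (relaxedSlope μ p).mul a (Ψ v)) ∧
        (∀ v : LipschitzModule μ p,
          (relaxedSlope μ p).pnorm (Ψ v) = (lipFunctional μ p).pnorm v)) ∧
      -- every Lipschitz function `f` with a relaxed slope satisfies `|Df|_{*,p} = lip f` a.e.
      (∀ (f : M → ℝ) (g : (lipFunctional μ p).relaxedDomain), IsLipschitz f →
        (g : M →ₘ[μ] ℝ) =ᵐ[μ] f → (relaxedSlope μ p).val g =ᵐ[μ] locLip f)) := by
  have hpn := (lipFunctional μ p).pnorm_relaxMap_of_closable hrefl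
  refine ⟨(lipFunctional μ p).isLpNormedSubmodule_zeroModule, ?_, (lipFunctional μ p).closable_iff,
    fun hcl => ⟨?_, fun f g hf hg => relaxedSlope_eq_locLip hrefl hcl g hf hg⟩⟩
  · refine ⟨(lipFunctional μ p).quotientRelaxEquiv hrefl, ?_, ?_, ?_⟩
    · exact (lipFunctional μ p).relaxMap_d
    · exact (lipFunctional μ p).relaxMap_mul
    · exact (lipFunctional μ p).isGLB_pnorm_relaxMap hrefl
  -- Under closability `relaxMap` preserves pointwise norms, so it is the isometry itself, with no
  -- passage to a quotient.
  · refine ⟨LinearIsometryEquiv.ofSurjective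
      ⟨(lipFunctional μ p).relaxMap.toLinearMap, fun v => ?_⟩
      ((lipFunctional μ p).relaxMap_surjective hrefl), ?_, ?_, ?_⟩
    · change ‖(lipFunctional μ p).relaxMap v‖ = ‖v‖
      rw [← LpFunctional.norm_pnorm, hpn hcl, LpFunctional.norm_pnorm]
    · exact (lipFunctional μ p).relaxMap_d
    · exact (lipFunctional μ p).relaxMap_mul
    · exact hpn hcl
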